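/- Let $2\le k\le n$ be integers, let $\sigma_m(\lambda)=\sum_{i_1<\dots<i_m}\lambda_{i_1}\cdots\lambda_{i_m}$ be the elementary symmetric functions on $\mathbb{R}^n$, and let $\overline\Gamma_k$ be the closure of the Gårding cone $\Gamma_k=\{\lambda\in\mathbb{R}^n:\sigma_m(\lambda)>0,\ m=1,\dots,k\}$. A $C^2$ function (respectively a $C^{1,1}$ function) $v$ is called $k$-convex in $\Omega$ if the eigenvalue vector $\lambda(D^2v(x))$ lies in $\overline\Gamma_k$ for every (respectively almost every) $x\in\Omega$. Let $\Omega\subset\mathbb{R}^n$ be a bounded domain, let $f>0$ satisfy $f^{1/(k-1)}\in C^{1,1}(\overline\Omega\times\mathbb{R})$, and let $u\in C^4(\overline\Omega)$ be a $k$-convex solution of the Dirichlet problem $$\sigma_k(\lambda(D^2u))=f(x,u)\ \text{ in }\Omega,\qquad u=\varphi\ \text{ on }\partial\Omega .$$ Assume that $\overline u\in C^{1,1}(\overline\Omega)$ is $k$-convex in $\Omega$ and that $$\overline u\ge u\ \text{ in }\Omega,\qquad \overline u=u\ \text{ on }\partial\Omega .$$ Then $$(\overline u-u)^{\alpha}\,|D^2u|\le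 C\quad\text{in }\Omega,$$ where $\alpha=k-1$ if $k>2$ and $\alpha=2$ if $k=2$. The constant $C$ depends only on $n$, $k$ and upper bounds for $\operatorname{diam}\Omega$, $\|u\|_{C^1(\overline\Omega)}$, $\|\overline u\|_{C^{1,1}(\overline\Omega)}$ and $\|f^{1/(k-1)}\|_{C^{1,1}(\overline\Omega\times[\inf_\Omega u,\,\sup_\Omega u])}$; in particular, it does not depend on a positive lower bound of $f$. -/

import Mathlib

open MeasureTheory Set
open scoped NNReal ENNReal

noncomputable section

namespace HessianPogorelov

/-- The `m`-th elementary symmetric function `σ_m` on `ℝⁿ`. -/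
def sigma {n : ℕ} (m : ℕ) (l : Fin n → ℝ) : ℝ :=
  ∑ s ∈ Finset.powersetCard m (Finset.univ : Finset (Fin n)), ∏ i ∈ s, l i

/-- Gårding's (open) cone `Γ_k`. -/
def gardingCone (n k : ℕ) : Set (Fin n → ℝ) :=
  {l | ∀ m : ℕ, 1 ≤ m → m ≤ k → 0 < sigma m l}

/-- The Hessian matrix `D²v(x) = (v_{ij}(x))`. -/
def hessian {n : ℕ} (v : EuclideanSpace ℝ (Fin n) → ℝ) (x : EuclideanSpace ℝ (Fin n)) :
    Matrix (Fin n) (Fin n) ℝ :=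
  Matrix.of fun i j =>
    fderiv ℝ (fderiv ℝ v) x (EuclideanSpace.single i 1) (EuclideanSpace.single j 1)

open Classical in
/-- The eigenvalues `λ(A)` of a real symmetric matrix, with multiplicity. (The value on
non-symmetric matrices plays no role: the Hessian is symmetric at every point of an open set where
the function is `C²`, and almost everywhere if the gradient is Lipschitz.) -/
def eigenvalues {n : ℕ} (A : Matrix (Fin n) (Fin n) ℝ) : Fin n → ℝ :=
  if h : A.IsHermitian then h.eigenvalues else 0

/-- The Euclidean (Frobenius) norm `|D²v(x)|`. -/
def hessianNorm {n : ℕ} (v : EuclideanSpace ℝ (Fin n) → ℝ) (x : EuclideanSpace ℝ (Fin n)) : ℝ :=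
  Real.sqrt (∑ i, ∑ j, hessian v x i j ^ 2)

/-- `k`-convexity of a `C²` function on `Ω`: `λ(D²v(x))` lies in the closure of `Γ_k` for every
`x ∈ Ω`. -/
def IsKConvexOn {n : ℕ} (k : ℕ) (v : EuclideanSpace ℝ (Fin n) → ℝ)
    (Ω : Set (EuclideanSpace ℝ (Fin n))) : Prop :=
  ∀ x ∈ Ω, eigenvalues (hessian v x) ∈ closure (gardingCone n k)

/-- `k`-convexity of a `C^{1,1}` function on `Ω`: its Hessian exists almost everywhere, and
`λ(D²v(x))` lies in the closure of `Γ_k` for almost every `x ∈ Ω`. -/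
def IsKConvexAEOn {n : ℕ} (k : ℕ) (v : EuclideanSpace ℝ (Fin n) → ℝ)
    (Ω : Set (EuclideanSpace ℝ (Fin n))) : Prop :=
  ∀ᵐ x ∂(volume.restrict Ω),
    DifferentiableAt ℝ (fderiv ℝ v) x ∧
      eigenvalues (hessian v x) ∈ closure (gardingCone n k)

section Norms

variable {E : Type*} [NormedAddCommGroup E] [NormedSpace ℝ E]

/-- The `C¹` norm `sup |w| + sup |Dw|` over `S`, as an extended nonnegative number. -/
def c1Norm (w : E → ℝ) (S : Set E) : ℝ≥0∞ :=
  (⨆ x ∈ S, ‖w x‖ₑ) + ⨆ x ∈ S, ‖fderiv ℝ w x‖ₑ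

/-- The `C^{1,1}` norm over `S`: the `C¹` norm plus the least Lipschitz constant of `Dw` on `S`
(in `ℝ≥0∞` one has `0 / 0 = 0`, so the diagonal does not contribute). -/
def c11Norm (w : E → ℝ) (S : Set E) : ℝ≥0∞ :=
  c1Norm w S + ⨆ x ∈ S, ⨆ y ∈ S, edist (fderiv ℝ w x) (fderiv ℝ w y) / edist x y

/-- `w ∈ C^{1,1}(closure U)` for an open set `U`. (A Lipschitz gradient on `U` extends
continuously to the closure.) -/
def MemC11 (w : E → ℝ) (U : Set E) : Prop :=
  ContDiffOn ℝ 1 w U ∧ ContinuousOn w (closure U) ∧ c11Norm w U < ∞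

/-- `w ∈ C^r(closure U)` for an open set `U`: `w` is `C^r` in `U`, and all derivatives of order at
most `r` extend continuously to the closure of `U`. -/
def MemCUpTo (r : ℕ) (w : E → ℝ) (U : Set E) : Prop :=
  ContDiffOn ℝ r w U ∧ ContinuousOn w (closure U) ∧
    ∀ m : ℕ, m ≤ r → ∃ g : E → ContinuousMultilinearMap ℝ (fun _ : Fin m => E) ℝ,
      ContinuousOn g (closure U) ∧ EqOn (iteratedFDeriv ℝ m w) g U

end Norms

/-- The function `f^{1/(k-1)}` of `(x, z)`. -/
def rootRHS {n : ℕ} (k : ℕ) (f : EuclideanSpace ℝ (Fin n) → ℝ → ℝ) :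
    EuclideanSpace ℝ (Fin n) × ℝ → ℝ :=
  fun p => f p.1 p.2 ^ (1 / ((k : ℝ) - 1))

/-- `f^{1/(k-1)} ∈ C^{1,1}(closure Ω × ℝ)`, where `C^{1,1}` is understood locally in the unbounded
variable `z`, that is, on `closure Ω × [-r, r]` for every `r`. -/
def RootIsC11 {n : ℕ} (k : ℕ) (f : EuclideanSpace ℝ (Fin n) → ℝ → ℝ)
    (Ω : Set (EuclideanSpace ℝ (Fin n))) : Prop :=
  ∀ r : ℝ, 0 < r → MemC11 (rootRHS k f) (Ω ×ˢ Ioo (-r) r)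

/-- `u` solves the Dirichlet problem `σ_k(λ(D²u)) = f(x, u)` in `Ω`, `u = φ` on `∂Ω`. -/
def SolvesDirichlet {n : ℕ} (k : ℕ) (f : EuclideanSpace ℝ (Fin n) → ℝ → ℝ)
    (φ : EuclideanSpace ℝ (Fin n) → ℝ) (u : EuclideanSpace ℝ (Fin n) → ℝ)
    (Ω : Set (EuclideanSpace ℝ (Fin n))) : Prop :=
  (∀ x ∈ Ω, sigma k (eigenvalues (hessian u x)) = f x (u x)) ∧ ∀ x ∈ frontier Ω, u x = φ x

/-- The exponent `α`: `2` for `k = 2` and `k - 1` for `k > 2`. -/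
def pogorelovExponent (k : ℕ) : ℕ := if k = 2 then 2 else k - 1

end HessianPogorelov

end

/-!
Consider a maximum point, over `x ∈ Ω` and unit vectors `v`, of Pogorelov's function
`(ubar - u)^m D²u(v,v) exp (B/2 |Du|² + A/2 |x - z|²)`. There `v` is an eigenvector of `D²u` for
the largest eigenvalue `λ₁`.

Since `ubar` is only `C^{1,1}`, its second derivatives are not available at the maximum point `x₀`.
But maximality says precisely that `ubar` is touched from above at `x₀` by the `C²` function
`u + w exp ((ψ - ψ x₀) / m)`, where `w = ubar - u` at `x₀` and `-ψ` is the logarithm of the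
remaining factors. The linearised operator `∑ᵢ ∂σ_k/∂λᵢ Dᵢᵢ` applied to `ubar` is nonnegative
almost everywhere because `ubar` is `k`-convex, and averaging over small balls transfers this to the
touching function. Letting the direction `v` rotate with `x` gives an additional good term in the
mixed third derivatives of `u`.

Write `f = g^(k-1)`. Differentiating `σ_k(D²u) = g^(k-1)` twice only ever produces derivatives of
`g`, and the negative terms are absorbed through the concavity of `(σ_k/ℓ)^(1/(k-1))`, with `ℓ` the
sum of the variables outside a set of `k - 2` indices; hence no positive lower bound of `f` enters.
The remaining third derivatives are controlled by Gårding's inequality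
`∂σ_k/∂λ_p ≥ c ∑ᵢ ∂σ_k/∂λᵢ` for `p ≥ k`. What is left is a bound for
`(ubar - u) λ₁^(1/(k-1))` at the maximum.
-/

noncomputable section

namespace HessianPogorelov

section Newton

open Polynomial

theorem splits_derivative {p : ℝ[X]} (hp : p.Splits) : (derivative p).Splits := by
  rw [splits_iff_card_roots] at hp ⊢
  have rolle := card_roots_le_derivative p
  have upper := (derivative p).card_roots'
  rcases Nat.eq_zero_or_pos p.natDegree with hdeg | hdeg
  · rw [eq_C_of_natDegree_eq_zero hdeg]
    simp
  · have := natDegree_derivative_lt (p := p) (by omega)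
    omega

theorem splits_iterate_derivative {p : ℝ[X]} (hp : p.Splits) (j : ℕ) :
    (derivative^[j] p).Splits := by
  induction j with
  | zero => exact hp
  | succ j ih =>
    rw [Function.iterate_succ_apply']
    exact splits_derivative ih

theorem splits_hasseDeriv {p : ℝ[X]} (hp : p.Splits) (j : ℕ) : (hasseDeriv j p).Splits := by
  have hj : (j.factorial : ℝ) ≠ 0 := by positivity
  have heq : hasseDeriv j p = C (j.factorial : ℝ)⁻¹ * derivative^[j] p := by
    rw [← factorial_smul_hasseDeriv, LinearMap.smul_apply, ← Nat.cast_smul_eq_nsmul ℝ, ← C_mul',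
      ← mul_assoc, ← C_mul, inv_mul_cancel₀ hj, C_1, one_mul]
  rw [heq]
  exact (Splits.C _).mul (splits_iterate_derivative hp j)

theorem two_mul_coeff_mul_coeff_le_sq_of_prod (s : Multiset ℝ) :
    2 * ((s.map fun a => X - C a).prod).coeff 0 * ((s.map fun a => X - C a).prod).coeff 2 ≤
      ((s.map fun a => X - C a).prod).coeff 1 ^ 2 := by
  induction s using Multiset.induction_on with
  | empty => simp [coeff_one]
  | cons a s ih =>
    rw [Multiset.map_cons, Multiset.prod_cons]
    set q := (s.map fun x => X - C x).prod
    have coeff_zero : ((X - C a) * q).coeff 0 = - a * q.coeff 0 := by simp [sub_mul]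
    have coeff_one : ((X - C a) * q).coeff 1 = q.coeff 0 - a * q.coeff 1 := by
      simp [sub_mul, coeff_X_mul q 0]
    have coeff_two : ((X - C a) * q).coeff 2 = q.coeff 1 - a * q.coeff 2 := by
      simp [sub_mul, coeff_X_mul q 1]
    rw [coeff_zero, coeff_one, coeff_two]
    nlinarith [sq_nonneg (q.coeff 0), mul_le_mul_of_nonneg_left ih (sq_nonneg a)]

theorem two_mul_coeff_mul_coeff_le_sq {p : ℝ[X]} (hp : p.Splits) :
    2 * p.coeff 0 * p.coeff 2 ≤ p.coeff 1 ^ 2 := by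
  rw [hp.eq_prod_roots]
  simp only [coeff_C_mul]
  nlinarith [mul_le_mul_of_nonneg_left (two_mul_coeff_mul_coeff_le_sq_of_prod p.roots)
    (sq_nonneg p.leadingCoeff)]

theorem coeff_mul_coeff_le_sq {p : ℝ[X]} (hp : p.Splits) (j : ℕ) :
    p.coeff j * p.coeff (j + 2) ≤ p.coeff (j + 1) ^ 2 := by
  have hchoose : (((j + 2).choose j : ℕ) : ℝ) = (j + 2) * (j + 1) / 2 := by
    rw [Nat.choose_symm_add, Nat.cast_choose_two]
    push_cast
    ring
  have hlow := two_mul_coeff_mul_coeff_le_sq (splits_hasseDeriv hp j)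
  simp only [hasseDeriv_coeff, zero_add, Nat.choose_self, add_comm 1 j,
    add_comm 2 j, Nat.choose_succ_self_right, Nat.cast_succ, hchoose] at hlow
  have strong : (j + 2) * (p.coeff j * p.coeff (j + 2)) ≤ (j + 1) * p.coeff (j + 1) ^ 2 := by
    refine le_of_mul_le_mul_left ?_ (show (0 : ℝ) < j + 1 by positivity)
    linarith
  rcases le_or_gt (p.coeff j * p.coeff (j + 2)) 0 with hneg | hpos
  · exact hneg.trans (sq_nonneg _)
  · exact le_of_mul_le_mul_left (by linarith) (show (0 : ℝ) < j + 1 by positivity)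

end Newton

section ElementarySymmetric

variable {ι R : Type*} [CommRing R]

/-- The elementary symmetric function of degree `m` in the variables `l i`, `i ∈ s`. Compared with
the function `sigma` it can be restricted to subsets of the variables, as recursions on the
variables require. -/
def esymm (s : Finset ι) (m : ℕ) (l : ι → R) : R :=
  ∑ t ∈ Finset.powersetCard m s, ∏ i ∈ t, l i

theorem sigma_eq_esymm {n : ℕ} (m : ℕ) (l : Fin n → ℝ) : sigma m l = esymm Finset.univ m l := rfl

@[simp] theorem esymm_zero (s : Finset ι) (l : ι → R) : esymm s 0 l = 1 := by simp [esymm]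

theorem esymm_eq_zero {s : Finset ι} {m : ℕ} (h : s.card < m) (l : ι → R) : esymm s m l = 0 := by
  simp [esymm, Finset.powersetCard_eq_empty.2 h]

theorem esymm_one (s : Finset ι) (l : ι → R) : esymm s 1 l = ∑ i ∈ s, l i := by
  simp [esymm, Finset.powersetCard_one]

theorem continuous_esymm (s : Finset ι) (m : ℕ) : Continuous (esymm s m : (ι → ℝ) → ℝ) := by
  unfold esymm
  fun_prop

theorem esymm_smul (s : Finset ι) (m : ℕ) (c : R) (l : ι → R) :
    esymm s m (c • l) = c ^ m * esymm s m l := by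
  unfold esymm
  rw [Finset.mul_sum]
  refine Finset.sum_congr rfl fun t ht => ?_
  simp [Finset.prod_mul_distrib, (Finset.mem_powersetCard.1 ht).2]

theorem esymm_eq_coeff (s : Finset ι) (m j : ℕ) (l : ι → R) (h : m + j = s.card) :
    esymm s m l = (∏ i ∈ s, (Polynomial.X + Polynomial.C (l i))).coeff j := by
  rw [Finset.prod_X_add_C_coeff s l (by omega), show s.card - j = m by omega]
  rfl

theorem esymm_mul_esymm_le_sq (s : Finset ι) (m : ℕ) (l : ι → ℝ) :
    esymm s m l * esymm s (m + 2) l ≤ esymm s (m + 1) l ^ 2 := by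
  rcases lt_or_ge s.card (m + 2) with hcard | hcard
  · rw [esymm_eq_zero hcard, mul_zero]
    exact sq_nonneg _
  obtain ⟨j, hj⟩ := Nat.exists_eq_add_of_le hcard
  have hsplits : (∏ i ∈ s, (Polynomial.X + Polynomial.C (l i))).Splits :=
    Polynomial.Splits.prod fun i _ => Polynomial.Splits.X_add_C _
  rw [esymm_eq_coeff s m (j + 2) l (by omega), esymm_eq_coeff s (m + 1) (j + 1) l (by omega),
    esymm_eq_coeff s (m + 2) j l (by omega), mul_comm]
  exact coeff_mul_coeff_le_sq hsplits j

variable [DecidableEq ι]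

theorem esymm_insert {s : Finset ι} {i : ι} (hi : i ∉ s) (m : ℕ) (l : ι → R) :
    esymm (insert i s) (m + 1) l = l i * esymm s m l + esymm s (m + 1) l := by
  have notMem {r : ℕ} {t : Finset ι} (ht : t ∈ Finset.powersetCard r s) : i ∉ t :=
    fun h => hi ((Finset.mem_powersetCard.1 ht).1 h)
  have hdisj : Disjoint (Finset.powersetCard (m + 1) s)
      ((Finset.powersetCard m s).image (insert i)) := by
    rw [Finset.disjoint_left]
    intro t ht ht'
    obtain ⟨t', -, rfl⟩ := Finset.mem_image.1 ht'
    exact notMem ht (Finset.mem_insert_self _ _)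
  have hinj : InjOn (insert i) (Finset.powersetCard m s : Set (Finset ι)) := fun a ha b hb hab => by
    rw [← Finset.erase_insert (notMem ha), ← Finset.erase_insert (notMem hb), hab]
  unfold esymm
  rw [Finset.powersetCard_succ_insert hi, Finset.sum_union hdisj, add_comm, Finset.sum_image hinj,
    Finset.mul_sum, Finset.sum_congr rfl fun t ht => Finset.prod_insert (notMem ht)]

theorem esymm_erase {s : Finset ι} {i : ι} (hi : i ∈ s) (m : ℕ) (l : ι → R) :
    esymm s (m + 1) l = l i * esymm (s.erase i) m l + esymm (s.erase i) (m + 1) l := by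
  conv_lhs => rw [← Finset.insert_erase hi]
  exact esymm_insert (Finset.notMem_erase i s) m l

theorem sum_mul_esymm_erase (s : Finset ι) (m : ℕ) (l : ι → R) :
    ∑ i ∈ s, l i * esymm (s.erase i) m l = (m + 1) * esymm s (m + 1) l := by
  induction s using Finset.induction_on generalizing m with
  | empty => simp [esymm_eq_zero (s := (∅ : Finset ι)) (m := m + 1) (by simp)]
  | insert a s ha ih =>
    rw [Finset.sum_insert ha, Finset.erase_insert ha]
    have herase : ∀ i ∈ s, (insert a s).erase i = insert a (s.erase i) := fun i hi =>
      Finset.erase_insert_of_ne (fun h => ha (h ▸ hi))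
    rw [Finset.sum_congr rfl fun i hi => by rw [herase i hi]]
    have ha' : ∀ i, a ∉ s.erase i := fun i h => ha (Finset.mem_of_mem_erase h)
    cases m with
    | zero =>
      have := ih 0
      simp only [esymm_zero, mul_one] at this ⊢
      rw [esymm_insert ha, this]
      simp
    | succ m =>
      have hsplit : ∀ i ∈ s, l i * esymm (insert a (s.erase i)) (m + 1) l =
          l a * (l i * esymm (s.erase i) m l) + l i * esymm (s.erase i) (m + 1) l := fun i _ => by
        rw [esymm_insert (ha' i)]
        ring
      rw [Finset.sum_congr rfl hsplit, Finset.sum_add_distrib, ← Finset.mul_sum, ih, ih,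
        esymm_insert ha]
      push_cast
      ring

theorem sum_esymm_erase (s : Finset ι) (m : ℕ) (l : ι → R) :
    ∑ i ∈ s, esymm (s.erase i) m l = ((s.card : R) - m) * esymm s m l := by
  cases m with
  | zero => simp
  | succ m =>
    rw [Finset.sum_congr rfl fun i hi => eq_sub_of_add_eq' (esymm_erase hi m l).symm,
      Finset.sum_sub_distrib, sum_mul_esymm_erase, Finset.sum_const, nsmul_eq_mul]
    push_cast
    ring

end ElementarySymmetric

section GardingCone

variable {ι : Type*}

/-- Membership in Gårding's cone of order `k` in the variables `l i`, `i ∈ s`. The condition for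
`m = 0` holds trivially and is included to shorten inductions. -/
def InGardingCone (s : Finset ι) (k : ℕ) (l : ι → ℝ) : Prop := ∀ m ≤ k, 0 < esymm s m l

theorem mem_gardingCone_iff {n k : ℕ} {l : Fin n → ℝ} :
    l ∈ gardingCone n k ↔ InGardingCone Finset.univ k l := by
  constructor
  · intro h m hm
    rcases Nat.eq_zero_or_pos m with rfl | hm0
    · simp
    · exact h m hm0 hm
  · intro h m _ hm
    exact h m hm

theorem isOpen_setOf_inGardingCone (s : Finset ι) (k : ℕ) : IsOpen {l | InGardingCone s k l} := by
  have heq : {l | InGardingCone s k l} = ⋂ m ∈ Finset.range (k + 1), {l | 0 < esymm s m l} := by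
    ext l
    simp [InGardingCone]
  rw [heq]
  exact isOpen_biInter_finset fun m _ => isOpen_lt continuous_const (continuous_esymm s m)

namespace InGardingCone

variable {s : Finset ι} {k : ℕ} {x y : ι → ℝ}

theorem mono {k' : ℕ} (h : InGardingCone s k x) (hk : k' ≤ k) : InGardingCone s k' x :=
  fun m hm => h m (hm.trans hk)

theorem smul (h : InGardingCone s k x) {c : ℝ} (hc : 0 < c) : InGardingCone s k (c • x) :=
  fun m hm => by
    rw [esymm_smul]
    exact mul_pos (pow_pos hc m) (h m hm)

theorem esymm_div_succ_le (hx : InGardingCone s (k + 1) x) :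
    esymm s (k + 2) x / esymm s (k + 1) x ≤ esymm s (k + 1) x / esymm s k x := by
  rw [div_le_div_iff₀ (hx _ le_rfl) (hx _ (by omega))]
  linarith [esymm_mul_esymm_le_sq s k x]

theorem esymm_div_antitone {j : ℕ} (hx : InGardingCone s k x) (hjk : j ≤ k) :
    esymm s (k + 1) x / esymm s k x ≤ esymm s (j + 1) x / esymm s j x := by
  induction k, hjk using Nat.le_induction with
  | base => exact le_rfl
  | succ k _ ih => exact hx.esymm_div_succ_le.trans (ih (hx.mono k.le_succ))

theorem esymm_one_mul_pow_le {j : ℕ} (hx : InGardingCone s (j + 2) x) :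
    esymm s 1 x * esymm s (j + 2) x ^ j ≤ esymm s (j + 1) x ^ (j + 1) := by
  set q := esymm s (j + 2) x / esymm s (j + 1) x with hq
  have hpos := hx (j + 1) (by omega)
  have hq_pos : 0 < q := div_pos (hx _ le_rfl) hpos
  have telescope : ∀ i ≤ j, esymm s 1 x * q ^ i ≤ esymm s (i + 1) x := by
    intro i hi
    induction i with
    | zero => simp
    | succ i ih =>
      have hstep := (hx.mono (show j + 1 ≤ j + 2 by omega)).esymm_div_antitone
        (show i + 1 ≤ j + 1 by omega)
      rw [← hq, le_div_iff₀ (hx _ (by omega))] at hstep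
      calc esymm s 1 x * q ^ (i + 1) = q * (esymm s 1 x * q ^ i) := by ring
        _ ≤ q * esymm s (i + 1) x := by gcongr; exact ih (by omega)
        _ ≤ _ := hstep
  calc esymm s 1 x * esymm s (j + 2) x ^ j
      = (esymm s 1 x * q ^ j) * esymm s (j + 1) x ^ j := by
        rw [show esymm s (j + 2) x = q * esymm s (j + 1) x by
          rw [hq, div_mul_cancel₀ _ hpos.ne']]
        ring
    _ ≤ esymm s (j + 1) x * esymm s (j + 1) x ^ j := by gcongr; exact telescope j le_rfl
    _ = _ := by ring

theorem esymm_succ_le_mul (hx : InGardingCone s k x) :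
    esymm s (k + 1) x ≤ esymm s k x * esymm s 1 x := by
  have h := hx.esymm_div_antitone (Nat.zero_le k)
  rwa [esymm_zero, div_one, zero_add, div_le_iff₀' (hx k le_rfl)] at h

theorem esymm_add_le_mul_pow {m i : ℕ} (hm : 1 ≤ m) (hx : InGardingCone s (m + i) x) :
    esymm s (m + i) x ≤ esymm s m x * esymm s 1 x ^ i := by
  induction i with
  | zero => simp
  | succ i ih =>
    have hx' := hx.mono (show m + i ≤ m + (i + 1) by omega)
    have := hx 1 (by omega)
    calc esymm s (m + (i + 1)) x ≤ esymm s (m + i) x * esymm s 1 x := hx'.esymm_succ_le_mul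
      _ ≤ esymm s m x * esymm s 1 x ^ i * esymm s 1 x := by gcongr; exact ih hx'
      _ = _ := by ring

end InGardingCone

theorem inGardingCone_of_mem_closure {n k : ℕ} {l : Fin n → ℝ} (hk : 1 ≤ k)
    (h : l ∈ closure (gardingCone n k)) (hpos : 0 < sigma k l) :
    InGardingCone Finset.univ k l := by
  have h_one : 0 ≤ esymm Finset.univ 1 l :=
    closure_minimal (fun x hx => (mem_gardingCone_iff.1 hx 1 hk).le)
      (isClosed_le continuous_const (continuous_esymm _ 1)) h
  intro m hm
  rcases Nat.eq_zero_or_pos m with rfl | hm0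
  · simp
  obtain ⟨i, rfl⟩ := Nat.exists_eq_add_of_le hm
  have hle : esymm Finset.univ (m + i) l ≤ esymm Finset.univ m l * esymm Finset.univ 1 l ^ i :=
    closure_minimal (fun x hx => (mem_gardingCone_iff.1 hx).esymm_add_le_mul_pow hm0)
      (isClosed_le (continuous_esymm _ _) ((continuous_esymm _ _).mul
        ((continuous_esymm _ _).pow _))) h
  rw [sigma_eq_esymm] at hpos
  exact pos_of_mul_pos_left (hpos.trans_le hle) (pow_nonneg h_one i)

section Erase

variable [DecidableEq ι] {s : Finset ι} {k : ℕ} {x : ι → ℝ}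

theorem InGardingCone.erase (h : InGardingCone s (k + 1) x) {i : ι} (hi : i ∈ s) :
    InGardingCone (s.erase i) k x := by
  induction k with
  | zero =>
    intro m hm
    simp [Nat.le_zero.1 hm]
  | succ k ih =>
    have ih' := ih (h.mono (by omega))
    intro m hm
    rcases Nat.lt_or_ge m (k + 1) with hm' | hm'
    · exact ih' m (by omega)
    obtain rfl : m = k + 1 := by omega
    have ha := ih' k le_rfl
    have hb_erase := h (k + 1) (by omega)
    have hc_erase := h (k + 1 + 1) le_rfl
    rw [esymm_erase hi] at hb_erase hc_erase
    have newton := esymm_mul_esymm_le_sq (s.erase i) k x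
    by_contra! hb
    set a := esymm (s.erase i) k x
    set b := esymm (s.erase i) (k + 1) x
    set c := esymm (s.erase i) (k + 2) x
    have hac : -(a * (x i * b)) < a * c := by nlinarith
    nlinarith

theorem InGardingCone.sdiff {t : Finset ι} (ht : t ⊆ s) (h : InGardingCone s (k + t.card) x) :
    InGardingCone (s \ t) k x := by
  induction t using Finset.induction_on generalizing k with
  | empty => simpa using h
  | insert a t ha ih =>
    rw [Finset.card_insert_of_notMem ha, add_comm t.card, ← add_assoc] at h
    rw [Finset.sdiff_insert]
    exact (ih ((Finset.subset_insert a t).trans ht) h).erase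
      (Finset.mem_sdiff.2 ⟨ht (Finset.mem_insert_self a t), ha⟩)

theorem InGardingCone.esymm_div_erase_pos (h : InGardingCone s (k + 1) x) {i : ι} (hi : i ∈ s) :
    0 < esymm s (k + 1) x / esymm (s.erase i) k x :=
  div_pos (h _ le_rfl) (h.erase hi k le_rfl)

theorem InGardingCone.esymm_div_erase_eq (h : InGardingCone s (k + 1) x) {i : ι} (hi : i ∈ s) :
    esymm s (k + 1) x / esymm (s.erase i) k x =
      x i + esymm (s.erase i) (k + 1) x / esymm (s.erase i) k x := by
  have := (h.erase hi k le_rfl).ne'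
  rw [esymm_erase hi]
  field_simp

theorem add_two_mul_esymm_div_eq_sum (h : esymm s (k + 1) x ≠ 0) :
    ((k : ℝ) + 2) * (esymm s (k + 2) x / esymm s (k + 1) x) =
      ∑ i ∈ s, (x i - x i ^ 2 / (esymm s (k + 1) x / esymm (s.erase i) k x)) := by
  have hterm : ∀ i ∈ s, x i - x i ^ 2 / (esymm s (k + 1) x / esymm (s.erase i) k x) =
      (x i * esymm (s.erase i) (k + 1) x) / esymm s (k + 1) x := fun i hi => by
    rw [div_div_eq_mul_div, eq_div_iff h, sub_mul, div_mul_cancel₀ _ h, esymm_erase hi]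
    ring
  rw [Finset.sum_congr rfl hterm, ← Finset.sum_div, sum_mul_esymm_erase]
  push_cast
  ring

end Erase

theorem add_sq_div_le {x y a b c : ℝ} (ha : 0 < a) (hb : 0 < b) (hc : a + b ≤ c) :
    (x + y) ^ 2 / c ≤ x ^ 2 / a + y ^ 2 / b :=
  calc (x + y) ^ 2 / c ≤ (x + y) ^ 2 / (a + b) := by gcongr
    _ ≤ x ^ 2 / a + y ^ 2 / b := by
      rw [div_add_div _ _ ha.ne' hb.ne', div_le_div_iff₀ (by positivity) (by positivity)]
      nlinarith [sq_nonneg (x * b - y * a), mul_pos ha hb]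

/-- Marcus and Lopes: in `(k + 2) σ_{k+2} / σ_{k+1} = ∑ (x_i - x_i² / (x_i + q_i))` with
`q_i = σ_{k+1;i} / σ_{k;i}`, superadditivity of the `q_i` passes to the sum since `x² / a` is convex
and decreasing in `a`. -/
theorem inGardingCone_add_and_esymm_div_add_le (k : ℕ) : ∀ (s : Finset ι) (x y : ι → ℝ),
    InGardingCone s k x → InGardingCone s k y → InGardingCone s k (x + y) ∧
      esymm s (k + 1) x / esymm s k x + esymm s (k + 1) y / esymm s k y ≤
        esymm s (k + 1) (x + y) / esymm s k (x + y) := by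
  classical
  induction k with
  | zero =>
    intro s x y _ _
    refine ⟨fun m hm => by simp [Nat.le_zero.1 hm], ?_⟩
    simp [esymm_one, Finset.sum_add_distrib]
  | succ k ih =>
    intro s x y hx hy
    obtain ⟨hcone, hquot⟩ := ih s x y (hx.mono (by omega)) (hy.mono (by omega))
    have hpos : 0 < esymm s (k + 1) (x + y) := by
      have hx_pos := div_pos (hx (k + 1) le_rfl) (hx k (by omega))
      have hy_pos := div_pos (hy (k + 1) le_rfl) (hy k (by omega))
      exact (div_pos_iff_of_pos_right (hcone k le_rfl)).1 (by linarith)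
    have hxy : InGardingCone s (k + 1) (x + y) := fun m hm => by
      rcases Nat.lt_or_ge m (k + 1) with h | h
      · exact hcone m (by omega)
      · rwa [show m = k + 1 by omega]
    refine ⟨hxy, le_of_mul_le_mul_left ?_ (show (0 : ℝ) < k + 2 by positivity)⟩
    rw [mul_add, add_two_mul_esymm_div_eq_sum (hx (k + 1) le_rfl).ne',
      add_two_mul_esymm_div_eq_sum (hy (k + 1) le_rfl).ne', add_two_mul_esymm_div_eq_sum hpos.ne',
      ← Finset.sum_add_distrib]
    refine Finset.sum_le_sum fun i hi => ?_
    have hquot_erase := (ih (s.erase i) x y (hx.erase hi) (hy.erase hi)).2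
    have hconvex := add_sq_div_le (x := x i) (y := y i) (hx.esymm_div_erase_pos hi)
      (hy.esymm_div_erase_pos hi) (c := esymm s (k + 1) (x + y) / esymm (s.erase i) k (x + y)) (by
        rw [hx.esymm_div_erase_eq hi, hy.esymm_div_erase_eq hi, hxy.esymm_div_erase_eq hi,
          Pi.add_apply]
        linarith)
    rw [Pi.add_apply]
    linarith

namespace InGardingCone

variable {s : Finset ι} {k : ℕ} {x y : ι → ℝ}

theorem add (hx : InGardingCone s k x) (hy : InGardingCone s k y) : InGardingCone s k (x + y) :=
  (inGardingCone_add_and_esymm_div_add_le k s x y hx hy).1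

theorem esymm_div_add_le (hx : InGardingCone s k x) (hy : InGardingCone s k y) :
    esymm s (k + 1) x / esymm s k x + esymm s (k + 1) y / esymm s k y ≤
      esymm s (k + 1) (x + y) / esymm s k (x + y) :=
  (inGardingCone_add_and_esymm_div_add_le k s x y hx hy).2

theorem esymm_le_esymm_add (hx : InGardingCone s k x) (hy : InGardingCone s k y) :
    esymm s k x ≤ esymm s k (x + y) := by
  induction k with
  | zero => simp
  | succ k ih =>
    have hx' := hx.mono k.le_succ
    have hy' := hy.mono k.le_succ
    have hx_pos := hx' k le_rfl
    have hxy_pos := (hx'.add hy') k le_rfl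
    have hsucc_pos := hx (k + 1) le_rfl
    have hquot : esymm s (k + 1) x / esymm s k x ≤ esymm s (k + 1) (x + y) / esymm s k (x + y) := by
      linarith [hx'.esymm_div_add_le hy', div_pos (hy (k + 1) le_rfl) (hy' k le_rfl)]
    calc esymm s (k + 1) x = esymm s (k + 1) x / esymm s k x * esymm s k x :=
        (div_mul_cancel₀ _ hx_pos.ne').symm
      _ ≤ esymm s (k + 1) (x + y) / esymm s k (x + y) * esymm s k (x + y) := by
        gcongr
        · exact (div_pos hsucc_pos hx_pos).le.trans hquot
        · exact ih hx' hy'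
      _ = esymm s (k + 1) (x + y) := div_mul_cancel₀ _ hxy_pos.ne'

end InGardingCone

end GardingCone

section Jets

open Filter Topology

/-- `f` is differentiable near `0`, twice differentiable at `0`, and its value and first two
derivatives at `0` are `a`, `b`, `c`. -/
def HasTwoJet (f : ℝ → ℝ) (a b c : ℝ) : Prop :=
  ∃ f' : ℝ → ℝ, f 0 = a ∧ f' 0 = b ∧ (∀ᶠ t in 𝓝 0, HasDerivAt f (f' t) t) ∧ HasDerivAt f' c 0

namespace HasTwoJet

variable {f g : ℝ → ℝ} {a b c a' b' c' : ℝ}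

theorem val (h : HasTwoJet f a b c) : f 0 = a :=
  h.choose_spec.1

theorem hasDerivAt (h : HasTwoJet f a b c) : HasDerivAt f b 0 := by
  obtain ⟨f', -, rfl, hf, -⟩ := h
  exact hf.self_of_nhds

theorem const (a : ℝ) : HasTwoJet (fun _ => a) a 0 0 :=
  ⟨fun _ => 0, rfl, rfl, .of_forall fun t => hasDerivAt_const t a, hasDerivAt_const 0 0⟩

theorem id : HasTwoJet (fun t => t) 0 1 0 :=
  ⟨fun _ => 1, rfl, rfl, .of_forall fun t => hasDerivAt_id t, hasDerivAt_const 0 1⟩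

theorem congr_coeff (h : HasTwoJet f a b c) (ha : a = a') (hb : b = b') (hc : c = c') :
    HasTwoJet f a' b' c' := by
  subst ha hb hc
  exact h

theorem congr (h : HasTwoJet f a b c) (hfg : g =ᶠ[𝓝 0] f) : HasTwoJet g a b c := by
  obtain ⟨f', hval, hderiv, hf, hf'⟩ := h
  refine ⟨f', by rw [hfg.self_of_nhds, hval], hderiv, ?_, hf'⟩
  filter_upwards [hf, hfg.eventually_nhds] with t ht hfgt
  exact ht.congr_of_eventuallyEq hfgt

theorem unique (h : HasTwoJet f a b c) (h' : HasTwoJet f a' b' c') :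
    a = a' ∧ b = b' ∧ c = c' := by
  refine ⟨h.val.symm.trans h'.val, h.hasDerivAt.unique h'.hasDerivAt, ?_⟩
  obtain ⟨f', -, -, hf, hf'⟩ := h
  obtain ⟨g', -, -, hg, hg'⟩ := h'
  have heq : f' =ᶠ[𝓝 0] g' := by
    filter_upwards [hf, hg] with t hft hgt using hft.unique hgt
  exact (hf'.congr_of_eventuallyEq heq.symm).unique hg'

theorem add (hf : HasTwoJet f a b c) (hg : HasTwoJet g a' b' c') :
    HasTwoJet (fun t => f t + g t) (a + a') (b + b') (c + c') := by
  obtain ⟨f', rfl, rfl, hf, hf'⟩ := hf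
  obtain ⟨g', rfl, rfl, hg, hg'⟩ := hg
  refine ⟨fun t => f' t + g' t, rfl, rfl, ?_, hf'.add hg'⟩
  filter_upwards [hf, hg] with t hft hgt using hft.add hgt

theorem mul (hf : HasTwoJet f a b c) (hg : HasTwoJet g a' b' c') :
    HasTwoJet (fun t => f t * g t) (a * a') (b * a' + a * b')
      (c * a' + 2 * (b * b') + a * c') := by
  have hf_zero := hf.hasDerivAt
  have hg_zero := hg.hasDerivAt
  obtain ⟨f', rfl, rfl, hf, hf'⟩ := hf
  obtain ⟨g', rfl, rfl, hg, hg'⟩ := hg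
  refine ⟨fun t => f' t * g t + f t * g' t, rfl, rfl, ?_, ?_⟩
  · filter_upwards [hf, hg] with t hft hgt using hft.mul hgt
  · refine ((hf'.mul hg_zero).add (hf_zero.mul hg')).congr_deriv ?_
    ring

theorem const_mul (r : ℝ) (h : HasTwoJet f a b c) :
    HasTwoJet (fun t => r * f t) (r * a) (r * b) (r * c) :=
  ((const r).mul h).congr_coeff rfl (by ring) (by ring)

theorem neg (h : HasTwoJet f a b c) : HasTwoJet (fun t => -f t) (-a) (-b) (-c) := by
  simpa using h.const_mul (-1)

theorem sub (hf : HasTwoJet f a b c) (hg : HasTwoJet g a' b' c') :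
    HasTwoJet (fun t => f t - g t) (a - a') (b - b') (c - c') := by
  simpa [sub_eq_add_neg] using hf.add hg.neg

theorem sum {ι : Type*} {s : Finset ι} {f : ι → ℝ → ℝ} {a b c : ι → ℝ}
    (h : ∀ i ∈ s, HasTwoJet (f i) (a i) (b i) (c i)) :
    HasTwoJet (fun t => ∑ i ∈ s, f i t) (∑ i ∈ s, a i) (∑ i ∈ s, b i) (∑ i ∈ s, c i) := by
  classical
  induction s using Finset.induction_on with
  | empty => simpa using const 0
  | insert i s hi ih =>
    simp only [Finset.sum_insert hi]
    exact (h i (Finset.mem_insert_self i s)).add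
      (ih fun j hj => h j (Finset.mem_insert_of_mem hj))

theorem comp {g' : ℝ → ℝ} {d : ℝ} (h : HasTwoJet f a b c)
    (hg : ∀ᶠ y in 𝓝 a, HasDerivAt g (g' y) y) (hg' : HasDerivAt g' d a) :
    HasTwoJet (fun t => g (f t)) (g a) (g' a * b) (d * b ^ 2 + g' a * c) := by
  have hf_zero := h.hasDerivAt
  obtain ⟨f', rfl, rfl, hf, hf'⟩ := h
  refine ⟨fun t => g' (f t) * f' t, rfl, rfl, ?_, ?_⟩
  · filter_upwards [hf, hf_zero.continuousAt.eventually hg] with t hft hgt using hgt.comp t hft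
  · refine ((hg'.comp 0 hf_zero).mul hf').congr_deriv ?_
    simp only [Function.comp]
    ring

theorem exp (h : HasTwoJet f a b c) :
    HasTwoJet (fun t => Real.exp (f t)) (Real.exp a) (Real.exp a * b)
      (Real.exp a * b ^ 2 + Real.exp a * c) :=
  h.comp (.of_forall Real.hasDerivAt_exp) (Real.hasDerivAt_exp a)

theorem log (h : HasTwoJet f a b c) (ha : 0 < a) :
    HasTwoJet (fun t => Real.log (f t)) (Real.log a) (a⁻¹ * b)
      (-(a ^ 2)⁻¹ * b ^ 2 + a⁻¹ * c) := by
  refine h.comp (g' := fun y => y⁻¹) ?_ (hasDerivAt_inv ha.ne')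
  filter_upwards [lt_mem_nhds ha] with y hy using Real.hasDerivAt_log hy.ne'

theorem pow (h : HasTwoJet f a b c) (m : ℕ) :
    HasTwoJet (fun t => f t ^ m) (a ^ m) (m * a ^ (m - 1) * b)
      ((m * ((m - 1 : ℕ) * a ^ (m - 1 - 1))) * b ^ 2 + m * a ^ (m - 1) * c) :=
  h.comp (.of_forall fun y => hasDerivAt_pow m y) ((hasDerivAt_pow (m - 1) a).const_mul _)

theorem inv (h : HasTwoJet f a b c) (ha : a ≠ 0) :
    HasTwoJet (fun t => (f t)⁻¹) a⁻¹ (-(a ^ 2)⁻¹ * b)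
      (2 * (a ^ 3)⁻¹ * b ^ 2 + -(a ^ 2)⁻¹ * c) := by
  refine h.comp (g' := fun y => -(y ^ 2)⁻¹) ?_ ?_
  · filter_upwards [isOpen_ne.mem_nhds ha] with y hy using hasDerivAt_inv hy
  · refine ((hasDerivAt_pow 2 a).fun_inv (by positivity)).fun_neg.congr_deriv ?_
    field_simp
    norm_num
    ring

theorem comp_neg (h : HasTwoJet f a b c) : HasTwoJet (fun t => f (-t)) a (-b) c := by
  obtain ⟨f', rfl, rfl, hf, hf'⟩ := h
  have hneg : Tendsto (fun t : ℝ => -t) (𝓝 0) (𝓝 0) := by simpa using tendsto_neg (0 : ℝ)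
  refine ⟨fun t => -f' (-t), by simp, by simp, ?_, ?_⟩
  · filter_upwards [hneg.eventually hf] with t ht
    simpa [Function.comp_def] using ht.comp t (hasDerivAt_neg t)
  · rw [← neg_zero] at hf'
    simpa [Function.comp_def] using (hf'.comp (0 : ℝ) (hasDerivAt_neg 0)).fun_neg

theorem prod {ι : Type*} [DecidableEq ι] {s : Finset ι} {f : ι → ℝ → ℝ} {a b c : ι → ℝ}
    (h : ∀ i ∈ s, HasTwoJet (f i) (a i) (b i) (c i)) :
    HasTwoJet (fun t => ∏ i ∈ s, f i t) (∏ i ∈ s, a i) (∑ i ∈ s, (∏ j ∈ s.erase i, a j) * b i)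
      (∑ i ∈ s, (∏ j ∈ s.erase i, a j) * c i +
        ∑ i ∈ s, ∑ j ∈ s.erase i, (∏ l ∈ (s.erase i).erase j, a l) * (b i * b j)) := by
  have hval : ∀ i ∈ s, f i 0 = a i := fun i hi => (h i hi).val
  have hd : ∀ i ∈ s, HasDerivAt (f i) (b i) 0 := fun i hi => (h i hi).hasDerivAt
  choose! f' _ hf'_zero hf hf' using h
  have hval_erase : ∀ i, ∏ j ∈ s.erase i, f j 0 = ∏ j ∈ s.erase i, a j := fun i =>
    Finset.prod_congr rfl fun j hj => hval j (Finset.mem_of_mem_erase hj)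
  refine ⟨fun t => ∑ i ∈ s, (∏ j ∈ s.erase i, f j t) * f' i t, Finset.prod_congr rfl hval,
    Finset.sum_congr rfl fun i hi => by rw [hf'_zero i hi, hval_erase], ?_, ?_⟩
  · filter_upwards [(Filter.eventually_all_finset s).2 hf] with t ht
    simpa using HasDerivAt.fun_finsetProd ht
  · rw [← Finset.sum_add_distrib]
    refine HasDerivAt.fun_sum fun i hi => ?_
    have hprod := HasDerivAt.fun_finsetProd (u := s.erase i) (f := f) (f' := b) (x := (0 : ℝ))
      fun j hj => hd j (Finset.mem_of_mem_erase hj)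
    refine (hprod.mul (hf' i hi)).congr_deriv ?_
    rw [hf'_zero i hi, hval_erase, add_comm, Finset.sum_mul]
    congr 1
    refine Finset.sum_congr rfl fun j _ => ?_
    rw [Finset.prod_congr rfl fun l hl =>
      hval l (Finset.mem_of_mem_erase (Finset.mem_of_mem_erase hl)), smul_eq_mul]
    ring

theorem of_isLocalMax (h : HasTwoJet f a b c) (hmax : IsLocalMax f 0) : b = 0 ∧ c ≤ 0 := by
  have hb : b = 0 := hmax.hasDerivAt_eq_zero h.hasDerivAt
  refine ⟨hb, ?_⟩
  by_contra! hc
  obtain ⟨f', -, -, hf, hf'⟩ := _root_.id h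
  have hderiv : deriv f =ᶠ[𝓝 0] f' := by filter_upwards [hf] with t ht using ht.deriv
  have hmin : IsLocalMin f 0 :=
    isLocalMin_of_deriv_deriv_pos (by rwa [hderiv.deriv_eq, hf'.deriv])
      (by rw [h.hasDerivAt.deriv, hb]) h.hasDerivAt.continuousAt
  have hconst : (fun _ => a) =ᶠ[𝓝 0] f := by
    filter_upwards [hmax, hmin] with t hle hge
    rw [← h.val]
    exact le_antisymm hge hle
  exact hc.ne' ((h.congr hconst).unique (const a)).2.2

theorem of_contDiffAt {E : Type*} [NormedAddCommGroup E] [NormedSpace ℝ E] {g : E → ℝ} {x : E}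
    (hg : ContDiffAt ℝ 2 g x) (v : E) :
    HasTwoJet (fun t => g (x + t • v)) (g x) (fderiv ℝ g x v)
      (fderiv ℝ (fun y => fderiv ℝ g y v) x v) := by
  have hline : ∀ t : ℝ, HasDerivAt (fun t : ℝ => x + t • v) v t := fun t => by
    simpa using ((hasDerivAt_id t).smul_const v).const_add x
  have hcont : Tendsto (fun t : ℝ => x + t • v) (𝓝 0) (𝓝 x) := by
    simpa using (hline 0).continuousAt.tendsto
  refine ⟨fun t => fderiv ℝ g (x + t • v) v, by simp, by simp, ?_, ?_⟩
  · have hdiff : ∀ᶠ y in 𝓝 x, DifferentiableAt ℝ g y :=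
      (hg.eventually (by simp)).mono fun y hy => hy.differentiableAt (by simp)
    filter_upwards [hcont.eventually hdiff] with t ht
    exact ht.hasFDerivAt.comp_hasDerivAt t (hline t)
  · have hdiff : DifferentiableAt ℝ (fun y => fderiv ℝ g y v) x :=
      ((hg.fderiv_right (m := 1) (by norm_num)).differentiableAt (by simp)).clm_apply
        (differentiableAt_const v)
    have hderiv : HasFDerivAt (fun y => fderiv ℝ g y v) (fderiv ℝ (fun y => fderiv ℝ g y v) x)
        (x + (0 : ℝ) • v) := by simpa using hdiff.hasFDerivAt
    exact hderiv.comp_hasDerivAt 0 (hline 0)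

end HasTwoJet

end Jets

section Interpolation

open Polynomial

/-- The weights expressing the `j`-th coefficient of a polynomial of degree at most `N` through its
values at `0, 1, …, N`. -/
def interpolationWeight (N j r : ℕ) : ℝ :=
  (Lagrange.basis (Finset.range (N + 1)) (fun r : ℕ => (r : ℝ)) r).coeff j

theorem coeff_eq_sum_interpolationWeight {N : ℕ} (j : ℕ) {p : ℝ[X]} (hp : p.natDegree ≤ N) :
    p.coeff j = ∑ r ∈ Finset.range (N + 1), interpolationWeight N j r * p.eval (r : ℝ) := by
  have hinterp := Lagrange.eq_interpolate (s := Finset.range (N + 1)) (v := fun r : ℕ => (r : ℝ))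
    (f := p) (fun a _ b _ hab => Nat.cast_injective hab) (by
      rw [Finset.card_range]
      exact lt_of_le_of_lt degree_le_natDegree (by exact_mod_cast Nat.lt_succ_of_le hp))
  conv_lhs => rw [hinterp, Lagrange.interpolate_apply, finsetSum_coeff]
  refine Finset.sum_congr rfl fun r _ => ?_
  rw [coeff_C_mul, interpolationWeight, mul_comm]

theorem esymm_eq_sum_interpolationWeight {ι : Type*} {s : Finset ι} {N m j : ℕ} (l : ι → ℝ)
    (h : m + j = s.card) (hN : s.card ≤ N) :
    esymm s m l =
      ∑ r ∈ Finset.range (N + 1), interpolationWeight N j r * ∏ i ∈ s, ((r : ℝ) + l i) := by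
  rw [esymm_eq_coeff s m j l h, coeff_eq_sum_interpolationWeight (N := N)]
  · simp [eval_prod]
  · refine (natDegree_prod_le _ _).trans (le_trans ?_ hN)
    simp

end Interpolation

section Permutations

open Equiv

theorem perm_eq_one_of_apply_eq {ι : Type*} {σ : Perm ι} {i : ι} (h : ∀ l, l ≠ i → σ l = l) :
    σ = 1 := by
  ext l
  by_cases hl : l = i
  · subst hl
    by_contra hσ
    exact hσ (σ.injective (h _ hσ))
  · exact h l hl

variable {ι : Type*} [DecidableEq ι]

theorem perm_eq_one_or_swap_of_apply_eq {σ : Perm ι} {i j : ι}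
    (h : ∀ l, l ≠ i → l ≠ j → σ l = l) : σ = 1 ∨ σ = swap i j := by
  have hσi : σ i = i ∨ σ i = j := by
    by_contra! hne
    exact hne.1 (σ.injective (h _ hne.1 hne.2))
  rcases hσi with hσi | hσi
  · refine .inl (perm_eq_one_of_apply_eq (i := j) fun l hl => ?_)
    by_cases hli : l = i
    · rwa [hli]
    · exact h l hli hl
  · refine .inr (eq_of_inv_mul_eq_one (perm_eq_one_of_apply_eq (i := j) fun l hl => ?_)).symm
    by_cases hli : l = i
    · simp [hli, hσi]
    · simp [h l hli hl, swap_apply_of_ne_of_ne hli hl]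

theorem prod_diagonal_perm_eq_zero {s : Finset ι} {σ : Perm ι} {l : ι} (hl : l ∈ s) (h : σ l ≠ l)
    (d : ι → ℝ) : ∏ l ∈ s, Matrix.diagonal d (σ l) l = 0 :=
  Finset.prod_eq_zero hl (Matrix.diagonal_apply_ne _ h)

end Permutations

section Determinant

open Equiv

variable {ι : Type*} [Fintype ι] [DecidableEq ι]

/-- The sum of the principal minors of order `k` of `A`, as a coefficient of `det (X + A)`. -/
def minorSum (k : ℕ) (A : Matrix ι ι ℝ) : ℝ :=
  (-A).charpoly.coeff (Fintype.card ι - k)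

theorem minorSum_eq_sum_interpolationWeight (k : ℕ) (A : Matrix ι ι ℝ) :
    minorSum k A = ∑ r ∈ Finset.range (Fintype.card ι + 1),
      interpolationWeight (Fintype.card ι) (Fintype.card ι - k) r *
        (Matrix.diagonal (fun _ => (r : ℝ)) + A).det := by
  rw [minorSum, coeff_eq_sum_interpolationWeight _ (Matrix.charpoly_natDegree_eq_dim _).le]
  simp only [Matrix.eval_charpoly, sub_neg_eq_add, Matrix.scalar_apply]

theorem minorSum_diagonal {k : ℕ} (hk : k ≤ Fintype.card ι) (l : ι → ℝ) :
    minorSum k (Matrix.diagonal l) = esymm Finset.univ k l := by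
  rw [minorSum_eq_sum_interpolationWeight, esymm_eq_sum_interpolationWeight l
    (Nat.add_sub_cancel' hk) le_rfl, Finset.card_univ]
  simp only [Matrix.diagonal_add, Matrix.det_diagonal]

theorem sum_perm_prod_erase_diagonal (d : ι → ℝ) (i : ι) (w : Perm ι → ℝ) :
    ∑ σ : Perm ι, ((Perm.sign σ : ℤ) : ℝ) *
        ((∏ l ∈ Finset.univ.erase i, Matrix.diagonal d (σ l) l) * w σ) =
      (∏ l ∈ Finset.univ.erase i, d l) * w 1 := by
  rw [Finset.sum_eq_single 1]
  · simp
  · intro σ _ hσ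
    obtain ⟨l, hli, hl⟩ : ∃ l, l ≠ i ∧ σ l ≠ l := by
      by_contra! h
      exact hσ (perm_eq_one_of_apply_eq h)
    rw [prod_diagonal_perm_eq_zero (Finset.mem_erase.2 ⟨hli, Finset.mem_univ l⟩) hl, zero_mul,
      mul_zero]
  · simp

theorem sum_perm_prod_erase_erase_diagonal (d : ι → ℝ) {i j : ι} (hij : i ≠ j)
    (w : Perm ι → ℝ) :
    ∑ σ : Perm ι, ((Perm.sign σ : ℤ) : ℝ) *
        ((∏ l ∈ (Finset.univ.erase i).erase j, Matrix.diagonal d (σ l) l) * w σ) =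
      (∏ l ∈ (Finset.univ.erase i).erase j, d l) * (w 1 - w (swap i j)) := by
  rw [Finset.sum_eq_add 1 (swap i j) (fun h => hij (swap_eq_one_iff.1 h.symm))]
  · have hswap : ∏ l ∈ (Finset.univ.erase i).erase j, Matrix.diagonal d (swap i j l) l =
        ∏ l ∈ (Finset.univ.erase i).erase j, d l := by
      refine Finset.prod_congr rfl fun l hl => ?_
      obtain ⟨hlj, hli, -⟩ := by simpa only [Finset.mem_erase] using hl
      rw [swap_apply_of_ne_of_ne hli hlj, Matrix.diagonal_apply_eq]
    rw [hswap, Perm.sign_swap hij]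
    simp only [Perm.sign_one, Perm.one_apply, Matrix.diagonal_apply_eq]
    push_cast
    ring
  · intro σ _ hσ
    obtain ⟨l, hli, hlj, hl⟩ : ∃ l, l ≠ i ∧ l ≠ j ∧ σ l ≠ l := by
      by_contra! h
      exact (perm_eq_one_or_swap_of_apply_eq h).elim hσ.1 hσ.2
    have hl_mem : l ∈ (Finset.univ.erase i).erase j := by simp [hli, hlj]
    rw [prod_diagonal_perm_eq_zero hl_mem hl, zero_mul, mul_zero]
  · simp
  · simp

theorem HasTwoJet.det {A : ℝ → Matrix ι ι ℝ} {d : ι → ℝ} {B C : Matrix ι ι ℝ}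
    (h : ∀ p q, HasTwoJet (fun t => A t p q) (Matrix.diagonal d p q) (B p q) (C p q)) :
    HasTwoJet (fun t => (A t).det) (∏ i, d i) (∑ i, (∏ j ∈ Finset.univ.erase i, d j) * B i i)
      (∑ i, (∏ j ∈ Finset.univ.erase i, d j) * C i i +
        ∑ i, ∑ j ∈ Finset.univ.erase i, (∏ l ∈ (Finset.univ.erase i).erase j, d l) *
          (B i i * B j j - B i j * B j i)) := by
  have hexpansion := HasTwoJet.sum (s := Finset.univ) fun (σ : Perm ι) _ =>
    (HasTwoJet.prod (s := Finset.univ) fun i _ => h (σ i) i).const_mul ((Perm.sign σ : ℤ) : ℝ)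
  refine (hexpansion.congr (.of_forall fun t => Matrix.det_apply' (A t))).congr_coeff ?_ ?_ ?_
  · rw [← Matrix.det_apply', Matrix.det_diagonal]
  · simp only [Finset.mul_sum]
    rw [Finset.sum_comm]
    simp only [sum_perm_prod_erase_diagonal, Perm.one_apply]
  · simp only [mul_add, Finset.mul_sum, Finset.sum_add_distrib]
    congr 1
    · rw [Finset.sum_comm]
      simp only [sum_perm_prod_erase_diagonal, Perm.one_apply]
    · rw [Finset.sum_comm]
      refine Finset.sum_congr rfl fun i _ => ?_
      rw [Finset.sum_comm]
      refine Finset.sum_congr rfl fun j hj => ?_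
      rw [sum_perm_prod_erase_erase_diagonal d (Finset.ne_of_mem_erase hj).symm]
      simp only [Perm.one_apply, swap_apply_left, swap_apply_right]
      ring

theorem HasTwoJet.minorSum {k : ℕ} (hk : k + 2 ≤ Fintype.card ι) {A : ℝ → Matrix ι ι ℝ}
    {d : ι → ℝ} {B C : Matrix ι ι ℝ}
    (h : ∀ p q, HasTwoJet (fun t => A t p q) (Matrix.diagonal d p q) (B p q) (C p q)) :
    HasTwoJet (fun t => minorSum (k + 2) (A t)) (esymm Finset.univ (k + 2) d)
      (∑ i, esymm (Finset.univ.erase i) (k + 1) d * B i i)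
      (∑ i, esymm (Finset.univ.erase i) (k + 1) d * C i i +
        ∑ i, ∑ j ∈ Finset.univ.erase i, esymm ((Finset.univ.erase i).erase j) k d *
          (B i i * B j j - B i j * B j i)) := by
  have hdet := fun r : ℕ => HasTwoJet.det (A := fun t => Matrix.diagonal (fun _ => (r : ℝ)) + A t)
    (d := fun i => (r : ℝ) + d i) (B := B) (C := C) fun p q => by
      rw [← Matrix.diagonal_add]
      exact ((HasTwoJet.const _).add (h p q)).congr_coeff rfl (zero_add _) (zero_add _)
  have hcard : ∀ i : ι, (Finset.univ.erase i).card = Fintype.card ι - 1 := fun i => by simp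
  have hsum : ∀ (s : Finset ι) (m : ℕ), m + (Fintype.card ι - (k + 2)) = s.card → ∀ b : ℝ,
      ∑ r ∈ Finset.range (Fintype.card ι + 1),
        interpolationWeight (Fintype.card ι) (Fintype.card ι - (k + 2)) r *
          ((∏ i ∈ s, ((r : ℝ) + d i)) * b) = esymm s m d * b := fun s m hm b => by
    rw [esymm_eq_sum_interpolationWeight d hm (Finset.card_le_univ s), Finset.sum_mul]
    exact Finset.sum_congr rfl fun r _ => by ring
  have hsum_erase : ∀ (i : ι) (b : ℝ), _ := fun i =>
    hsum (Finset.univ.erase i) (k + 1) (by rw [hcard]; omega)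
  simp only [minorSum_eq_sum_interpolationWeight]
  refine (HasTwoJet.sum (s := Finset.range (Fintype.card ι + 1)) fun r _ =>
    (hdet r).const_mul _).congr_coeff ?_ ?_ ?_
  · exact (esymm_eq_sum_interpolationWeight d (by rw [Finset.card_univ]; omega) le_rfl).symm
  · simp only [Finset.mul_sum]
    rw [Finset.sum_comm]
    simp only [hsum_erase]
  · simp only [Finset.mul_sum, mul_add, Finset.sum_add_distrib]
    congr 1
    · rw [Finset.sum_comm]
      simp only [hsum_erase]
    · rw [Finset.sum_comm]
      refine Finset.sum_congr rfl fun i _ => ?_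
      rw [Finset.sum_comm]
      refine Finset.sum_congr rfl fun j hj => hsum _ k ?_ _
      rw [Finset.card_erase_of_mem hj, hcard]
      omega

end Determinant

section ConeCalculus

open Filter Topology

theorem hasTwoJet_esymm_add_smul {ι : Type*} [Fintype ι] [DecidableEq ι] {k : ℕ}
    (hk : k + 2 ≤ Fintype.card ι) (x y : ι → ℝ) :
    HasTwoJet (fun t => esymm Finset.univ (k + 2) (x + t • y)) (esymm Finset.univ (k + 2) x)
      (∑ i, esymm (Finset.univ.erase i) (k + 1) x * y i)
      (∑ i, ∑ j ∈ Finset.univ.erase i,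
        esymm ((Finset.univ.erase i).erase j) k x * (y i * y j)) := by
  have h := HasTwoJet.minorSum hk (A := fun t => Matrix.diagonal (x + t • y)) (d := x)
    (B := Matrix.diagonal y) (C := 0) fun p q => by
      by_cases hpq : p = q
      · subst hpq
        simp only [Matrix.diagonal_apply_eq, Pi.add_apply, Pi.smul_apply, smul_eq_mul]
        exact ((HasTwoJet.const (x p)).add (HasTwoJet.id.mul (HasTwoJet.const (y p)))).congr_coeff
          (by ring) (by ring) (by simp)
      · simpa [Matrix.diagonal_apply_ne _ hpq] using HasTwoJet.const 0
  simp only [minorSum_diagonal hk] at h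
  refine h.congr_coeff rfl (by simp) ?_
  simp only [Matrix.zero_apply, mul_zero, Finset.sum_const_zero, zero_add,
    Matrix.diagonal_apply_eq]
  refine Finset.sum_congr rfl fun i _ => Finset.sum_congr rfl fun j hj => ?_
  rw [Matrix.diagonal_apply_ne _ (Finset.ne_of_mem_erase hj), mul_zero, sub_zero]

namespace InGardingCone

theorem sum_esymm_erase_mul_nonneg {n k : ℕ} (hk : k + 2 ≤ n) {x y : Fin n → ℝ}
    (hx : InGardingCone Finset.univ (k + 2) x) (hy : y ∈ closure (gardingCone n (k + 2))) :
    0 ≤ ∑ i, esymm (Finset.univ.erase i) (k + 1) x * y i := by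
  have hclosed : IsClosed {y : Fin n → ℝ |
      0 ≤ ∑ i, esymm (Finset.univ.erase i) (k + 1) x * y i} :=
    isClosed_le continuous_const (by fun_prop)
  refine closure_minimal (fun y hy => ?_) hclosed hy
  have hd := (hasTwoJet_esymm_add_smul (by simpa using hk) x y).hasDerivAt
  refine ge_of_tendsto (hasDerivAt_iff_tendsto_slope_zero.1 hd |>.mono_left
    (nhdsWithin_mono 0 (s := Ioi 0) fun t ht => (ne_of_gt ht : t ≠ 0))) ?_
  filter_upwards [self_mem_nhdsWithin] with t (ht : 0 < t)
  have hmono := hx.esymm_le_esymm_add ((mem_gardingCone_iff.1 hy).smul ht)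
  simp only [zero_add, zero_smul, add_zero, smul_eq_mul]
  exact mul_nonneg (inv_nonneg.2 ht.le) (by linarith)

section

variable {ι : Type*} {s : Finset ι} {k : ℕ} {x : ι → ℝ}

theorem eventually_add_smul (h : InGardingCone s k x) (ξ : ι → ℝ) :
    ∀ᶠ t in 𝓝 (0 : ℝ), InGardingCone s k (x + t • ξ) := by
  have hcont : Continuous fun t : ℝ => x + t • ξ := by fun_prop
  refine hcont.continuousAt.eventually ((isOpen_setOf_inGardingCone s k).mem_nhds ?_)
  simpa using h

theorem eventually_add_neg_smul (h : InGardingCone s k x) (ξ : ι → ℝ) :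
    ∀ᶠ t in 𝓝 (0 : ℝ), InGardingCone s k (x + (-t) • ξ) := by
  simpa only [neg_smul, smul_neg] using h.eventually_add_smul (-ξ)

theorem eventually_esymm_div_add_le (h : InGardingCone s k x) (ξ : ι → ℝ) :
    ∀ᶠ t in 𝓝 (0 : ℝ), esymm s (k + 1) (x + t • ξ) / esymm s k (x + t • ξ) +
      esymm s (k + 1) (x + (-t) • ξ) / esymm s k (x + (-t) • ξ) ≤
        2 * (esymm s (k + 1) x / esymm s k x) := by
  filter_upwards [h.eventually_add_smul ξ, h.eventually_add_neg_smul ξ] with t hpos hneg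
  refine (hpos.esymm_div_add_le hneg).trans_eq ?_
  have hmid : x + t • ξ + (x + (-t) • ξ) = (2 : ℝ) • x := by module
  have := (h k le_rfl).ne'
  rw [hmid, esymm_smul, esymm_smul, pow_succ]
  field_simp

theorem esymm_erase_le_esymm_erase [DecidableEq ι] (h : InGardingCone s (k + 2) x) {i j : ι}
    (hi : i ∈ s) (hj : j ∈ s) (hij : x j ≤ x i) :
    esymm (s.erase i) (k + 1) x ≤ esymm (s.erase j) (k + 1) x := by
  rcases eq_or_ne i j with rfl | hne
  · exact le_rfl
  have hj' : j ∈ s.erase i := Finset.mem_erase.2 ⟨hne.symm, hj⟩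
  have hi' : i ∈ s.erase j := Finset.mem_erase.2 ⟨hne, hi⟩
  rw [esymm_erase hj', esymm_erase hi', Finset.erase_right_comm (a := j)]
  gcongr
  exact ((h.erase hi).erase hj' k le_rfl).le

end

end InGardingCone

theorem inGardingCone_indicator {ι : Type*} {s K : Finset ι} (hK : K ⊆ s) :
    InGardingCone s K.card ((K : Set ι).indicator 1) := by
  intro m hm
  have hnonneg : ∀ t ∈ Finset.powersetCard m s, 0 ≤ ∏ i ∈ t, (K : Set ι).indicator (1 : ι → ℝ) i :=
    fun t _ => Finset.prod_nonneg fun i _ => indicator_nonneg (fun _ _ => zero_le_one) i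
  obtain ⟨t, htK, htc⟩ := Finset.exists_subset_card_eq hm
  refine lt_of_lt_of_le ?_ (Finset.single_le_sum hnonneg
    (Finset.mem_powersetCard.2 ⟨htK.trans hK, htc⟩))
  exact Finset.prod_pos fun i hi => by simp [htK hi]

theorem exists_inGardingCone_indicator_sub {ι : Type*} [Fintype ι] (K : Finset ι) :
    ∃ ε : ℝ, 0 < ε ∧ ε ≤ 1 ∧ InGardingCone Finset.univ K.card
      ((K : Set ι).indicator 1 - ε • (Kᶜ : Set ι).indicator 1) := by
  have hcone := (inGardingCone_indicator (Finset.subset_univ K)).eventually_add_neg_smul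
    ((Kᶜ : Set ι).indicator 1)
  obtain ⟨ε, hε, hεpos, hε1⟩ := ((hcone.filter_mono nhdsWithin_le_nhds).and
    (Ioc_mem_nhdsGT zero_lt_one)).exists
  exact ⟨ε, hεpos, hε1, by rwa [neg_smul, ← sub_eq_add_neg] at hε⟩

-- The gradient is paired with the vector of the cone that is `1` at the `k + 2` largest entries
-- of `x` and slightly negative at the others; at those others the gradient is largest.
theorem exists_mul_sum_esymm_erase_le {n k : ℕ} (hk : k + 2 ≤ n) :
    ∃ c : ℝ, 0 < c ∧ ∀ x : Fin n → ℝ, Antitone x → InGardingCone Finset.univ (k + 2) x →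
      ∀ p : Fin n, k + 1 ≤ (p : ℕ) →
        c * ∑ i, esymm (Finset.univ.erase i) (k + 1) x ≤
          esymm (Finset.univ.erase p) (k + 1) x := by
  set K : Finset (Fin n) := Finset.univ.filter fun i => (i : ℕ) < k + 2 with hK
  have hcard : K.card = k + 2 := by
    rw [hK, Fin.card_filter_val_lt]
    omega
  obtain ⟨ε, hε, hε1, hcone⟩ := exists_inGardingCone_indicator_sub K
  rw [hcard] at hcone
  refine ⟨ε / (2 * (k + 2)), by positivity, fun x hanti hx p hp => ?_⟩
  set F : Fin n → ℝ := fun i => esymm (Finset.univ.erase i) (k + 1) x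
  have hFpos : ∀ i, 0 < F i := fun i => hx.erase (Finset.mem_univ i) (k + 1) le_rfl
  have hpair : 0 ≤ ∑ i ∈ K, F i - ε * ∑ i ∈ Kᶜ, F i := by
    refine (hx.sum_esymm_erase_mul_nonneg hk
      (subset_closure (mem_gardingCone_iff.2 hcone))).trans_eq ?_
    rw [← Finset.sum_add_sum_compl K, sub_eq_add_neg (∑ i ∈ K, F i), Finset.mul_sum,
      ← Finset.sum_neg_distrib]
    congr 1
    · exact Finset.sum_congr rfl fun i hi => by simp [hi, F]
    · exact Finset.sum_congr rfl fun i hi => by simp [Finset.mem_compl.1 hi, F, mul_comm]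
  have hK_le : ∑ i ∈ K, F i ≤ (k + 2) * F p := by
    have hterm : ∀ i ∈ K, F i ≤ F p := fun i hi => by
      have := (Finset.mem_filter.1 hi).2
      exact hx.esymm_erase_le_esymm_erase (Finset.mem_univ i) (Finset.mem_univ p)
        (hanti (Fin.le_def.2 (by omega)))
    simpa [hcard] using Finset.sum_le_card_nsmul K F (F p) hterm
  have hK_nonneg : 0 ≤ ∑ i ∈ K, F i := Finset.sum_nonneg fun i _ => (hFpos i).le
  rw [div_mul_eq_mul_div, div_le_iff₀ (by positivity), ← Finset.sum_add_sum_compl K F]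
  nlinarith

theorem HasTwoJet.le_of_div_add_div_neg_le {f g : ℝ → ℝ} {a b c a' b' c' : ℝ}
    (hf : HasTwoJet f a b c) (hg : HasTwoJet g a' b' c') (ha : 0 < a) (ha' : 0 < a')
    (h : ∀ᶠ t in 𝓝 0, f t / g t + f (-t) / g (-t) ≤ 2 * (a / a')) :
    c / a - (b / a) ^ 2 ≤ c' / a' - (b' / a') ^ 2 - (b / a - b' / a') ^ 2 := by
  have hdiv := hf.mul (hg.inv ha'.ne')
  have hmax : IsLocalMax (fun t => f t * (g t)⁻¹ + f (-t) * (g (-t))⁻¹) 0 := by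
    filter_upwards [h] with t ht
    simp only [neg_zero, hf.val, hg.val, ← div_eq_mul_inv]
    linarith
  have hsecond := ((hdiv.add hdiv.comp_neg).of_isLocalMax hmax).2
  have hscaled : (c * a'⁻¹ + 2 * (b * (-(a' ^ 2)⁻¹ * b')) +
      a * (2 * (a' ^ 3)⁻¹ * b' ^ 2 + -(a' ^ 2)⁻¹ * c')) * (a' / a) ≤ 0 :=
    mul_nonpos_of_nonpos_of_nonneg (by linarith) (by positivity)
  have hexpand : (c * a'⁻¹ + 2 * (b * (-(a' ^ 2)⁻¹ * b')) +
      a * (2 * (a' ^ 3)⁻¹ * b' ^ 2 + -(a' ^ 2)⁻¹ * c')) * (a' / a) =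
      c / a - 2 * (b / a) * (b' / a') + 2 * (b' / a') ^ 2 - c' / a' := by
    field_simp
    ring
  nlinarith

theorem exists_hasTwoJet_esymm_add_smul {ι : Type*} (s : Finset ι) (m : ℕ) (x ξ : ι → ℝ) :
    ∃ b c, HasTwoJet (fun t => esymm s m (x + t • ξ)) (esymm s m x) b c := by
  have h : ContDiff ℝ 2 fun t : ℝ => esymm s m (x + t • ξ) := by
    simp only [esymm, Pi.add_apply, Pi.smul_apply, smul_eq_mul]
    fun_prop
  have hjet := HasTwoJet.of_contDiffAt (h.contDiffAt (x := 0)) 1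
  simp only [zero_add, smul_eq_mul, mul_one, zero_smul, add_zero] at hjet
  exact ⟨_, _, hjet⟩

theorem hasTwoJet_esymm_one_add_smul {ι : Type*} (s : Finset ι) (x ξ : ι → ℝ) :
    HasTwoJet (fun t => esymm s 1 (x + t • ξ)) (esymm s 1 x) (esymm s 1 ξ) 0 := by
  have hline : ∀ t : ℝ, esymm s 1 (x + t • ξ) = esymm s 1 x + t * esymm s 1 ξ := fun t => by
    simp [esymm_one, Finset.sum_add_distrib, Finset.mul_sum]
  simp only [hline]
  exact ((HasTwoJet.const _).add (HasTwoJet.id.mul (HasTwoJet.const _))).congr_coeff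
    (by ring) (by ring) (by ring)

theorem InGardingCone.log_esymm_second_deriv_le_erase {ι : Type*} [DecidableEq ι] {s : Finset ι}
    {k : ℕ} {x ξ : ι → ℝ} (hx : InGardingCone s (k + 1) x) {i : ι} (hi : i ∈ s) {b c b' c' : ℝ}
    (hjet : HasTwoJet (fun t => esymm s (k + 1) (x + t • ξ)) (esymm s (k + 1) x) b c)
    (hjet_erase : HasTwoJet (fun t => esymm (s.erase i) k (x + t • ξ))
      (esymm (s.erase i) k x) b' c') :
    c / esymm s (k + 1) x - (b / esymm s (k + 1) x) ^ 2 ≤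
      c' / esymm (s.erase i) k x - (b' / esymm (s.erase i) k x) ^ 2 -
        (b / esymm s (k + 1) x - b' / esymm (s.erase i) k x) ^ 2 := by
  have hx_erase := hx.erase hi
  have hquot : ∀ z : ι → ℝ, InGardingCone (s.erase i) k z →
      esymm s (k + 1) z / esymm (s.erase i) k z =
        z i + esymm (s.erase i) (k + 1) z / esymm (s.erase i) k z := fun z hz => by
    have := (hz k le_rfl).ne'
    rw [esymm_erase hi]
    field_simp
  refine hjet.le_of_div_add_div_neg_le hjet_erase (hx _ le_rfl) (hx_erase _ le_rfl) ?_
  filter_upwards [hx_erase.eventually_esymm_div_add_le ξ, hx_erase.eventually_add_smul ξ,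
    hx_erase.eventually_add_neg_smul ξ] with t hconc hpos hneg
  rw [hquot _ hpos, hquot _ hneg, hquot _ hx_erase]
  simp only [Pi.add_apply, Pi.smul_apply, smul_eq_mul]
  linarith

/-- Second order form of the concavity of `(σ_k / ℓ) ^ (1 / (k - 1))` on Gårding's cone, where `ℓ`
is the sum of the variables outside a set of `k - 2` indices. -/
theorem InGardingCone.log_esymm_second_deriv_le {ι : Type*} [DecidableEq ι] {s J : Finset ι}
    (hJ : J ⊆ s) {x : ι → ℝ} (hx : InGardingCone s (J.card + 2) x) (ξ : ι → ℝ) {b c : ℝ}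
    (hjet : HasTwoJet (fun t => esymm s (J.card + 2) (x + t • ξ)) (esymm s (J.card + 2) x) b c) :
    c / esymm s (J.card + 2) x - (b / esymm s (J.card + 2) x) ^ 2 ≤
      -(esymm (s \ J) 1 ξ / esymm (s \ J) 1 x) ^ 2 - ((J.card : ℝ) + 1)⁻¹ *
        (b / esymm s (J.card + 2) x - esymm (s \ J) 1 ξ / esymm (s \ J) 1 x) ^ 2 := by
  induction J using Finset.induction_on generalizing s b c with
  | empty =>
    simp only [Finset.card_empty, zero_add, Finset.sdiff_empty, Nat.cast_zero] at hx hjet ⊢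
    have hle := hjet.le_of_div_add_div_neg_le (hasTwoJet_esymm_one_add_smul s x ξ) (hx 2 le_rfl)
      (hx 1 one_le_two) ((hx.mono one_le_two).eventually_esymm_div_add_le ξ)
    simp only [zero_div] at hle
    linarith
  | insert i J hi ih =>
    rw [Finset.card_insert_of_notMem hi] at hx hjet ⊢
    have his : i ∈ s := hJ (Finset.mem_insert_self i J)
    have hx_erase : InGardingCone (s.erase i) (J.card + 2) x := hx.erase his
    obtain ⟨b', c', hjet_erase⟩ := exists_hasTwoJet_esymm_add_smul (s.erase i) (J.card + 2) x ξ
    have hJ_erase : J ⊆ s.erase i :=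
      Finset.subset_erase.2 ⟨(Finset.subset_insert i J).trans hJ, hi⟩
    have hih := ih hJ_erase hx_erase hjet_erase
    rw [Finset.erase_sdiff_comm, ← Finset.sdiff_insert] at hih
    have hle := hx.log_esymm_second_deriv_le_erase his hjet hjet_erase
    set P := b / esymm s (J.card + 1 + 2) x
    set Q := b' / esymm (s.erase i) (J.card + 2) x
    set L := esymm (s \ insert i J) 1 ξ / esymm (s \ insert i J) 1 x
    have hsq : ((J.card : ℝ) + 1 + 1)⁻¹ * (P - L) ^ 2 ≤
        ((J.card : ℝ) + 1)⁻¹ * (Q - L) ^ 2 + (P - Q) ^ 2 := by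
      have h := add_sq_div_le (x := Q - L) (y := P - Q)
        (by positivity : (0 : ℝ) < (J.card : ℝ) + 1) one_pos le_rfl
      rw [show Q - L + (P - Q) = P - L by ring] at h
      simpa [div_eq_inv_mul] using h
    push_cast
    linarith

end ConeCalculus

section BallIntegral

open Filter Topology Metric

variable {E : Type*} [NormedAddCommGroup E]

theorem add_mem_ball {x y : E} {ε : ℝ} (hy : y ∈ ball (0 : E) ε) : x + y ∈ ball x ε := by
  rwa [mem_ball_iff_norm, add_sub_cancel_left, ← mem_ball_zero_iff]

theorem ball_add_smul_subset [NormedSpace ℝ E] {x b : E} {ε ρ t : ℝ}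
    (ht : t ∈ ball (0 : ℝ) (ρ / (‖b‖ + 1))) : ball (x + t • b) ε ⊆ ball x (ε + ρ) := by
  rw [mem_ball_zero_iff, lt_div_iff₀ (by positivity)] at ht
  refine ball_subset_ball' ?_
  rw [dist_eq_norm, add_sub_cancel_left, norm_smul]
  nlinarith [norm_nonneg t]

variable [MeasurableSpace E] [BorelSpace E]

theorem aestronglyMeasurable_ball_add [SecondCountableTopology E] {μ : Measure E} {v : E → ℝ}
    {S : Set E} {x : E} {ε : ℝ} (hv : ContinuousOn v S) (hx : ball x ε ⊆ S) :
    AEStronglyMeasurable (fun y => v (x + y)) (μ.restrict (ball 0 ε)) :=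
  (hv.comp (by fun_prop) fun _ hy => hx (add_mem_ball hy)).aestronglyMeasurable measurableSet_ball

theorem ae_restrict_ball_add {μ : Measure E} [μ.IsAddLeftInvariant] {P : E → Prop} {Ω : Set E}
    (hΩ : MeasurableSet Ω) (h : ∀ᵐ x ∂μ.restrict Ω, P x) {x : E} {ε : ℝ} (hx : ball x ε ⊆ Ω) :
    ∀ᵐ y ∂μ.restrict (ball 0 ε), P (x + y) := by
  rw [ae_restrict_iff' hΩ] at h
  rw [ae_restrict_iff' measurableSet_ball]
  filter_upwards [(measurePreserving_add_left μ x).quasiMeasurePreserving.ae h] with y hy hyb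
  exact hy (hx (add_mem_ball hyb))

/-- The unnormalised average of `v` over the ball of radius `ε` around `x`. It smooths `v` and
keeps the differential inequalities that `v` satisfies almost everywhere. -/
def ballIntegral (μ : Measure E) (ε : ℝ) (v : E → ℝ) (x : E) : ℝ :=
  ∫ y in ball 0 ε, v (x + y) ∂μ

variable [NormedSpace ℝ E] [FiniteDimensional ℝ E] {μ : Measure E} [μ.IsAddHaarMeasure]
  {v : E → ℝ} {S Ω : Set E} {D K : ℝ≥0} {x b : E} {ε ρ : ℝ}

theorem integrableOn_ball_add (hv : LipschitzOnWith D v S) (hε : 0 < ε) (hx : ball x ε ⊆ S) :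
    IntegrableOn (fun y => v (x + y)) (ball 0 ε) μ := by
  have : Fact (μ (ball (0 : E) ε) < ∞) := ⟨measure_ball_lt_top⟩
  refine Integrable.of_bound (aestronglyMeasurable_ball_add hv.continuousOn hx)
    (D * ε + ‖v x‖) ?_
  rw [ae_restrict_iff' measurableSet_ball]
  refine .of_forall fun y hy => ?_
  have hlip := hv.dist_le_mul _ (hx (add_mem_ball hy)) x (hx (mem_ball_self hε))
  rw [mem_ball_zero_iff] at hy
  rw [dist_eq_norm, dist_self_add_left] at hlip
  calc ‖v (x + y)‖ ≤ ‖v (x + y) - v x‖ + ‖v x‖ := norm_le_norm_sub_add _ _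
    _ ≤ D * ε + ‖v x‖ := by
      gcongr
      exact hlip.trans (by gcongr)

theorem abs_ballIntegral_sub_le (hv : LipschitzOnWith D v S) (hε : 0 < ε) (hx : ball x ε ⊆ S) :
    |ballIntegral μ ε v x - μ.real (ball 0 ε) * v x| ≤ μ.real (ball 0 ε) * (D * ε) := by
  have hsub : ballIntegral μ ε v x - μ.real (ball 0 ε) * v x =
      ∫ y in ball 0 ε, (v (x + y) - v x) ∂μ := by
    rw [integral_sub (integrableOn_ball_add hv hε hx)
      (integrableOn_const measure_ball_lt_top.ne), setIntegral_const, smul_eq_mul, ballIntegral]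
  rw [hsub, ← Real.norm_eq_abs, mul_comm]
  refine norm_setIntegral_le_of_norm_le_const measure_ball_lt_top fun y hy => ?_
  have hlip := hv.dist_le_mul _ (hx (add_mem_ball hy)) x (hx (mem_ball_self hε))
  rw [mem_ball_zero_iff] at hy
  rw [dist_eq_norm, dist_self_add_left] at hlip
  exact hlip.trans (by gcongr)

theorem continuousOn_ballIntegral (hv : LipschitzOnWith D v S) (hε : 0 < ε) :
    ContinuousOn (ballIntegral μ ε v) {x | ball x ε ⊆ S} := by
  refine LipschitzOnWith.continuousOn (K := D * (μ.real (ball (0 : E) ε)).toNNReal)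
    (LipschitzOnWith.of_dist_le_mul fun x hx z hz => ?_)
  rw [dist_eq_norm, ballIntegral, ballIntegral, ← integral_sub (integrableOn_ball_add hv hε hx)
    (integrableOn_ball_add hv hε hz)]
  refine (norm_setIntegral_le_of_norm_le_const (C := D * dist x z) measure_ball_lt_top
    fun y hy => ?_).trans_eq ?_
  · have hlip := hv.dist_le_mul _ (hx (add_mem_ball hy)) _ (hz (add_mem_ball hy))
    rwa [dist_add_right, dist_eq_norm] at hlip
  · rw [NNReal.coe_mul, Real.coe_toNNReal _ measureReal_nonneg]
    ring

theorem hasDerivAt_ballIntegral_of_ae (hv : LipschitzOnWith D v S) (hε : 0 < ε) (hρ : 0 < ρ)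
    (hx : ball x (ε + ρ) ⊆ S) {v' : E → ℝ}
    (hmeas : AEStronglyMeasurable v' (μ.restrict (ball 0 ε)))
    (hderiv : ∀ᵐ y ∂μ.restrict (ball 0 ε), HasDerivAt (fun t : ℝ => v (x + t • b + y)) (v' y) 0) :
    IntegrableOn v' (ball 0 ε) μ ∧
      HasDerivAt (fun t : ℝ => ballIntegral μ ε v (x + t • b)) (∫ y in ball 0 ε, v' y ∂μ) 0 := by
  have hradius : 0 < ρ / (‖b‖ + 1) := by positivity
  have hball : ∀ t ∈ ball (0 : ℝ) (ρ / (‖b‖ + 1)), ball (x + t • b) ε ⊆ S := fun t ht =>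
    (ball_add_smul_subset ht).trans hx
  refine hasDerivAt_integral_of_dominated_loc_of_lip (s := ball (0 : ℝ) (ρ / (‖b‖ + 1)))
    (bound := fun _ => D * ‖b‖) (ball_mem_nhds _ hradius) ?_ ?_ hmeas ?_
    (integrableOn_const measure_ball_lt_top.ne) hderiv
  · filter_upwards [ball_mem_nhds _ hradius] with t ht
    exact aestronglyMeasurable_ball_add hv.continuousOn (hball t ht)
  · exact integrableOn_ball_add hv hε (hball 0 (mem_ball_self hradius))
  · rw [ae_restrict_iff' measurableSet_ball]
    refine .of_forall fun y hy => LipschitzOnWith.of_dist_le_mul fun t ht t' ht' => ?_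
    refine (hv.dist_le_mul _ (hball t ht (add_mem_ball hy)) _
      (hball t' ht' (add_mem_ball hy))).trans_eq ?_
    rw [dist_add_right, dist_add_left, dist_eq_norm, dist_eq_norm, ← sub_smul, norm_smul,
      Real.coe_nnabs, abs_of_nonneg (by positivity)]
    ring

theorem hasDerivAt_ballIntegral (hv : LipschitzOnWith D v S)
    (hdiff : ∀ x ∈ S, DifferentiableAt ℝ v x) (hε : 0 < ε) (hρ : 0 < ρ) {t : ℝ}
    (hx : ball (x + t • b) (ε + ρ) ⊆ S) :
    HasDerivAt (fun t : ℝ => ballIntegral μ ε v (x + t • b))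
      (ballIntegral μ ε (fun y => fderiv ℝ v y b) (x + t • b)) t := by
  have hmeas : Measurable fun y => fderiv ℝ v (x + t • b + y) b :=
    (measurable_fderiv_apply_const ℝ v b).comp (measurable_const_add _)
  have hzero := (hasDerivAt_ballIntegral_of_ae (b := b) (μ := μ) hv hε hρ hx
    hmeas.aestronglyMeasurable (by
      rw [ae_restrict_iff' measurableSet_ball]
      refine .of_forall fun y hy => ?_
      have hline : HasDerivAt (fun s : ℝ => x + t • b + s • b + y) b 0 := by
        simpa using (((hasDerivAt_id (0 : ℝ)).smul_const b).const_add (x + t • b)).add_const y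
      have hd := (hdiff _ (hx (ball_subset_ball (by linarith) (add_mem_ball hy)))).hasFDerivAt
      rw [← add_zero (x + t • b), ← zero_smul ℝ b] at hd
      simpa [Function.comp_def] using hd.comp_hasDerivAt (0 : ℝ) hline)).2
  rw [← sub_self t] at hzero
  have hline : ∀ s : ℝ, x + t • b + (s - t) • b = x + s • b := fun s => by module
  simpa only [hline, ballIntegral] using hzero.comp_sub_const t t

theorem hasTwoJet_ballIntegral (hΩ : IsOpen Ω) (hdiff : ∀ x ∈ Ω, DifferentiableAt ℝ v x)
    (hv : LipschitzOnWith D v (ball x (ε + 2 * ρ)))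
    (hK : LipschitzOnWith K (fderiv ℝ v) Ω)
    (hae : ∀ᵐ x ∂μ.restrict Ω, DifferentiableAt ℝ (fderiv ℝ v) x) (hε : 0 < ε) (hρ : 0 < ρ)
    (hx : ball x (ε + 2 * ρ) ⊆ Ω) (b : E) :
    IntegrableOn (fun y => fderiv ℝ (fderiv ℝ v) (x + y) b b) (ball 0 ε) μ ∧
      HasTwoJet (fun t : ℝ => ballIntegral μ ε v (x + t • b)) (ballIntegral μ ε v x)
        (ballIntegral μ ε (fun y => fderiv ℝ v y b) x)
        (ballIntegral μ ε (fun y => fderiv ℝ (fderiv ℝ v) y b b) x) := by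
  have hlip : LipschitzOnWith (‖ContinuousLinearMap.apply ℝ ℝ b‖₊ * K)
      (fun y => fderiv ℝ v y b) Ω :=
    (ContinuousLinearMap.apply ℝ ℝ b).lipschitz.comp_lipschitzOnWith hK
  have hmeas : Measurable fun y => fderiv ℝ (fderiv ℝ v) (x + y) b b :=
    (ContinuousLinearMap.apply ℝ ℝ b).continuous.measurable.comp
      ((measurable_fderiv_apply_const ℝ (fderiv ℝ v) b).comp (measurable_const_add x))
  obtain ⟨hint, hsecond⟩ := hasDerivAt_ballIntegral_of_ae hlip hε hρ
    ((ball_subset_ball (by linarith)).trans hx) (b := b) hmeas.aestronglyMeasurable (by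
      filter_upwards [ae_restrict_ball_add hΩ.measurableSet hae
        ((ball_subset_ball (by linarith)).trans hx)] with y hy
      have hline : HasDerivAt (fun t : ℝ => x + t • b + y) b 0 := by
        simpa using (((hasDerivAt_id (0 : ℝ)).smul_const b).const_add x).add_const y
      have hd := (ContinuousLinearMap.apply ℝ ℝ b).hasFDerivAt.comp _ hy.hasFDerivAt
      rw [← add_zero x, ← zero_smul ℝ b] at hd
      simpa [Function.comp_def] using hd.comp_hasDerivAt (0 : ℝ) hline)
  refine ⟨hint, fun t => ballIntegral μ ε (fun y => fderiv ℝ v y b) (x + t • b), by simp, by simp,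
    ?_, hsecond⟩
  filter_upwards [ball_mem_nhds (0 : ℝ) (by positivity : 0 < ρ / (‖b‖ + 1))] with t ht
  exact hasDerivAt_ballIntegral hv (fun y hy => hdiff y (hx hy)) hε hρ
    ((ball_add_smul_subset ht).trans (ball_subset_ball (by linarith)))

/-- Touching from above persists under averaging: after adding a small paraboloid to the test
function, the average over small balls touches it at a nearby point. -/
theorem exists_isLocalMax_ballIntegral_sub (μ : Measure E) [μ.IsAddHaarMeasure] {q : E → ℝ}
    {x₀ : E} {R : ℝ} (hR : 0 < R) (hv : LipschitzOnWith D v (ball x₀ R))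
    (hq : ContinuousOn q (ball x₀ R)) (hle : ∀ x ∈ ball x₀ R, v x ≤ q x) (heq : v x₀ = q x₀)
    {η : ℝ} (hη : 0 < η) :
    ∃ ε : ℝ, 0 < ε ∧ ∃ x₁, dist x₁ x₀ + ε < R ∧ IsLocalMax (fun x =>
      ballIntegral μ ε v x - μ.real (ball 0 ε) * (q x + η * ‖x - x₀‖ ^ 2)) x₁ := by
  set r := R / 2 with hr
  set ε := min (R / 4) (η * r ^ 2 / (4 * (D + 1)))
  have hr0 : 0 < r := by positivity
  have hε : 0 < ε := by positivity
  have hεR : ε ≤ R / 4 := min_le_left _ _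
  have hDε : D * ε ≤ η * r ^ 2 / 4 := by
    have hle : ε * (4 * ((D : ℝ) + 1)) ≤ η * r ^ 2 := by
      rw [← le_div_iff₀ (by positivity)]
      exact min_le_right _ _
    nlinarith
  set c := μ.real (ball (0 : E) ε)
  have hc0 : 0 < c := ENNReal.toReal_pos (measure_ball_pos μ 0 hε).ne' measure_ball_lt_top.ne
  have hsub : closedBall x₀ r ⊆ ball x₀ R := closedBall_subset_ball (by linarith)
  have hball : closedBall x₀ r ⊆ {x | ball x ε ⊆ ball x₀ R} := fun x hx =>
    ball_subset_ball' (by linarith [mem_closedBall.1 hx])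
  set m : E → ℝ := fun x => ballIntegral μ ε v x - c * (q x + η * ‖x - x₀‖ ^ 2) with hm
  have hcont : ContinuousOn m (closedBall x₀ r) :=
    ((continuousOn_ballIntegral hv hε).mono hball).sub
      (((hq.mono hsub).add (by fun_prop)).const_mul c)
  have hx₀ : x₀ ∈ closedBall x₀ r := mem_closedBall_self hr0.le
  obtain ⟨x₁, hx₁, hmax⟩ := (isCompact_closedBall x₀ r).exists_isMaxOn ⟨x₀, hx₀⟩ hcont
  have hinterior : dist x₁ x₀ < r := by
    by_contra! hge
    have hnorm : ‖x₁ - x₀‖ = r := by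
      rw [← dist_eq_norm]
      exact le_antisymm hx₁ hge
    have hm_le : m x₀ ≤ m x₁ := hmax hx₀
    have hlower := (abs_le.1 (abs_ballIntegral_sub_le (μ := μ) hv hε (hball hx₀))).1
    have hupper := (abs_le.1 (abs_ballIntegral_sub_le (μ := μ) hv hε (hball hx₁))).2
    have hvq : c * v x₁ ≤ c * q x₁ := mul_le_mul_of_nonneg_left (hle x₁ (hsub hx₁)) hc0.le
    have herror : c * (D * ε) ≤ c * (η * r ^ 2 / 4) := mul_le_mul_of_nonneg_left hDε hc0.le
    have hgain : 0 < c * (η * r ^ 2) := by positivity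
    simp only [hm, hnorm, sub_self, norm_zero] at hm_le
    rw [heq] at hlower
    linarith
  exact ⟨ε, hε, x₁, by linarith,
    hmax.isLocalMax (closedBall_mem_nhds_of_mem (mem_ball.2 hinterior))⟩

end BallIntegral

section Viscosity

open Filter Topology Metric

variable {E ι : Type*} [NormedAddCommGroup E] [InnerProductSpace ℝ E] [Fintype ι]

theorem hasTwoJet_const_mul_norm_sq_sub (η : ℝ) (x x₀ b : E) :
    HasTwoJet (fun t : ℝ => η * ‖x + t • b - x₀‖ ^ 2) (η * ‖x - x₀‖ ^ 2)
      (η * (2 * inner ℝ (x - x₀) b)) (η * (2 * ‖b‖ ^ 2)) := by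
  have hexpand : ∀ t : ℝ, ‖x + t • b - x₀‖ ^ 2 =
      ‖x - x₀‖ ^ 2 + t * (2 * inner ℝ (x - x₀) b) + t * t * ‖b‖ ^ 2 := fun t => by
    rw [add_sub_right_comm, norm_add_sq_real, inner_smul_right, norm_smul, mul_pow,
      Real.norm_eq_abs, sq_abs]
    ring
  simp only [hexpand]
  exact ((((HasTwoJet.const _).add (HasTwoJet.id.mul (.const _))).add
    ((HasTwoJet.id.mul .id).mul (.const _))).const_mul η).congr_coeff (by ring) (by ring) (by ring)

theorem continuousAt_sum_mul_fderiv_fderiv {q : E → ℝ} {x₀ : E} (hq : ContDiffAt ℝ 2 q x₀)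
    (F : ι → ℝ) (b : ι → E) :
    ContinuousAt (fun x => ∑ i, F i * fderiv ℝ (fun y => fderiv ℝ q y (b i)) x (b i)) x₀ := by
  refine tendsto_finsetSum _ fun i _ => Tendsto.const_mul _ ?_
  have hfirst : ContDiffAt ℝ 1 (fun y => fderiv ℝ q y (b i)) x₀ :=
    (hq.fderiv_right (m := 1) (by norm_num)).clm_apply contDiffAt_const
  exact ((hfirst.fderiv_right (m := 0) (by norm_num)).clm_apply contDiffAt_const).continuousAt

variable [MeasurableSpace E] [BorelSpace E] [FiniteDimensional ℝ E] {μ : Measure E}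
  [μ.IsAddHaarMeasure] {v : E → ℝ} {Ω : Set E} {D K : ℝ≥0} {F : ι → ℝ} {b : ι → E}

/-- At a maximum of `ballIntegral μ ε v - φ` the second derivatives of `φ` dominate averages of
those of `v`, and averaging keeps the sign of the operator. -/
theorem nonneg_of_isLocalMax_ballIntegral_sub (hΩ : IsOpen Ω)
    (hdiff : ∀ x ∈ Ω, DifferentiableAt ℝ v x) (hK : LipschitzOnWith K (fderiv ℝ v) Ω)
    (hF : ∀ i, 0 ≤ F i)
    (hae : ∀ᵐ x ∂μ.restrict Ω, DifferentiableAt ℝ (fderiv ℝ v) x ∧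
      0 ≤ ∑ i, F i * fderiv ℝ (fderiv ℝ v) x (b i) (b i))
    {x₁ : E} {ε ρ : ℝ} (hε : 0 < ε) (hρ : 0 < ρ) (hball : ball x₁ (ε + 2 * ρ) ⊆ Ω)
    (hv : LipschitzOnWith D v (ball x₁ (ε + 2 * ρ))) {φ : E → ℝ} {β γ : ι → ℝ}
    (hφ : ∀ i, HasTwoJet (fun t : ℝ => φ (x₁ + t • b i)) (φ x₁) (β i) (γ i))
    (hmax : IsLocalMax (fun x => ballIntegral μ ε v x - φ x) x₁) :
    0 ≤ ∑ i, F i * γ i := by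
  have hjet := fun i => hasTwoJet_ballIntegral hΩ hdiff hv hK (hae.mono fun _ h => h.1) hε hρ
    hball (b i)
  have hsecond : ∀ i, ballIntegral μ ε (fun y => fderiv ℝ (fderiv ℝ v) y (b i) (b i)) x₁ ≤ γ i := by
    intro i
    have hline : Tendsto (fun t : ℝ => x₁ + t • b i) (𝓝 0) (𝓝 x₁) := by
      have hcont : ContinuousAt (fun t : ℝ => x₁ + t • b i) 0 := by fun_prop
      simpa using hcont.tendsto
    have hmaxline : IsLocalMax (fun t : ℝ =>
        ballIntegral μ ε v (x₁ + t • b i) - φ (x₁ + t • b i)) 0 := by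
      filter_upwards [hline.eventually hmax] with t ht
      simpa using ht
    exact sub_nonpos.1 (((hjet i).2.sub (hφ i)).of_isLocalMax hmaxline).2
  calc (0 : ℝ)
      ≤ ∫ y in ball 0 ε, ∑ i, F i * fderiv ℝ (fderiv ℝ v) (x₁ + y) (b i) (b i) ∂μ :=
        integral_nonneg_of_ae (ae_restrict_ball_add hΩ.measurableSet (hae.mono fun _ h => h.2)
          ((ball_subset_ball (by linarith)).trans hball))
    _ = ∑ i, F i * ballIntegral μ ε (fun y => fderiv ℝ (fderiv ℝ v) y (b i) (b i)) x₁ := by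
        rw [integral_finsetSum _ fun i _ => (hjet i).1.const_mul (F i)]
        exact Finset.sum_congr rfl fun i _ => integral_const_mul _ _
    _ ≤ ∑ i, F i * γ i :=
        Finset.sum_le_sum fun i _ => mul_le_mul_of_nonneg_left (hsecond i) (hF i)

theorem viscosity_subsolution (hΩ : IsOpen Ω) (hdiff : ∀ x ∈ Ω, DifferentiableAt ℝ v x)
    (hD : ∀ x ∈ Ω, ‖fderiv ℝ v x‖₊ ≤ D) (hK : LipschitzOnWith K (fderiv ℝ v) Ω)
    (hF : ∀ i, 0 ≤ F i)
    (hae : ∀ᵐ x ∂μ.restrict Ω, DifferentiableAt ℝ (fderiv ℝ v) x ∧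
      0 ≤ ∑ i, F i * fderiv ℝ (fderiv ℝ v) x (b i) (b i))
    {x₀ : E} (hx₀ : x₀ ∈ Ω) {q : E → ℝ} (hq : ContDiffAt ℝ 2 q x₀)
    (hle : ∀ᶠ x in 𝓝 x₀, v x ≤ q x) (heq : v x₀ = q x₀) :
    0 ≤ ∑ i, F i * fderiv ℝ (fun y => fderiv ℝ q y (b i)) x₀ (b i) := by
  by_contra! hneg
  set L : E → ℝ := fun x => ∑ i, F i * fderiv ℝ (fun y => fderiv ℝ q y (b i)) x (b i) with hL
  set B : ℝ := ∑ i, F i * (2 * ‖b i‖ ^ 2)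
  obtain ⟨η, hη, hηB⟩ : ∃ η : ℝ, 0 < η ∧ L x₀ + η * B < 0 := by
    have hcont : ContinuousAt (fun η : ℝ => L x₀ + η * B) 0 := by fun_prop
    have hlt := hcont.eventually_lt_const (by simpa using hneg)
    exact ((eventually_mem_nhdsWithin (s := Ioi 0)).and (hlt.filter_mono nhdsWithin_le_nhds)).exists
  obtain ⟨R, hR, hnear⟩ := Metric.eventually_nhds_iff_ball.1 ((hΩ.eventually_mem hx₀).and
    ((hq.eventually (by simp)).and (hle.and
      (((continuousAt_sum_mul_fderiv_fderiv hq F b).add_const (η * B)).eventually_lt_const hηB))))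
  have hlip : LipschitzOnWith D v (ball x₀ R) :=
    (convex_ball x₀ R).lipschitzOnWith_of_nnnorm_fderiv_le
      (fun y hy => hdiff y (hnear y hy).1) fun y hy => hD y (hnear y hy).1
  obtain ⟨ε, hε, x₁, hx₁, hmax⟩ := exists_isLocalMax_ballIntegral_sub μ hR hlip
    (fun x hx => (hnear x hx).2.1.continuousAt.continuousWithinAt)
    (fun x hx => (hnear x hx).2.2.1) heq hη
  obtain ⟨-, hq₁, -, hL₁⟩ := hnear x₁ (mem_ball.2 (by linarith))
  set c := μ.real (ball (0 : E) ε)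
  have hc : 0 < c := ENNReal.toReal_pos (measure_ball_pos μ 0 hε).ne' measure_ball_lt_top.ne
  have hball : ball x₁ (ε + 2 * ((R - dist x₁ x₀ - ε) / 2)) ⊆ ball x₀ R :=
    ball_subset_ball' (by linarith)
  have hnonneg := nonneg_of_isLocalMax_ballIntegral_sub hΩ hdiff hK hF hae hε (by linarith)
    (hball.trans fun x hx => (hnear x hx).1) (hlip.mono hball)
    (fun i => ((HasTwoJet.of_contDiffAt hq₁ (b i)).add
      (hasTwoJet_const_mul_norm_sq_sub η x₁ x₀ (b i))).const_mul c) hmax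
  have hsum : ∑ i, F i * (c * (fderiv ℝ (fun y => fderiv ℝ q y (b i)) x₁ (b i) +
      η * (2 * ‖b i‖ ^ 2))) = c * (L x₁ + η * B) := by
    simp only [hL, B, Finset.mul_sum, ← Finset.sum_add_distrib]
    exact Finset.sum_congr rfl fun i _ => by ring
  rw [hsum] at hnonneg
  exact hL₁.not_ge (nonneg_of_mul_nonneg_right hnonneg hc)

end Viscosity

section Spectral

theorem esymm_comp_perm {ι : Type*} [Fintype ι] (m : ℕ) (l : ι → ℝ) (τ : Equiv.Perm ι) :
    esymm Finset.univ m (l ∘ τ) = esymm Finset.univ m l := by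
  conv_rhs => rw [← Finset.map_univ_equiv τ]
  simp only [esymm, Finset.powersetCard_map, Finset.sum_map, Finset.mapEmbedding_apply,
    RelEmbedding.coe_toEmbedding, Finset.prod_map, Equiv.coe_toEmbedding, Function.comp_apply]

theorem comp_perm_mem_closure_gardingCone {n k : ℕ} {l : Fin n → ℝ}
    (h : l ∈ closure (gardingCone n k)) (τ : Equiv.Perm (Fin n)) :
    l ∘ τ ∈ closure (gardingCone n k) := by
  have hcont : Continuous fun l : Fin n → ℝ => l ∘ τ := by
    unfold Function.comp
    fun_prop
  refine map_mem_closure (f := fun l => l ∘ τ) hcont h fun l hl =>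
    mem_gardingCone_iff.2 fun m hm => ?_
  rw [esymm_comp_perm]
  exact mem_gardingCone_iff.1 hl m hm

variable {ι E : Type*} [Fintype ι] [NormedAddCommGroup E] [InnerProductSpace ℝ E]

/-- The matrix of a bilinear form in an orthonormal basis. -/
def formMatrix (b : OrthonormalBasis ι ℝ E) (H : E →L[ℝ] E →L[ℝ] ℝ) : Matrix ι ι ℝ :=
  Matrix.of fun p q => H (b p) (b q)

theorem form_eq_sum (b : OrthonormalBasis ι ℝ E) (H : E →L[ℝ] E →L[ℝ] ℝ) (v w : E) :
    H v w = ∑ p, ∑ q, inner ℝ (b p) v * inner ℝ (b q) w * formMatrix b H p q := by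
  conv_lhs => rw [← b.sum_repr' v, ← b.sum_repr' w]
  simp only [map_sum, map_smul, sum_apply, smul_apply, smul_eq_mul, Finset.mul_sum, formMatrix,
    Matrix.of_apply]
  rw [Finset.sum_comm]
  exact Finset.sum_congr rfl fun p _ => Finset.sum_congr rfl fun q _ => by ring

variable [DecidableEq ι]

theorem minorSum_formMatrix_eq (b c : OrthonormalBasis ι ℝ E) (H : E →L[ℝ] E →L[ℝ] ℝ) (k : ℕ) :
    minorSum k (formMatrix b H) = minorSum k (formMatrix c H) := by
  set Q : Matrix ι ι ℝ := Matrix.of fun i p => inner ℝ (c i) (b p) with hQ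
  have hconj : formMatrix b H = Q.transpose * (formMatrix c H * Q) := by
    ext p q
    simp only [hQ, Matrix.mul_apply, Matrix.transpose_apply, Matrix.of_apply, Finset.mul_sum]
    rw [formMatrix, Matrix.of_apply, form_eq_sum c]
    exact Finset.sum_congr rfl fun i _ => Finset.sum_congr rfl fun j _ => by ring
  have horth : Q * Q.transpose = 1 := by
    ext i j
    simp only [hQ, Matrix.mul_apply, Matrix.transpose_apply, Matrix.of_apply, Matrix.one_apply,
      ← orthonormal_iff_ite.1 c.orthonormal i j, ← b.sum_inner_mul_inner (c i) (c j)]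
    exact Finset.sum_congr rfl fun p _ => by rw [real_inner_comm (c j)]
  rw [minorSum, minorSum, hconj, ← Matrix.mul_neg, Matrix.charpoly_mul_comm, ← Matrix.neg_mul,
    mul_assoc, horth, mul_one]

theorem sq_inner_mem_doublyStochastic (b c : OrthonormalBasis ι ℝ E) :
    (Matrix.of fun i j => inner ℝ (c j) (b i) ^ 2) ∈ doublyStochastic ℝ ι := by
  refine mem_doublyStochastic_iff_sum.2 ⟨fun i j => sq_nonneg _, fun i => ?_, fun j => ?_⟩
  · simpa [b.orthonormal.1 i] using c.sum_sq_norm_inner_right (b i)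
  · simpa [c.orthonormal.1 j] using b.sum_sq_norm_inner_left (c j)

theorem dotProduct_mulVec_nonneg_of_mem_doublyStochastic {W : Matrix ι ι ℝ}
    (hW : W ∈ doublyStochastic ℝ ι) {F l : ι → ℝ} (h : ∀ π : Equiv.Perm ι, 0 ≤ F ⬝ᵥ (l ∘ π)) :
    0 ≤ F ⬝ᵥ W.mulVec l := by
  have hconvex : Convex ℝ {W : Matrix ι ι ℝ | 0 ≤ F ⬝ᵥ W.mulVec l} :=
    convex_halfSpace_ge ⟨fun W W' => by rw [Matrix.add_mulVec, dotProduct_add],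
      fun r W => by rw [Matrix.smul_mulVec, dotProduct_smul]⟩ 0
  rw [← SetLike.mem_coe, doublyStochastic_eq_convexHull_permMatrix] at hW
  refine convexHull_min ?_ hconvex hW
  rintro _ ⟨π, rfl⟩
  rw [mem_ofPred_eq, Matrix.permMatrix_mulVec]
  exact h π

theorem form_eq_sum_of_diagonal {b : OrthonormalBasis ι ℝ E} {H : E →L[ℝ] E →L[ℝ] ℝ} {l : ι → ℝ}
    (hl : formMatrix b H = Matrix.diagonal l) (v w : E) :
    H v w = ∑ p, inner ℝ (b p) v * inner ℝ (b p) w * l p := by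
  rw [form_eq_sum b, hl]
  refine Finset.sum_congr rfl fun p _ => ?_
  rw [Finset.sum_eq_single p (fun q _ hq => by rw [Matrix.diagonal_apply_ne _ hq.symm, mul_zero])
    (by simp), Matrix.diagonal_apply_eq]

theorem form_apply_self_of_diagonal {b : OrthonormalBasis ι ℝ E} {H : E →L[ℝ] E →L[ℝ] ℝ}
    {l : ι → ℝ} (hl : formMatrix b H = Matrix.diagonal l) (i : ι) : H (b i) (b i) = l i :=
  (congrFun₂ hl i i).trans (Matrix.diagonal_apply_eq l i)

theorem formMatrix_apply_self_eq_mulVec {b c : OrthonormalBasis ι ℝ E} {H : E →L[ℝ] E →L[ℝ] ℝ}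
    {l : ι → ℝ} (hc : formMatrix c H = Matrix.diagonal l) (i : ι) :
    H (b i) (b i) = (Matrix.of fun i j => inner ℝ (c j) (b i) ^ 2).mulVec l i := by
  rw [form_eq_sum_of_diagonal hc]
  exact Finset.sum_congr rfl fun p _ => by rw [← sq]; rfl

variable {n : ℕ}
  {H : EuclideanSpace ℝ (Fin n) →L[ℝ] EuclideanSpace ℝ (Fin n) →L[ℝ] ℝ}

theorem form_eq_dotProduct_mulVec (v w : EuclideanSpace ℝ (Fin n)) :
    H v w = v ⬝ᵥ (formMatrix (EuclideanSpace.basisFun (Fin n) ℝ) H).mulVec w := by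
  rw [form_eq_sum (EuclideanSpace.basisFun (Fin n) ℝ)]
  simp only [EuclideanSpace.basisFun_apply, EuclideanSpace.inner_single_left, map_one, one_mul,
    dotProduct, Matrix.mulVec, Finset.mul_sum]
  exact Finset.sum_congr rfl fun i _ => Finset.sum_congr rfl fun j _ => by ring

theorem exists_formMatrix_eq_diagonal (hH : ∀ v w, H v w = H w v) :
    ∃ (b : OrthonormalBasis (Fin n) ℝ (EuclideanSpace ℝ (Fin n))) (τ : Equiv.Perm (Fin n)),
      Antitone (eigenvalues (formMatrix (EuclideanSpace.basisFun (Fin n) ℝ) H) ∘ τ) ∧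
        formMatrix b H = Matrix.diagonal
          (eigenvalues (formMatrix (EuclideanSpace.basisFun (Fin n) ℝ) H) ∘ τ) := by
  set A := formMatrix (EuclideanSpace.basisFun (Fin n) ℝ) H with hA
  have hherm : A.IsHermitian := by
    ext p q
    simp [hA, formMatrix, hH (EuclideanSpace.single q 1)]
  have heig : eigenvalues A = hherm.eigenvalues := dif_pos hherm
  set τ : Equiv.Perm (Fin n) := Tuple.sort fun i => -eigenvalues A i
  refine ⟨hherm.eigenvectorBasis.reindex τ.symm, τ, fun i j hij => neg_le_neg_iff.1
    (Tuple.monotone_sort (fun i => -eigenvalues A i) hij), ?_⟩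
  ext p q
  rw [formMatrix, Matrix.of_apply, form_eq_dotProduct_mulVec, ← hA, OrthonormalBasis.reindex_apply,
    OrthonormalBasis.reindex_apply, hherm.mulVec_eigenvectorBasis, dotProduct_smul,
    Equiv.symm_symm, heig, Matrix.diagonal_apply, dotProduct_comm]
  have horth := orthonormal_iff_ite.1 hherm.eigenvectorBasis.orthonormal (τ p) (τ q)
  rw [EuclideanSpace.inner_eq_star_dotProduct, star_trivial] at horth
  simp only [horth, τ.injective.eq_iff]
  split_ifs with hpq <;> simp [hpq]

theorem minorSum_formMatrix (hH : ∀ v w, H v w = H w v) {k : ℕ} (hk : k ≤ n)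
    (b : OrthonormalBasis (Fin n) ℝ (EuclideanSpace ℝ (Fin n))) :
    minorSum k (formMatrix b H) =
      sigma k (eigenvalues (formMatrix (EuclideanSpace.basisFun (Fin n) ℝ) H)) := by
  obtain ⟨c, τ, -, hc⟩ := exists_formMatrix_eq_diagonal hH
  rw [minorSum_formMatrix_eq b c, hc, minorSum_diagonal (by simpa using hk), esymm_comp_perm,
    sigma_eq_esymm]

/-- The diagonal of a symmetric matrix is a doubly stochastic image of its spectrum, so Birkhoff's
theorem reduces the claim to permuted eigenvalues. -/
theorem InGardingCone.sum_esymm_erase_mul_form_nonneg {k : ℕ} (hk : k + 2 ≤ n) {l : Fin n → ℝ}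
    (hl : InGardingCone Finset.univ (k + 2) l) (hH : ∀ v w, H v w = H w v)
    (hcone : eigenvalues (formMatrix (EuclideanSpace.basisFun (Fin n) ℝ) H) ∈
      closure (gardingCone n (k + 2)))
    (b : OrthonormalBasis (Fin n) ℝ (EuclideanSpace ℝ (Fin n))) :
    0 ≤ ∑ i, esymm (Finset.univ.erase i) (k + 1) l * H (b i) (b i) := by
  obtain ⟨c, τ, -, hc⟩ := exists_formMatrix_eq_diagonal hH
  simp only [formMatrix_apply_self_eq_mulVec hc]
  exact dotProduct_mulVec_nonneg_of_mem_doublyStochastic (sq_inner_mem_doublyStochastic b c)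
    fun π => hl.sum_esymm_erase_mul_nonneg hk
      (comp_perm_mem_closure_gardingCone (comp_perm_mem_closure_gardingCone hcone τ) π)

end Spectral

section ThirdOrderAbsorption

variable {A B β : ℝ}

theorem cutoff_gradient_sq_le {M₁ R x y z : ℝ} (hA : 0 ≤ A) (hB : 0 ≤ B)
    (hBM : 8 * B * M₁ ^ 2 ≤ 1) (hAR : 8 * A * R ^ 2 ≤ 1) (hy : |y| ≤ M₁) (hx : |x| ≤ R) :
    (B * y * z + A * x) ^ 2 ≤ B / 4 * z ^ 2 + A / 4 := by
  have hBy : 8 * B * y ^ 2 ≤ 1 :=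
    (mul_le_mul_of_nonneg_left (sq_le_sq' (abs_le.1 hy).1 (abs_le.1 hy).2) (by positivity)).trans
      hBM
  have hAx : 8 * A * x ^ 2 ≤ 1 :=
    (mul_le_mul_of_nonneg_left (sq_le_sq' (abs_le.1 hx).1 (abs_le.1 hx).2) (by positivity)).trans
      hAR
  have hfirst : B * z ^ 2 * (8 * B * y ^ 2) ≤ B * z ^ 2 :=
    mul_le_of_le_one_right (by positivity) hBy
  have hsecond : A * (8 * A * x ^ 2) ≤ A := mul_le_of_le_one_right hA hAx
  linarith [sq_nonneg (B * y * z - A * x)]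

variable {Λ F F₀ e l τ φ P Y : ℝ}

theorem sq_div_add_sq_le (hβ : 2 ≤ β) (hφ : φ ^ 2 ≤ P) (hY : (φ + τ) ^ 2 ≤ Y) :
    (φ + τ) ^ 2 / β + τ ^ 2 ≤ 5 / 2 * Y + 2 * P := by
  have hdiv : (φ + τ) ^ 2 / β ≤ (φ + τ) ^ 2 / 2 := by gcongr
  linarith [sq_nonneg (τ + 2 * φ)]

theorem third_order_le_of_gap (hβ : 2 ≤ β) (hF : 0 ≤ F) (hφ : φ ^ 2 ≤ P) (hP : 0 ≤ P)
    (heF : F ≤ 8 / 7 * (e * Λ)) :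
    F * ((φ + τ) ^ 2 / β + τ ^ 2) - 2 * e * Λ * τ ^ 2 ≤ 2 * F * P := by
  have hdiv : (φ + τ) ^ 2 / β ≤ (φ + τ) ^ 2 / 2 := by gcongr
  have hyoung : (φ + τ) ^ 2 / β + τ ^ 2 ≤ 7 / 4 * τ ^ 2 + 3 / 2 * P := by
    linarith [sq_nonneg (τ - 2 * φ)]
  have hgap : F * τ ^ 2 ≤ 8 / 7 * (e * Λ) * τ ^ 2 := mul_le_mul_of_nonneg_right heF (sq_nonneg τ)
  have hprod := mul_le_mul_of_nonneg_left hyoung hF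
  have hFP := mul_nonneg hF hP
  linarith

/-- If `F` is much larger than `F₀` and `l` is not too negative, then `e Λ` is comparable to `F` and
the good term `2 e Λ τ²` absorbs everything. Otherwise `τ²` is controlled by `Y`, which is absorbed
either by `F₀` or, when `l` is very negative, by `B F l²`. -/
theorem third_order_le_of_ne (hA : 0 ≤ A) (hB : 0 ≤ B) (hβ : 2 ≤ β) (hΛ : 0 ≤ Λ) (hF : 0 ≤ F)
    (hF₀ : 0 ≤ F₀) (he : 0 ≤ e) (heF : F - F₀ = e * (Λ - l))
    (hφ : φ ^ 2 ≤ B / 4 * l ^ 2 + A / 4) (hY : (φ + τ) ^ 2 ≤ Y) (hlarge : 980 * Y ≤ B * Λ ^ 2) :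
    F * ((φ + τ) ^ 2 / β + τ ^ 2) - 2 * e * Λ * τ ^ 2 ≤
      B * F * l ^ 2 + A / 2 * F + 40 * Y * F₀ := by
  have hY₀ : 0 ≤ Y := (sq_nonneg _).trans hY
  have hYF₀ := mul_nonneg hY₀ hF₀
  have hBFl : 0 ≤ B * F * l ^ 2 := by positivity
  by_cases hgood : 16 * F₀ ≤ F ∧ -(Λ / 14) ≤ l
  · have hgap : e * (Λ - l) ≤ e * (15 / 14 * Λ) :=
      mul_le_mul_of_nonneg_left (by linarith [hgood.2]) he
    have := third_order_le_of_gap (τ := τ) hβ hF hφ (by positivity)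
      (show F ≤ 8 / 7 * (e * Λ) by linarith [hgood.1])
    linarith
  have hbad : F * ((φ + τ) ^ 2 / β + τ ^ 2) ≤ F * (5 / 2 * Y + 2 * (B / 4 * l ^ 2 + A / 4)) :=
    mul_le_mul_of_nonneg_left (sq_div_add_sq_le hβ hφ hY) hF
  have hdrop : 0 ≤ 2 * e * Λ * τ ^ 2 := by positivity
  rcases lt_or_ge F (16 * F₀) with hFF₀ | hFF₀
  · have : F * Y ≤ 16 * F₀ * Y := mul_le_mul_of_nonneg_right hFF₀.le hY₀
    linarith
  · have hl : l < -(Λ / 14) := not_le.1 fun h => hgood ⟨hFF₀, h⟩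
    have hΛl : Λ ^ 2 ≤ 196 * l ^ 2 := by nlinarith
    have hYl : 5 * Y ≤ B * l ^ 2 := by linarith [mul_le_mul_of_nonneg_left hΛl hB]
    have := mul_le_mul_of_nonneg_left hYl hF
    linarith

theorem sum_third_order_le {ι : Type*} [Fintype ι] [DecidableEq ι] (o : ι) {F e l φ τ : ι → ℝ}
    (hA : 0 ≤ A) (hB : 0 ≤ B) (hβ : 2 ≤ β) (hΛ : 0 ≤ l o) (hF : ∀ i, 0 ≤ F i)
    (he : ∀ i, i ≠ o → 0 ≤ e i) (heF : ∀ i, i ≠ o → F i - F o = e i * (l o - l i))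
    (hφ : ∀ i, φ i ^ 2 ≤ B / 4 * l i ^ 2 + A / 4) (hY : ∀ i, (φ i + τ i) ^ 2 ≤ Y)
    (hlarge : 980 * Fintype.card ι * Y ≤ B * l o ^ 2) :
    ∑ i, F i * ((φ i + τ i) ^ 2 / β + τ i ^ 2) -
        2 * l o * ∑ i ∈ Finset.univ.erase o, e i * τ i ^ 2 ≤
      B * ∑ i, F i * l i ^ 2 + A / 2 * ∑ i, F i := by
  have hY₀ : 0 ≤ Y := (sq_nonneg _).trans (hY o)
  have hcard : (1 : ℝ) ≤ Fintype.card ι := by exact_mod_cast Fintype.card_pos_iff.2 ⟨o⟩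
  have hYΛ : 980 * Y ≤ B * l o ^ 2 := by linarith [le_mul_of_one_le_left hY₀ hcard]
  have hleading := mul_le_mul_of_nonneg_left (sq_div_add_sq_le hβ (hφ o) (hY o)) (hF o)
  have hothers : ∑ i ∈ Finset.univ.erase o,
      (F i * ((φ i + τ i) ^ 2 / β + τ i ^ 2) - 2 * l o * (e i * τ i ^ 2)) ≤
        ∑ i ∈ Finset.univ.erase o, (B * (F i * l i ^ 2) + A / 2 * F i + 40 * Y * F o) := by
    refine Finset.sum_le_sum fun i hi => ?_
    have hio := (Finset.mem_erase.1 hi).1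
    linarith [third_order_le_of_ne hA hB hβ hΛ (hF i) (hF o) (he i hio) (heF i hio) (hφ i) (hY i)
      hYΛ]
  rw [Finset.sum_sub_distrib, Finset.sum_add_distrib, Finset.sum_add_distrib, Finset.sum_const,
    Finset.card_erase_of_mem (Finset.mem_univ o), Finset.card_univ, nsmul_eq_mul,
    ← Finset.mul_sum, ← Finset.mul_sum, ← Finset.mul_sum,
    Nat.cast_sub (Fintype.card_pos_iff.2 ⟨o⟩), Nat.cast_one] at hothers
  have hsurplus : 40 * Y * F o * Fintype.card ι ≤ B / 2 * F o * l o ^ 2 := by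
    have hYF : 0 ≤ Fintype.card ι * Y * F o := mul_nonneg (by positivity) (hF o)
    linarith [mul_le_mul_of_nonneg_right hlarge (hF o)]
  have hYF := mul_nonneg hY₀ (hF o)
  rw [← Finset.add_sum_erase _ _ (Finset.mem_univ o), ← Finset.add_sum_erase _
    (fun i => F i * l i ^ 2) (Finset.mem_univ o), ← Finset.add_sum_erase _ F (Finset.mem_univ o)]
  linarith

end ThirdOrderAbsorption

section MixedThirdOrder

theorem mul_abs_sub_mul_sq_le {a b ξ : ℝ} (ha : 0 < a) :
    b * |ξ| - a * ξ ^ 2 ≤ b ^ 2 / (4 * a) := by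
  rw [le_div_iff₀ (by positivity), ← sq_abs ξ]
  linarith [sq_nonneg (2 * a * |ξ| - b)]

theorem sum_mixed_third_order_le {ι : Type*} [Fintype ι] (S : Finset ι) {F ξ : ι → ℝ}
    {C c₀ G Λ : ℝ} (hc₀ : 0 < c₀) (hG : 0 < G) (hΛ : 1 ≤ Λ) (hF : ∀ p ∈ S, c₀ * G ≤ F p) :
    2 * G * C * (∑ p ∈ S, |ξ p|) / Λ ^ 2 -
        ∑ p ∈ S, F p * (2 * ξ p ^ 2 / (Fintype.card ι * Λ ^ 2)) ≤
      G * (Fintype.card ι ^ 2 * C ^ 2 / (2 * c₀)) := by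
  have hterm : ∀ p ∈ S, 2 * G * C / Λ ^ 2 * |ξ p| -
      F p * (2 * ξ p ^ 2 / (Fintype.card ι * Λ ^ 2)) ≤
        G * (Fintype.card ι * C ^ 2 / (2 * c₀)) := by
    intro p hp
    have hcard : (0 : ℝ) < Fintype.card ι := by exact_mod_cast Fintype.card_pos_iff.2 ⟨p⟩
    have : 0 < Λ := by linarith
    have : 0 < F p := (by positivity : 0 < c₀ * G).trans_le (hF p hp)
    calc 2 * G * C / Λ ^ 2 * |ξ p| - F p * (2 * ξ p ^ 2 / (Fintype.card ι * Λ ^ 2))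
        = 2 * G * C / Λ ^ 2 * |ξ p| - 2 * F p / (Fintype.card ι * Λ ^ 2) * ξ p ^ 2 := by ring
      _ ≤ (2 * G * C / Λ ^ 2) ^ 2 / (4 * (2 * F p / (Fintype.card ι * Λ ^ 2))) :=
          mul_abs_sub_mul_sq_le (by positivity)
      _ = Fintype.card ι * (G * C) ^ 2 / (2 * (F p * Λ ^ 2)) := by field_simp; ring
      _ ≤ Fintype.card ι * (G * C) ^ 2 / (2 * (c₀ * G * 1)) := by
          gcongr
          exacts [hF p hp, one_le_pow₀ hΛ]
      _ = G * (Fintype.card ι * C ^ 2 / (2 * c₀)) := by field_simp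
  calc _ = ∑ p ∈ S, (2 * G * C / Λ ^ 2 * |ξ p| -
          F p * (2 * ξ p ^ 2 / (Fintype.card ι * Λ ^ 2))) := by
        rw [Finset.sum_sub_distrib, ← Finset.mul_sum]; ring
    _ ≤ S.card * (G * (Fintype.card ι * C ^ 2 / (2 * c₀))) := by
        simpa only [nsmul_eq_mul] using Finset.sum_le_card_nsmul _ _ _ hterm
    _ ≤ Fintype.card ι * (G * (Fintype.card ι * C ^ 2 / (2 * c₀))) := by
        gcongr; exact Finset.card_le_univ S
    _ = _ := by ring

theorem abs_leading_third_order_le {A B β M M₁ R W x y Λ φ τ : ℝ} (hA : 0 ≤ A) (hB : 0 ≤ B)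
    (hβ : 0 ≤ β) (hM : 0 ≤ M) (hΛ : 1 ≤ Λ) (hW : 0 < W) (hWΛ : 1 ≤ W * Λ)
    (hy : |y| ≤ M₁) (hx : |x| ≤ R) (hτ : |φ + τ| ≤ β * M / W)
    (hφ : φ = B * y * Λ + A * x) : |τ| ≤ (β * M + B * M₁ + A * R) * Λ := by
  have hβMW : β * M / W ≤ β * M * Λ := by
    rw [div_le_iff₀ hW, mul_assoc, mul_comm Λ W]
    exact le_mul_of_one_le_right (mul_nonneg hβ hM) hWΛ
  have hφle : |φ| ≤ B * M₁ * Λ + A * R * Λ := by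
    rw [hφ]
    refine (abs_add_le _ _).trans (add_le_add ?_ ?_)
    · rw [abs_mul, abs_mul, abs_of_nonneg hB, abs_of_pos (by linarith : 0 < Λ)]
      gcongr
    · rw [abs_mul, abs_of_nonneg hA]
      exact (mul_le_mul_of_nonneg_left hx hA).trans
        (le_mul_of_one_le_right (mul_nonneg hA ((abs_nonneg x).trans hx)) hΛ)
  have : |τ| ≤ |φ + τ| + |φ| := by simpa using abs_sub (φ + τ) φ
  linarith

/-- Rotating the direction with angular speed `a = ξ / (n Λ)` gains a term quadratic in `ξ`. -/
theorem rotation_gain {n Λ l ξ : ℝ} (hn : 0 < n) (hΛ : 0 < Λ) (hl : Λ - l ≤ n * Λ) :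
    2 * (ξ / (n * Λ)) ^ 2 - (4 * (ξ / (n * Λ)) * ξ + 2 * (ξ / (n * Λ)) ^ 2 * l) / Λ ≤
      -(2 * ξ ^ 2 / (n * Λ ^ 2)) := by
  have hrest : 0 ≤ 2 * ξ ^ 2 / (n ^ 2 * Λ ^ 3) * (n * Λ - (Λ - l)) :=
    mul_nonneg (by positivity) (by linarith)
  have hsplit : 2 * (ξ / (n * Λ)) ^ 2 - (4 * (ξ / (n * Λ)) * ξ + 2 * (ξ / (n * Λ)) ^ 2 * l) / Λ =
      -(2 * ξ ^ 2 / (n * Λ ^ 2)) - 2 * ξ ^ 2 / (n ^ 2 * Λ ^ 3) * (n * Λ - (Λ - l)) := by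
    field_simp; ring
  linarith

end MixedThirdOrder

section Combination

/-- The coefficient of `sup (ū - u)` in the bound for the test function at its maximum point. -/
def pogorelovConst (n k : ℕ) (A B M M₁ R C c₀ β : ℝ) : ℝ :=
  B * n * M₁ * k * C + 2 * k * C + 2 * C * (β * M + B * M₁ + A * R) + n ^ 2 * C ^ 2 / (2 * c₀)

theorem pogorelovConst_nonneg {n k : ℕ} {A B M M₁ R C c₀ β : ℝ} (hA : 0 ≤ A) (hB : 0 ≤ B)
    (hM : 0 ≤ M) (hM₁ : 0 ≤ M₁) (hR : 0 ≤ R) (hC : 0 ≤ C) (hc₀ : 0 ≤ c₀) (hβ : 0 ≤ β) :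
    0 ≤ pogorelovConst n k A B M M₁ R C c₀ β := by
  unfold pogorelovConst
  positivity

/-- In the application `sF = ∑ Fᵢ`, `sFl = ∑ Fᵢ lᵢ²`, `sΨ = ∑ Fᵢ (Ψᵢ² / β + τᵢ²)`, `sΦ = ∑ Fᵢ Φ₂ᵢ`,
`sQ = ∑ Fᵢ Qᵢ`, while `E`, `X` and `Z` collect the third derivatives in the mixed terms. -/
theorem mul_le_of_maximum_inequalities {n k : ℕ} {A B β M M₁ R C c₀ W Λ θ G f τ E X Z : ℝ}
    {sF sFl sΨ sΦ sQ : ℝ} (hA : 0 < A) (hβ : 0 ≤ β) (hC : 0 ≤ C) (hW : 0 < W) (hΛ : 1 ≤ Λ)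
    (hG : 0 < G) (hf : f ≤ C * G) (hθ : θ * G ≤ sF)
    (hvisc : 0 ≤ β * (k * f) / W + sΨ - sΦ - sQ / Λ - Z)
    (hΨ : sΨ - 2 * Λ * E ≤ B * sFl + A / 2 * sF)
    (hΦ : B * sFl + A * sF - B * n * M₁ * k * C * G ≤ sΦ)
    (hQ : -(2 * G * C * (Λ * |τ| + X) / Λ) - k * C * G * (1 + Λ) + 2 * (Λ ^ 2 * E) ≤ sQ)
    (hX : 2 * G * C * X / Λ ^ 2 - Z ≤ G * (n ^ 2 * C ^ 2 / (2 * c₀)))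
    (hτ : |τ| ≤ (β * M + B * M₁ + A * R) * Λ) :
    W * θ ≤ 2 / A * (β * k * C + pogorelovConst n k A B M M₁ R C c₀ β * W) := by
  have hΛ₀ : 0 < Λ := by linarith
  have hQΛ : -(2 * G * C * (|τ| / Λ)) - 2 * G * C * X / Λ ^ 2 - k * C * G * (1 / Λ + 1) +
      2 * Λ * E ≤ sQ / Λ := by
    rw [le_div_iff₀ hΛ₀]
    refine le_of_eq_of_le ?_ hQ
    field_simp
    ring
  have hτΛ : 2 * G * C * (|τ| / Λ) ≤ 2 * G * C * (β * M + B * M₁ + A * R) :=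
    mul_le_mul_of_nonneg_left ((div_le_iff₀ hΛ₀).2 hτ) (by positivity)
  have hinvΛ : k * C * G * (1 / Λ + 1) ≤ k * C * G * 2 :=
    mul_le_mul_of_nonneg_left (by linarith [(div_le_one hΛ₀).2 hΛ]) (by positivity)
  have hfW : β * (k * f) / W ≤ β * (k * (C * G)) / W := by gcongr
  have hsum : A / 2 * sF ≤ β * (k * (C * G)) / W +
      G * pogorelovConst n k A B M M₁ R C c₀ β := by
    unfold pogorelovConst
    linarith
  have hscaled := mul_le_mul_of_nonneg_left
    ((mul_le_mul_of_nonneg_left hθ (by positivity : 0 ≤ A / 2)).trans hsum) hW.le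
  have hfactor : W * (β * (k * (C * G)) / W + G * pogorelovConst n k A B M M₁ R C c₀ β) =
      G * (β * k * C + pogorelovConst n k A B M M₁ R C c₀ β * W) := by
    field_simp
  have hcancel : A / 2 * (W * θ) ≤ β * k * C + pogorelovConst n k A B M M₁ R C c₀ β * W :=
    le_of_mul_le_mul_left (by linarith) hG
  rw [div_mul_eq_mul_div, le_div_iff₀ hA]
  linarith

end Combination

section DirectionalDerivatives

open Filter Topology

variable {E : Type*} [NormedAddCommGroup E] [NormedSpace ℝ E] {g g' : E → ℝ} {x : E}

/-- The derivative of `g` in the direction `v`, as an operator on functions, so that it can be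
iterated. -/
def dirDeriv (v : E) (g : E → ℝ) (x : E) : ℝ := fderiv ℝ g x v

theorem contDiffAt_dirDeriv {m k : WithTop ℕ∞} (hg : ContDiffAt ℝ k g x) (hmk : m + 1 ≤ k)
    (v : E) : ContDiffAt ℝ m (dirDeriv v g) x :=
  (hg.fderiv_right hmk).clm_apply contDiffAt_const

theorem eventuallyEq_dirDeriv (h : g =ᶠ[𝓝 x] g') (v : E) :
    dirDeriv v g =ᶠ[𝓝 x] dirDeriv v g' := by
  filter_upwards [h.fderiv (𝕜 := ℝ)] with y hy
  rw [dirDeriv, hy, dirDeriv]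

theorem dirDeriv_dirDeriv (hg : ContDiffAt ℝ 2 g x) (v w : E) :
    dirDeriv v (dirDeriv w g) x = fderiv ℝ (fderiv ℝ g) x v w := by
  have hdiff : DifferentiableAt ℝ (fderiv ℝ g) x :=
    (hg.fderiv_right (m := 1) (by norm_num)).differentiableAt (by simp)
  change fderiv ℝ (fun y => fderiv ℝ g y w) x v = _
  simp [fderiv_clm_apply hdiff (differentiableAt_const w)]

theorem fderiv_fderiv_comm (hg : ContDiffAt ℝ 2 g x) (v w : E) :
    fderiv ℝ (fderiv ℝ g) x v w = fderiv ℝ (fderiv ℝ g) x w v :=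
  hg.isSymmSndFDerivAt (by simp) v w

theorem dirDeriv_comm (hg : ContDiffAt ℝ 2 g x) (v w : E) :
    dirDeriv v (dirDeriv w g) x = dirDeriv w (dirDeriv v g) x := by
  rw [dirDeriv_dirDeriv hg, dirDeriv_dirDeriv hg, fderiv_fderiv_comm hg]

theorem eventuallyEq_dirDeriv_comm (hg : ContDiffAt ℝ 2 g x) (v w : E) :
    dirDeriv v (dirDeriv w g) =ᶠ[𝓝 x] dirDeriv w (dirDeriv v g) := by
  filter_upwards [hg.eventually (by simp)] with y hy using dirDeriv_comm hy v w

theorem dirDeriv_dirDeriv_comm_right (hg : ContDiffAt ℝ 2 g x) (v w z : E) :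
    dirDeriv v (dirDeriv w (dirDeriv z g)) x = dirDeriv v (dirDeriv z (dirDeriv w g)) x :=
  (eventuallyEq_dirDeriv (eventuallyEq_dirDeriv_comm hg w z) v).eq_of_nhds

theorem dirDeriv_dirDeriv_comm_left (hg : ContDiffAt ℝ 3 g x) (v w z : E) :
    dirDeriv v (dirDeriv w (dirDeriv z g)) x = dirDeriv w (dirDeriv v (dirDeriv z g)) x :=
  dirDeriv_comm (contDiffAt_dirDeriv hg (by norm_num) z) v w

theorem dirDeriv_dirDeriv_rotate (hg : ContDiffAt ℝ 3 g x) (v w z : E) :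
    dirDeriv v (dirDeriv w (dirDeriv z g)) x = dirDeriv w (dirDeriv z (dirDeriv v g)) x := by
  rw [dirDeriv_dirDeriv_comm_left hg, dirDeriv_dirDeriv_comm_right (hg.of_le (by norm_num))]

theorem dirDeriv_dirDeriv_dirDeriv_comm (hg : ContDiffAt ℝ 4 g x) (v w : E) :
    dirDeriv v (dirDeriv v (dirDeriv w (dirDeriv w g))) x =
      dirDeriv w (dirDeriv w (dirDeriv v (dirDeriv v g))) x := by
  have hrotate : dirDeriv v (dirDeriv w (dirDeriv w g)) =ᶠ[𝓝 x]
      dirDeriv w (dirDeriv w (dirDeriv v g)) := by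
    filter_upwards [(hg.of_le (m := 3) (by norm_num)).eventually (by simp)] with y hy using
      dirDeriv_dirDeriv_rotate hy v w w
  rw [(eventuallyEq_dirDeriv hrotate v).eq_of_nhds,
    dirDeriv_dirDeriv_rotate (contDiffAt_dirDeriv hg (by norm_num) v)]

theorem hasTwoJet_line (hg : ContDiffAt ℝ 2 g x) (v : E) :
    HasTwoJet (fun t => g (x + t • v)) (g x) (dirDeriv v g x) (dirDeriv v (dirDeriv v g) x) :=
  HasTwoJet.of_contDiffAt hg v

end DirectionalDerivatives

section TestFunction

open Filter Topology

variable {E : Type*} [NormedAddCommGroup E] [InnerProductSpace ℝ E]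

theorem hasTwoJet_norm_sq_line (x v : E) :
    HasTwoJet (fun t : ℝ => ‖x + t • v‖ ^ 2) (‖x‖ ^ 2) (2 * inner ℝ x v) (2 * ‖v‖ ^ 2) := by
  have hexpand : ∀ t : ℝ, ‖x + t • v‖ ^ 2 = ‖x‖ ^ 2 + t * (2 * inner ℝ x v) + t * t * ‖v‖ ^ 2 :=
    fun t => by
      rw [norm_add_sq_real, inner_smul_right, norm_smul, mul_pow, Real.norm_eq_abs, sq_abs]
      ring
  simp only [hexpand]
  exact (((HasTwoJet.const _).add (HasTwoJet.id.mul (HasTwoJet.const _))).add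
    ((HasTwoJet.id.mul HasTwoJet.id).mul (HasTwoJet.const _))).congr_coeff
      (by ring) (by ring) (by ring)

/-- The exponent `B/2 |Du|² + A/2 |x - z|²` of the exponential factor in Pogorelov's test
function. -/
def pogorelovWeight (A B : ℝ) (z : E) (u : E → ℝ) (x : E) : ℝ :=
  B / 2 * ‖fderiv ℝ u x‖ ^ 2 + A / 2 * ‖x - z‖ ^ 2

/-- Pogorelov's test function `(ū - u)ᵐ D²u(v, v) exp(weight)`, as a function of the point and of
the direction `v`; it is quadratic in `v`. -/
def pogorelovFunction (m : ℕ) (A B : ℝ) (z : E) (u ub : E → ℝ) (x v : E) : ℝ :=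
  (ub x - u x) ^ m * fderiv ℝ (fderiv ℝ u) x v v * Real.exp (pogorelovWeight A B z u x)

variable {ι : Type*} [Fintype ι] {b : OrthonormalBasis ι ℝ E} {l : ι → ℝ} {u : E → ℝ} {x₀ : E}

theorem pogorelovWeight_eq_sum (A B : ℝ) (z : E) (u : E → ℝ) (b : OrthonormalBasis ι ℝ E) (x : E) :
    pogorelovWeight A B z u x =
      B / 2 * ∑ r, dirDeriv (b r) u x ^ 2 + A / 2 * ‖x - z‖ ^ 2 := by
  simp only [pogorelovWeight, b.norm_dual, dirDeriv]

theorem contDiffAt_pogorelovWeight {k m : WithTop ℕ∞} (hu : ContDiffAt ℝ k u x₀) (hmk : m + 1 ≤ k)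
    (b : OrthonormalBasis ι ℝ E) (A B : ℝ) (z : E) :
    ContDiffAt ℝ m (pogorelovWeight A B z u) x₀ := by
  rw [funext (pogorelovWeight_eq_sum A B z u b)]
  exact (contDiffAt_const.mul (ContDiffAt.sum fun r _ =>
    (contDiffAt_dirDeriv hu hmk (b r)).pow 2)).add
      (contDiffAt_const.mul ((contDiffAt_id.sub contDiffAt_const).norm_sq ℝ))

/-- A direction field through `b o` at `x₀` that turns towards `b p` with speed `a p` when the base
point moves along `b p`. -/
def rotatingField (b : OrthonormalBasis ι ℝ E) (o : ι) (a : ι → ℝ) (x₀ x : E) : E :=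
  b o + ∑ p, (a p * inner ℝ (b p) (x - x₀)) • b p

theorem rotatingField_line (o : ι) (a : ι → ℝ) (i : ι) (t : ℝ) :
    rotatingField b o a x₀ (x₀ + t • b i) = b o + t • (a i • b i) := by
  classical
  simp [rotatingField, inner_smul_right, b.inner_eq_ite, smul_smul, mul_comm]

@[simp]
theorem rotatingField_self (o : ι) (a : ι → ℝ) : rotatingField b o a x₀ x₀ = b o := by
  simp [rotatingField]

theorem contDiff_rotatingField {k : WithTop ℕ∞} (o : ι) (a : ι → ℝ) :
    ContDiff ℝ k (rotatingField b o a x₀) := by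
  refine contDiff_const.add (ContDiff.sum fun p _ => ?_)
  have hspeed : ContDiff ℝ k fun x => a p * inner ℝ (b p) (x - x₀) :=
    contDiff_const.mul (contDiff_const.inner ℝ (contDiff_id.sub contDiff_const))
  exact hspeed.smul contDiff_const

theorem hasTwoJet_rotatingField_norm_sq {o : ι} {a : ι → ℝ} (ha : a o = 0) (i : ι) :
    HasTwoJet (fun t => ‖rotatingField b o a x₀ (x₀ + t • b i)‖ ^ 2) 1 0 (2 * a i ^ 2) := by
  simp only [rotatingField_line]
  refine (hasTwoJet_norm_sq_line (b o) (a i • b i)).congr_coeff (by simp) ?_ (by simp [norm_smul])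
  rcases eq_or_ne o i with rfl | hoi
  · simp [ha]
  · simp [inner_smul_right, b.orthonormal.2 hoi]

variable [DecidableEq ι]

theorem dirDeriv_dirDeriv_basis (hu : ContDiffAt ℝ 2 u x₀)
    (hl : formMatrix b (fderiv ℝ (fderiv ℝ u) x₀) = Matrix.diagonal l) (p q : ι) :
    dirDeriv (b p) (dirDeriv (b q) u) x₀ = Matrix.diagonal l p q := by
  rw [dirDeriv_dirDeriv hu, ← hl, formMatrix, Matrix.of_apply]

theorem hasTwoJet_pogorelovWeight_line (hu : ContDiffAt ℝ 3 u x₀)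
    (hl : formMatrix b (fderiv ℝ (fderiv ℝ u) x₀) = Matrix.diagonal l) (A B : ℝ) (z : E) (i : ι) :
    HasTwoJet (fun t => pogorelovWeight A B z u (x₀ + t • b i)) (pogorelovWeight A B z u x₀)
      (B * dirDeriv (b i) u x₀ * l i + A * inner ℝ (x₀ - z) (b i))
      (B * (l i ^ 2 + ∑ r, dirDeriv (b r) u x₀ *
        dirDeriv (b i) (dirDeriv (b i) (dirDeriv (b r) u)) x₀) + A) := by
  have hgradient := HasTwoJet.sum (s := Finset.univ) fun r _ =>
    (hasTwoJet_line (contDiffAt_dirDeriv hu (by norm_num) (b r)) (b i)).pow 2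
  have hjet := (hgradient.const_mul (B / 2)).add
    ((hasTwoJet_norm_sq_line (x₀ - z) (b i)).const_mul (A / 2))
  have hline : ∀ t : ℝ, pogorelovWeight A B z u (x₀ + t • b i) =
      B / 2 * ∑ r, dirDeriv (b r) u (x₀ + t • b i) ^ 2 + A / 2 * ‖x₀ - z + t • b i‖ ^ 2 :=
    fun t => by rw [pogorelovWeight_eq_sum A B z u b, show x₀ + t • b i - z = x₀ - z + t • b i by
      abel]
  simp only [hline]
  have hbasis := dirDeriv_dirDeriv_basis (hu.of_le (by norm_num)) hl i
  refine hjet.congr_coeff (pogorelovWeight_eq_sum A B z u b x₀).symm ?_ ?_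
  · simp only [Nat.cast_ofNat, Nat.add_one_sub_one, pow_one, hbasis, Matrix.diagonal_apply, mul_ite,
      mul_zero, Finset.sum_ite_eq, Finset.mem_univ, ↓reduceIte]
    ring
  · simp only [Nat.cast_ofNat, Nat.add_one_sub_one, Nat.cast_one, tsub_self, pow_zero, mul_one,
      hbasis, Matrix.diagonal_apply, ite_pow, ne_eq, OfNat.ofNat_ne_zero, not_false_eq_true,
      zero_pow, mul_ite, mul_zero, pow_one, mul_assoc, Finset.sum_add_distrib, Finset.sum_ite_eq,
      Finset.mem_univ, ↓reduceIte, ← Finset.mul_sum, OrthonormalBasis.norm_eq_one, one_pow,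
      isUnit_iff_ne_zero, IsUnit.div_mul_cancel, add_left_inj]
    ring

theorem dirDeriv_pogorelovWeight (hu : ContDiffAt ℝ 3 u x₀)
    (hl : formMatrix b (fderiv ℝ (fderiv ℝ u) x₀) = Matrix.diagonal l) (A B : ℝ) (z : E) (i : ι) :
    dirDeriv (b i) (pogorelovWeight A B z u) x₀ =
      B * dirDeriv (b i) u x₀ * l i + A * inner ℝ (x₀ - z) (b i) :=
  ((hasTwoJet_line (contDiffAt_pogorelovWeight hu (by norm_num) b A B z) (b i)).unique
    (hasTwoJet_pogorelovWeight_line hu hl A B z i)).2.1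

theorem dirDeriv_dirDeriv_pogorelovWeight (hu : ContDiffAt ℝ 3 u x₀)
    (hl : formMatrix b (fderiv ℝ (fderiv ℝ u) x₀) = Matrix.diagonal l) (A B : ℝ) (z : E) (i : ι) :
    dirDeriv (b i) (dirDeriv (b i) (pogorelovWeight A B z u)) x₀ =
      B * (l i ^ 2 + ∑ r, dirDeriv (b r) u x₀ *
        dirDeriv (b i) (dirDeriv (b i) (dirDeriv (b r) u)) x₀) + A :=
  ((hasTwoJet_line (contDiffAt_pogorelovWeight hu (by norm_num) b A B z) (b i)).unique
    (hasTwoJet_pogorelovWeight_line hu hl A B z i)).2.2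

theorem hasTwoJet_form_rotatingField (hu : ContDiffAt ℝ 4 u x₀)
    (hl : formMatrix b (fderiv ℝ (fderiv ℝ u) x₀) = Matrix.diagonal l) {o : ι} {a : ι → ℝ}
    (ha : a o = 0) (i : ι) :
    HasTwoJet (fun t => fderiv ℝ (fderiv ℝ u) (x₀ + t • b i)
        (rotatingField b o a x₀ (x₀ + t • b i)) (rotatingField b o a x₀ (x₀ + t • b i)))
      (l o) (dirDeriv (b i) (dirDeriv (b o) (dirDeriv (b o) u)) x₀)
      (dirDeriv (b i) (dirDeriv (b i) (dirDeriv (b o) (dirDeriv (b o) u))) x₀ +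
        4 * a i * dirDeriv (b o) (dirDeriv (b i) (dirDeriv (b i) u)) x₀ + 2 * a i ^ 2 * l i) := by
  have hsecond : ∀ p q, ContDiffAt ℝ 2 (dirDeriv (b p) (dirDeriv (b q) u)) x₀ := fun p q =>
    contDiffAt_dirDeriv (contDiffAt_dirDeriv hu (m := 3) (by norm_num) _) (by norm_num) _
  have hentry : ∀ p q, _ := fun p q => hasTwoJet_line (hsecond p q) (b i)
  have hexpand := ((hentry o o).add ((HasTwoJet.id.mul (hentry o i)).const_mul (2 * a i))).add
    (((HasTwoJet.id.mul HasTwoJet.id).mul (hentry i i)).const_mul (a i ^ 2))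
  have hline : Tendsto (fun t : ℝ => x₀ + t • b i) (𝓝 0) (𝓝 x₀) := by
    have : ContinuousAt (fun t : ℝ => x₀ + t • b i) 0 := by fun_prop
    simpa [ContinuousAt] using this
  have hu₂ : ContDiffAt ℝ 2 u x₀ := hu.of_le (by norm_num)
  have hbasis := dirDeriv_dirDeriv_basis hu₂ hl
  refine (hexpand.congr ?_).congr_coeff ?_ ?_ ?_
  · filter_upwards [hline.eventually (hu₂.eventually (by simp))] with t ht
    simp only [rotatingField_line, map_add, map_smul, add_apply, smul_apply, smul_eq_mul,
      dirDeriv_dirDeriv ht, fderiv_fderiv_comm ht (b i) (b o)]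
    ring
  · simp [hbasis]
  · rcases eq_or_ne o i with rfl | hoi
    · simp [hbasis, ha]
    · simp [hbasis, Matrix.diagonal_apply_ne _ hoi]
  · rw [hbasis i i, Matrix.diagonal_apply_eq,
      dirDeriv_dirDeriv_comm_left (hu.of_le (by norm_num)) (b i) (b o)]
    ring

end TestFunction

section Touching

open Filter Topology

variable {E : Type*} [NormedAddCommGroup E]

section Barrier

variable [NormedSpace ℝ E] {u ub ψ : E → ℝ} {x₀ : E} {β : ℝ}

/-- The barrier `u + w`, `w = (ū - u)(x₀) exp((ψ - ψ(x₀)) / β)`, touches `ū` from above at `x₀`. -/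
theorem fderiv_touching (hβ : β ≠ 0) (hub : DifferentiableAt ℝ ub x₀) (hu : DifferentiableAt ℝ u x₀)
    (hψ : DifferentiableAt ℝ ψ x₀)
    (hle : ∀ᶠ x in 𝓝 x₀, ub x - u x ≤ (ub x₀ - u x₀) * Real.exp ((ψ x - ψ x₀) / β)) :
    β • (fderiv ℝ ub x₀ - fderiv ℝ u x₀) = (ub x₀ - u x₀) • fderiv ℝ ψ x₀ := by
  have hbarrier : HasFDerivAt (fun x => (ub x₀ - u x₀) * Real.exp ((ψ x - ψ x₀) / β))
      ((ub x₀ - u x₀) • β⁻¹ • fderiv ℝ ψ x₀) x₀ := by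
    simpa [div_eq_mul_inv] using
      (((hψ.hasFDerivAt.sub_const (ψ x₀)).mul_const β⁻¹).exp).const_mul (ub x₀ - u x₀)
  have hmax : IsLocalMax
      (fun x => ub x - u x - (ub x₀ - u x₀) * Real.exp ((ψ x - ψ x₀) / β)) x₀ := by
    filter_upwards [hle] with x hx
    simpa using hx
  have hcritical := hmax.hasFDerivAt_eq_zero
    ((hub.hasFDerivAt.sub hu.hasFDerivAt).sub hbarrier)
  rw [sub_eq_zero.1 hcritical, smul_comm β, smul_inv_smul₀ hβ]

end Barrier

variable [InnerProductSpace ℝ E] [FiniteDimensional ℝ E] [MeasurableSpace E] [BorelSpace E]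
  {μ : Measure E} [μ.IsAddHaarMeasure] {ι : Type*} [Fintype ι] {b : ι → E} {Ω : Set E}
  {D K : ℝ≥0} {F : ι → ℝ} {u ub ψ : E → ℝ} {x₀ : E} {β : ℝ} {Ψ Ψ₂ : ι → ℝ}

theorem second_order_touching (hΩ : IsOpen Ω) (hdiff : ∀ x ∈ Ω, DifferentiableAt ℝ ub x)
    (hD : ∀ x ∈ Ω, ‖fderiv ℝ ub x‖₊ ≤ D) (hK : LipschitzOnWith K (fderiv ℝ ub) Ω)
    (hF : ∀ i, 0 ≤ F i)
    (hae : ∀ᵐ x ∂μ.restrict Ω, DifferentiableAt ℝ (fderiv ℝ ub) x ∧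
      0 ≤ ∑ i, F i * fderiv ℝ (fderiv ℝ ub) x (b i) (b i))
    (hx₀ : x₀ ∈ Ω) (hβ : 0 < β) (hW : 0 < ub x₀ - u x₀) (hu : ContDiffAt ℝ 2 u x₀)
    (hψ : ContDiffAt ℝ 2 ψ x₀)
    (hjet : ∀ i, HasTwoJet (fun t => ψ (x₀ + t • b i)) (ψ x₀) (Ψ i) (Ψ₂ i))
    (hle : ∀ᶠ x in 𝓝 x₀, ub x - u x ≤ (ub x₀ - u x₀) * Real.exp ((ψ x - ψ x₀) / β)) :
    0 ≤ β * (∑ i, F i * dirDeriv (b i) (dirDeriv (b i) u) x₀) / (ub x₀ - u x₀) +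
      ∑ i, F i * (Ψ₂ i + Ψ i ^ 2 / β) := by
  set W := ub x₀ - u x₀ with hWdef
  set q : E → ℝ := fun x => u x + W * Real.exp ((ψ x - ψ x₀) * β⁻¹) with hq
  have hqC : ContDiffAt ℝ 2 q x₀ :=
    hu.add (contDiffAt_const.mul ((hψ.sub contDiffAt_const).mul contDiffAt_const).exp)
  have hsub := viscosity_subsolution hΩ hdiff hD hK hF hae hx₀ hqC
    (by
      filter_upwards [hle] with x hx
      rw [div_eq_mul_inv] at hx
      simpa only [hq, sub_le_iff_le_add'] using hx)
    (by simp [hq, hWdef])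
  have hsecond : ∀ i, fderiv ℝ (fun y => fderiv ℝ q y (b i)) x₀ (b i) =
      dirDeriv (b i) (dirDeriv (b i) u) x₀ + W / β * (Ψ₂ i + Ψ i ^ 2 / β) := by
    intro i
    have hqjet := (hasTwoJet_line hu (b i)).add
      (((((hjet i).sub (HasTwoJet.const (ψ x₀))).mul (HasTwoJet.const β⁻¹)).exp).const_mul W)
    rw [((HasTwoJet.of_contDiffAt hqC (b i)).unique hqjet).2.2]
    simp only [sub_self, zero_mul, Real.exp_zero]
    field_simp
    ring
  have hfactor : ∑ i, F i * (dirDeriv (b i) (dirDeriv (b i) u) x₀ +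
      W / β * (Ψ₂ i + Ψ i ^ 2 / β)) = W / β *
        (β * (∑ i, F i * dirDeriv (b i) (dirDeriv (b i) u) x₀) / W +
          ∑ i, F i * (Ψ₂ i + Ψ i ^ 2 / β)) := by
    rw [mul_add, show W / β * (β * (∑ i, F i * dirDeriv (b i) (dirDeriv (b i) u) x₀) / W) =
      ∑ i, F i * dirDeriv (b i) (dirDeriv (b i) u) x₀ by field_simp, Finset.mul_sum,
      ← Finset.sum_add_distrib]
    exact Finset.sum_congr rfl fun i _ => by ring
  rw [Finset.sum_congr rfl fun i _ => by rw [hsecond i], hfactor] at hsub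
  exact nonneg_of_mul_nonneg_right hsub (by positivity)

end Touching

section TouchingExponent

open Filter Topology

variable {E : Type*} [NormedAddCommGroup E] [InnerProductSpace ℝ E] {A B : ℝ} {z x₀ : E}
  {u ub : E → ℝ} {V : E → E}

/-- The logarithm of `|V|² / (D²u(V, V) exp(weight))`: if Pogorelov's test function, normalized by
`|v|²`, is maximal at `x₀` in the direction `V x₀`, then `m log (ū - u)` minus this function has a
local maximum at `x₀`. -/
def touchingExponent (A B : ℝ) (z : E) (u : E → ℝ) (V : E → E) (x : E) : ℝ :=
  Real.log (‖V x‖ ^ 2) - pogorelovWeight A B z u x -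
    Real.log (fderiv ℝ (fderiv ℝ u) x (V x) (V x))

theorem eventually_sub_le_exp_of_isMax {m : ℕ} (hm : m ≠ 0) (hW : 0 < ub x₀ - u x₀)
    (hu : ContDiffAt ℝ 2 u x₀) (hV : ContinuousAt V x₀) (hV₀ : ‖V x₀‖ = 1)
    (hpos : 0 < fderiv ℝ (fderiv ℝ u) x₀ (V x₀) (V x₀))
    (hmax : ∀ᶠ x in 𝓝 x₀, ∀ v, pogorelovFunction m A B z u ub x v ≤
      pogorelovFunction m A B z u ub x₀ (V x₀) * ‖v‖ ^ 2) :
    ∀ᶠ x in 𝓝 x₀, ub x - u x ≤ (ub x₀ - u x₀) * Real.exp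
      ((touchingExponent A B z u V x - touchingExponent A B z u V x₀) / m) := by
  have hm₀ : (0 : ℝ) < m := by exact_mod_cast Nat.pos_of_ne_zero hm
  have hD2u : ContinuousAt (fderiv ℝ (fderiv ℝ u)) x₀ :=
    ((hu.fderiv_right (m := 1) (by norm_num)).fderiv_right (m := 0) (by norm_num)).continuousAt
  have hform : ContinuousAt (fun x => fderiv ℝ (fderiv ℝ u) x (V x) (V x)) x₀ :=
    (hD2u.clm_apply hV).clm_apply hV
  filter_upwards [hmax, hform.eventually_const_lt hpos,
    hV.norm.eventually_const_lt (by simp [hV₀] : (0 : ℝ) < _)] with x hx hformx hVx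
  rcases le_or_gt (ub x - u x) 0 with hWx | hWx
  · exact hWx.trans (by positivity)
  have hlog := Real.log_le_log (by unfold pogorelovFunction; positivity) (hx (V x))
  unfold pogorelovFunction at hlog
  rw [Real.log_mul (by positivity) (by positivity), Real.log_mul (by positivity) (by positivity),
    Real.log_mul (by positivity) (by positivity), Real.log_mul (by positivity) (by positivity),
    Real.log_mul (by positivity) (by positivity), Real.log_pow (n := m), Real.log_pow (n := m),
    Real.log_exp, Real.log_exp] at hlog
  rw [← Real.log_le_log_iff hWx (by positivity), Real.log_mul hW.ne' (by positivity), Real.log_exp,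
    ← sub_le_iff_le_add', le_div_iff₀ hm₀]
  simp only [touchingExponent, hV₀, one_pow, Real.log_one]
  linarith

theorem contDiffAt_touchingExponent {ι : Type*} [Fintype ι] (b : OrthonormalBasis ι ℝ E)
    (hu : ContDiffAt ℝ 4 u x₀) (hV : ContDiffAt ℝ 2 V x₀) (hV₀ : V x₀ ≠ 0)
    (hpos : 0 < fderiv ℝ (fderiv ℝ u) x₀ (V x₀) (V x₀)) :
    ContDiffAt ℝ 2 (touchingExponent A B z u V) x₀ := by
  have hD2u : ContDiffAt ℝ 2 (fderiv ℝ (fderiv ℝ u)) x₀ :=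
    (hu.fderiv_right (m := 3) (by norm_num)).fderiv_right (by norm_num)
  exact (((hV.norm_sq ℝ).log (by positivity)).sub
    (contDiffAt_pogorelovWeight hu (by norm_num) b A B z)).sub
      (((hD2u.clm_apply hV).clm_apply hV).log hpos.ne')

theorem hasTwoJet_touchingExponent {ι : Type*} [Fintype ι] [DecidableEq ι]
    {b : OrthonormalBasis ι ℝ E} {l : ι → ℝ} (hu : ContDiffAt ℝ 4 u x₀)
    (hl : formMatrix b (fderiv ℝ (fderiv ℝ u) x₀) = Matrix.diagonal l) {o : ι} {a : ι → ℝ}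
    (ha : a o = 0) (hlo : 0 < l o) (i : ι) :
    HasTwoJet (fun t => touchingExponent A B z u (rotatingField b o a x₀) (x₀ + t • b i))
      (touchingExponent A B z u (rotatingField b o a x₀) x₀)
      (-dirDeriv (b i) (pogorelovWeight A B z u) x₀ -
        dirDeriv (b i) (dirDeriv (b o) (dirDeriv (b o) u)) x₀ / l o)
      (2 * a i ^ 2 - dirDeriv (b i) (dirDeriv (b i) (pogorelovWeight A B z u)) x₀ -
        (dirDeriv (b i) (dirDeriv (b i) (dirDeriv (b o) (dirDeriv (b o) u))) x₀ +
          4 * a i * dirDeriv (b o) (dirDeriv (b i) (dirDeriv (b i) u)) x₀ +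
            2 * a i ^ 2 * l i) / l o +
        (dirDeriv (b i) (dirDeriv (b o) (dirDeriv (b o) u)) x₀ / l o) ^ 2) := by
  have hlo_form : fderiv ℝ (fderiv ℝ u) x₀ (b o) (b o) = l o := by
    simpa [formMatrix] using congrFun (congrFun hl o) o
  have hjet := (((hasTwoJet_rotatingField_norm_sq (b := b) (x₀ := x₀) ha i).log one_pos).sub
    (hasTwoJet_line (contDiffAt_pogorelovWeight hu (by norm_num) b A B z) (b i))).sub
      ((hasTwoJet_form_rotatingField hu hl ha i).log hlo)
  refine hjet.congr_coeff (by simp [touchingExponent, hlo_form]) (by ring) ?_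
  field_simp
  ring

end TouchingExponent

section JetsOfCompositions

open Filter Topology

theorem exists_hasTwoJet_root {η s : ℝ → ℝ} {s₀ s₁ s₂ : ℝ} (j : ℕ) (hs : HasTwoJet s s₀ s₁ s₂)
    (hη : ∀ᶠ t in 𝓝 0, 0 < η t) (hpow : ∀ᶠ t in 𝓝 0, η t ^ (j + 1) = s t) :
    ∃ η₁ η₂, HasTwoJet η (η 0) η₁ η₂ ∧ s₁ = (j + 1) * η 0 ^ j * η₁ ∧
      s₂ = (j + 1) * (j * η 0 ^ (j - 1)) * η₁ ^ 2 + (j + 1) * η 0 ^ j * η₂ := by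
  have hs₀ : 0 < s₀ := by
    rw [← hs.val, ← hpow.self_of_nhds]
    exact pow_pos hη.self_of_nhds _
  set r : ℝ := ((j + 1 : ℕ) : ℝ)⁻¹ with hr
  have hrpow := hs.comp (g := fun y => y ^ r) (g' := fun y => r * y ^ (r - 1))
    (by
      filter_upwards [lt_mem_nhds hs₀] with y hy
      exact Real.hasDerivAt_rpow_const (Or.inl hy.ne'))
    ((Real.hasDerivAt_rpow_const (Or.inl hs₀.ne')).const_mul r)
  have hη_eq : η =ᶠ[𝓝 0] fun t => s t ^ r := by
    filter_upwards [hη, hpow] with t ht htpow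
    rw [← htpow, hr, Real.pow_rpow_inv_natCast ht.le (by omega)]
  have hηjet := (hrpow.congr hη_eq).congr_coeff (hrpow.congr hη_eq).val.symm rfl rfl
  have hunique := ((hηjet.pow (j + 1)).congr (hpow.mono fun t ht => ht.symm)).unique hs
  refine ⟨_, _, hηjet, ?_, ?_⟩
  · simpa only [Nat.add_sub_cancel, Nat.cast_add, Nat.cast_one] using hunique.2.1.symm
  · simpa only [Nat.add_sub_cancel, Nat.cast_add, Nat.cast_one] using hunique.2.2.symm

section LipschitzGradient

variable {E : Type*} [NormedAddCommGroup E] [NormedSpace ℝ E] {g : E → ℝ} {S : Set E} {M : ℝ≥0}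

theorem norm_fderiv_apply_sub_le (hbound : ∀ p ∈ S, ‖fderiv ℝ g p‖ ≤ M)
    (hlip : LipschitzOnWith M (fderiv ℝ g) S) {p q : E} (hp : p ∈ S) (hq : q ∈ S) (v w : E) :
    ‖fderiv ℝ g p v - fderiv ℝ g q w‖ ≤ M * ‖v - w‖ + M * ‖p - q‖ * ‖w‖ := by
  have hsplit : fderiv ℝ g p v - fderiv ℝ g q w =
      fderiv ℝ g p (v - w) + (fderiv ℝ g p - fderiv ℝ g q) w := by
    simp
  rw [hsplit]
  exact norm_add_le_of_le (ContinuousLinearMap.le_of_opNorm_le _ (hbound p hp) _)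
    (ContinuousLinearMap.le_of_opNorm_le _ (hlip.norm_sub_le hp hq) _)

theorem HasTwoJet.bounds_of_lipschitzOnWith (hdiff : ∀ p ∈ S, DifferentiableAt ℝ g p)
    (hbound : ∀ p ∈ S, ‖fderiv ℝ g p‖ ≤ M) (hlip : LipschitzOnWith M (fderiv ℝ g) S)
    {γ γ' : ℝ → E} {γ'' : E} (hγS : ∀ᶠ t in 𝓝 0, γ t ∈ S)
    (hγ : ∀ᶠ t in 𝓝 0, HasDerivAt γ (γ' t) t) (hγ' : HasDerivAt γ' γ'' 0) {a g₁ g₂ : ℝ}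
    (hjet : HasTwoJet (fun t => g (γ t)) a g₁ g₂) :
    |g₁| ≤ M * ‖γ' 0‖ ∧ |g₂| ≤ M * ‖γ''‖ + M * ‖γ' 0‖ ^ 2 := by
  obtain ⟨η', -, rfl, hη, hη'⟩ := hjet
  have hη'_eq : ∀ᶠ t in 𝓝 0, η' t = fderiv ℝ g (γ t) (γ' t) := by
    filter_upwards [hγS, hγ, hη] with t htS htγ htη
    exact htη.unique ((hdiff _ htS).hasFDerivAt.comp_hasDerivAt t htγ)
  have hγ₀ := hγS.self_of_nhds
  have hη'₀ := hη'_eq.self_of_nhds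
  refine ⟨?_, ?_⟩
  · rw [hη'₀]
    exact ContinuousLinearMap.le_of_opNorm_le _ (hbound _ hγ₀) _
  have hslope := ((hasDerivAt_iff_tendsto_slope.1 hγ').norm.const_mul (M : ℝ)).add
    (((hasDerivAt_iff_tendsto_slope.1 hγ.self_of_nhds).norm.mul_const ‖γ' 0‖).const_mul (M : ℝ))
  rw [← Real.norm_eq_abs, sq]
  refine le_of_tendsto_of_tendsto (hasDerivAt_iff_tendsto_slope.1 hη').norm hslope ?_
  filter_upwards [nhdsWithin_le_nhds hη'_eq, nhdsWithin_le_nhds hγS] with t htη' htS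
  rw [slope_def_module, slope_def_module, slope_def_module, norm_smul, norm_smul, norm_smul, htη',
    hη'₀]
  calc ‖(t - 0)⁻¹‖ * ‖fderiv ℝ g (γ t) (γ' t) - fderiv ℝ g (γ 0) (γ' 0)‖
      ≤ ‖(t - 0)⁻¹‖ * (M * ‖γ' t - γ' 0‖ + M * ‖γ t - γ 0‖ * ‖γ' 0‖) := by
        gcongr
        exact norm_fderiv_apply_sub_le hbound hlip htS hγ₀ _ _
    _ = _ := by ring

end LipschitzGradient

end JetsOfCompositions

section DifferentiatedEquation

open Filter Topology

variable {E : Type*} [NormedAddCommGroup E] [InnerProductSpace ℝ E] {ι : Type*} [Fintype ι]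
  [DecidableEq ι] {b : OrthonormalBasis ι ℝ E} {l : ι → ℝ} {u g : E → ℝ} {x₀ : E} {j : ℕ}

theorem hasTwoJet_minorSum_formMatrix_line (hu : ContDiffAt ℝ 4 u x₀)
    (hl : formMatrix b (fderiv ℝ (fderiv ℝ u) x₀) = Matrix.diagonal l)
    (hj : j + 2 ≤ Fintype.card ι) (v : E) :
    HasTwoJet (fun t => minorSum (j + 2) (formMatrix b (fderiv ℝ (fderiv ℝ u) (x₀ + t • v))))
      (esymm Finset.univ (j + 2) l)
      (∑ i, esymm (Finset.univ.erase i) (j + 1) l *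
        dirDeriv v (dirDeriv (b i) (dirDeriv (b i) u)) x₀)
      (∑ i, esymm (Finset.univ.erase i) (j + 1) l *
          dirDeriv v (dirDeriv v (dirDeriv (b i) (dirDeriv (b i) u))) x₀ +
        ∑ i, ∑ p ∈ Finset.univ.erase i, esymm ((Finset.univ.erase i).erase p) j l *
          (dirDeriv v (dirDeriv (b i) (dirDeriv (b i) u)) x₀ *
              dirDeriv v (dirDeriv (b p) (dirDeriv (b p) u)) x₀ -
            dirDeriv v (dirDeriv (b i) (dirDeriv (b p) u)) x₀ *
              dirDeriv v (dirDeriv (b p) (dirDeriv (b i) u)) x₀)) := by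
  refine HasTwoJet.minorSum hj
    (B := Matrix.of fun p q => dirDeriv v (dirDeriv (b p) (dirDeriv (b q) u)) x₀)
    (C := Matrix.of fun p q => dirDeriv v (dirDeriv v (dirDeriv (b p) (dirDeriv (b q) u))) x₀)
    fun p q => ?_
  have hentry := hasTwoJet_line (contDiffAt_dirDeriv (contDiffAt_dirDeriv hu (m := 3)
    (by norm_num) (b q)) (m := 2) (by norm_num) (b p)) v
  refine (hentry.congr ?_).congr_coeff
    (dirDeriv_dirDeriv_basis (hu.of_le (by norm_num)) hl p q) rfl rfl
  have hline : Tendsto (fun t : ℝ => x₀ + t • v) (𝓝 0) (𝓝 x₀) :=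
    Continuous.tendsto' (by fun_prop) 0 x₀ (by simp)
  filter_upwards [hline.eventually ((hu.of_le (m := 2) (by norm_num)).eventually (by simp))]
    with t ht
  exact (dirDeriv_dirDeriv ht (b p) (b q)).symm

/-- The equation `σ_k(D²u) = g^{k-1}`, `k = j + 2`, at a point where `D²u` is diagonal with
eigenvalues `l` in the basis `b`, differentiated up to twice in every direction, with the bounds
that a `C^{1,1}` estimate for `f^{1/(k-1)}` gives for the derivatives of `g = f^{1/(k-1)}(x, u)`. -/
structure DifferentiatedEquation (b : OrthonormalBasis ι ℝ E) (u : E → ℝ) (x₀ : E) (l : ι → ℝ)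
    (j : ℕ) (C g : ℝ) : Prop where
  pos : 0 < g
  le : g ≤ C
  pow_eq : g ^ (j + 1) = esymm Finset.univ (j + 2) l
  exists_deriv : ∀ v : E, ‖v‖ = 1 → ∃ g₁ g₂ : ℝ,
    |g₁| ≤ C ∧ |g₂| ≤ C * (1 + |fderiv ℝ (fderiv ℝ u) x₀ v v|) ∧
    ∑ i, esymm (Finset.univ.erase i) (j + 1) l *
      dirDeriv v (dirDeriv (b i) (dirDeriv (b i) u)) x₀ = (j + 1) * g ^ j * g₁ ∧
    ∑ i, esymm (Finset.univ.erase i) (j + 1) l *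
        dirDeriv v (dirDeriv v (dirDeriv (b i) (dirDeriv (b i) u))) x₀ +
      ∑ i, ∑ p ∈ Finset.univ.erase i, esymm ((Finset.univ.erase i).erase p) j l *
        (dirDeriv v (dirDeriv (b i) (dirDeriv (b i) u)) x₀ *
            dirDeriv v (dirDeriv (b p) (dirDeriv (b p) u)) x₀ -
          dirDeriv v (dirDeriv (b i) (dirDeriv (b p) u)) x₀ *
            dirDeriv v (dirDeriv (b p) (dirDeriv (b i) u)) x₀) =
      (j + 1) * (j * g ^ (j - 1)) * g₁ ^ 2 + (j + 1) * g ^ j * g₂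

theorem differentiatedEquation_of_eventually {C : ℝ} (hu : ContDiffAt ℝ 4 u x₀)
    (hl : formMatrix b (fderiv ℝ (fderiv ℝ u) x₀) = Matrix.diagonal l)
    (hj : j + 2 ≤ Fintype.card ι) (hpos : ∀ᶠ x in 𝓝 x₀, 0 < g x)
    (heq : ∀ᶠ x in 𝓝 x₀, g x ^ (j + 1) = minorSum (j + 2) (formMatrix b (fderiv ℝ (fderiv ℝ u) x)))
    (hle : g x₀ ≤ C)
    (hbounds : ∀ v, ‖v‖ = 1 → ∀ g₁ g₂, HasTwoJet (fun t => g (x₀ + t • v)) (g x₀) g₁ g₂ →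
      |g₁| ≤ C ∧ |g₂| ≤ C * (1 + |fderiv ℝ (fderiv ℝ u) x₀ v v|)) :
    DifferentiatedEquation b u x₀ l j C (g x₀) := by
  refine ⟨hpos.self_of_nhds, hle, ?_, fun v hv => ?_⟩
  · rw [heq.self_of_nhds, hl, minorSum_diagonal hj]
  have hline : Tendsto (fun t : ℝ => x₀ + t • v) (𝓝 0) (𝓝 x₀) :=
    Continuous.tendsto' (by fun_prop) 0 x₀ (by simp)
  obtain ⟨g₁, g₂, hjet, hfirst, hsecond⟩ := exists_hasTwoJet_root j
    (hasTwoJet_minorSum_formMatrix_line hu hl hj v) (hline.eventually hpos) (hline.eventually heq)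
  simp only [zero_smul, add_zero] at hjet hfirst hsecond
  exact ⟨g₁, g₂, (hbounds v hv g₁ g₂ hjet).1, (hbounds v hv g₁ g₂ hjet).2, hfirst, hsecond⟩

end DifferentiatedEquation

section Concavity

variable {ι : Type*} [Fintype ι] {l ξ : ι → ℝ}

theorem InGardingCone.sum_pos_of_card_add {j : ℕ} (hl : InGardingCone Finset.univ (j + 2) l)
    {S : Finset ι} (hS : S.card + (j + 1) = Fintype.card ι) : 0 < ∑ p ∈ S, l p := by
  classical
  have hcompl : Sᶜ.card = j + 1 := by rw [Finset.card_compl]; omega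
  have hcone : InGardingCone (Finset.univ \ Sᶜ) 1 l := by
    refine InGardingCone.sdiff (Finset.subset_univ _) ?_
    rwa [hcompl, show 1 + (j + 1) = j + 2 by ring]
  rw [← esymm_one, ← compl_compl S, Finset.compl_eq_univ_sdiff Sᶜ]
  exact hcone 1 le_rfl

theorem InGardingCone.add_two_le_card {j : ℕ} (hl : InGardingCone Finset.univ (j + 2) l)
    {S : Finset ι} (hS : S.card + (j + 1) = Fintype.card ι) : j + 2 ≤ Fintype.card ι := by
  have := (Finset.nonempty_of_sum_ne_zero (hl.sum_pos_of_card_add hS).ne').card_pos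
  omega

variable [DecidableEq ι]

theorem InGardingCone.sum_sum_esymm_erase_erase_mul_le {J : Finset ι}
    (hJ : J.card + 2 ≤ Fintype.card ι) (hl : InGardingCone Finset.univ (J.card + 2) l) {g g₁ : ℝ}
    (hg : 0 < g) (hpow : g ^ (J.card + 1) = esymm Finset.univ (J.card + 2) l)
    (hlin : ∑ i, esymm (Finset.univ.erase i) (J.card + 1) l * ξ i =
      (J.card + 1) * g ^ J.card * g₁) :
    ∑ i, ∑ p ∈ Finset.univ.erase i, esymm ((Finset.univ.erase i).erase p) J.card l * (ξ i * ξ p) ≤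
      (J.card + 1) * (J.card * g ^ (J.card - 1)) * g₁ ^ 2 +
        2 * g ^ J.card * g₁ * (esymm Jᶜ 1 ξ / esymm Jᶜ 1 l) := by
  have hconcave := hl.log_esymm_second_deriv_le (Finset.subset_univ J) ξ
    (hasTwoJet_esymm_add_smul hJ l ξ)
  rw [← Finset.compl_eq_univ_sdiff, hlin, ← hpow] at hconcave
  set r : ℝ := esymm Jᶜ 1 ξ / esymm Jᶜ 1 l
  set j := J.card
  set s := ∑ i, ∑ p ∈ Finset.univ.erase i, esymm ((Finset.univ.erase i).erase p) j l * (ξ i * ξ p)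
  have hlogderiv : (j + 1) * g ^ j * g₁ / g ^ (j + 1) = (j + 1) * (g₁ / g) := by
    rw [pow_succ]
    field_simp
  have hcomplete_sq : -r ^ 2 - ((j : ℝ) + 1)⁻¹ * ((j + 1) * (g₁ / g) - r) ^ 2 +
      ((j + 1) * (g₁ / g)) ^ 2 ≤ (j + 1) * j * (g₁ / g) ^ 2 + 2 * (g₁ / g) * r := by
    have hexpand : ((j : ℝ) + 1)⁻¹ * ((j + 1) * (g₁ / g) - r) ^ 2 =
        (j + 1) * (g₁ / g) ^ 2 - 2 * (g₁ / g) * r + ((j : ℝ) + 1)⁻¹ * r ^ 2 := by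
      field_simp
      ring
    have hr : 0 ≤ ((j : ℝ) + 1)⁻¹ * r ^ 2 := by positivity
    linarith [sq_nonneg r]
  rw [hlogderiv] at hconcave
  have hbound : s / g ^ (j + 1) ≤ (j + 1) * j * (g₁ / g) ^ 2 + 2 * (g₁ / g) * r := by
    linarith
  rw [div_le_iff₀ (by positivity)] at hbound
  refine hbound.trans_eq ?_
  -- the truncated exponent `j - 1` only occurs with the factor `j`
  cases j with
  | zero =>
    simp only [CharP.cast_eq_zero]
    field_simp
    ring
  | succ j =>
    rw [Nat.add_sub_cancel]
    field_simp
    ring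

variable {S : Finset ι} {o : ι} {j : ℕ} {T : ι → ℝ} {g g₁ C : ℝ}

theorem InGardingCone.sum_sum_esymm_erase_erase_mul_le_abs
    (hl : InGardingCone Finset.univ (j + 2) l) (hlo : 0 < l o) (hoS : o ∉ S)
    (hS : S.card + (j + 1) = Fintype.card ι) (hg : 0 < g)
    (hpow : g ^ (j + 1) = esymm Finset.univ (j + 2) l)
    (hlin : ∑ i, esymm (Finset.univ.erase i) (j + 1) l * ξ i = (j + 1) * g ^ j * g₁)
    (hg₁ : |g₁| ≤ C) :
    ∑ i, ∑ p ∈ Finset.univ.erase i, esymm ((Finset.univ.erase i).erase p) j l * (ξ i * ξ p) ≤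
      (j + 1) * (j * g ^ (j - 1)) * g₁ ^ 2 +
        2 * g ^ j * C * (|ξ o| + ∑ p ∈ S, |ξ p|) / l o := by
  have hC : 0 ≤ C := (abs_nonneg _).trans hg₁
  have hJcard : (insert o S)ᶜ.card = j := by
    rw [Finset.card_compl, Finset.card_insert_of_notMem hoS]; omega
  have htail := hl.sum_pos_of_card_add hS
  subst hJcard
  refine (hl.sum_sum_esymm_erase_erase_mul_le (hl.add_two_le_card hS) hg hpow hlin).trans ?_
  rw [compl_compl, esymm_one, esymm_one, Finset.sum_insert hoS, Finset.sum_insert hoS]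
  have hratio : |(ξ o + ∑ p ∈ S, ξ p) / (l o + ∑ p ∈ S, l p)| ≤
      (|ξ o| + ∑ p ∈ S, |ξ p|) / l o := by
    rw [abs_div, abs_of_pos (by linarith : 0 < l o + ∑ p ∈ S, l p)]
    refine div_le_div₀ (by positivity) ?_ hlo (by linarith)
    exact (abs_add_le _ _).trans (by gcongr; exact Finset.abs_sum_le_sum_abs _ _)
  rw [mul_assoc (2 * g ^ _) g₁, mul_assoc (2 * g ^ _) C, mul_div_assoc (2 * g ^ _),
    mul_div_assoc C]
  refine add_le_add_right (mul_le_mul_of_nonneg_left ?_ (by positivity)) _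
  refine (le_abs_self _).trans ?_
  rw [abs_mul]
  gcongr

theorem InGardingCone.two_mul_sum_le_sum_sum (hl : InGardingCone Finset.univ (j + 2) l) (o : ι)
    {U : ι → ι → ℝ} (hU : ∀ i p, U i p = U p i) :
    2 * ∑ i ∈ Finset.univ.erase o, esymm ((Finset.univ.erase o).erase i) j l * U o i ^ 2 ≤
      ∑ i, ∑ p ∈ Finset.univ.erase i,
        esymm ((Finset.univ.erase i).erase p) j l * (U i p * U p i) := by
  have hterm : ∀ i, ∀ p ∈ Finset.univ.erase i,
      0 ≤ esymm ((Finset.univ.erase i).erase p) j l * (U i p * U p i) := by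
    intro i p hp
    rw [hU i p, ← sq]
    exact mul_nonneg (((hl.erase (Finset.mem_univ i)).erase hp) j le_rfl).le (sq_nonneg _)
  rw [← Finset.add_sum_erase _ _ (Finset.mem_univ o), two_mul]
  refine add_le_add (Finset.sum_le_sum fun i _ => by rw [hU i o, sq])
    (Finset.sum_le_sum fun i hi => ?_)
  have ho : o ∈ Finset.univ.erase i :=
    Finset.mem_erase.2 ⟨(Finset.ne_of_mem_erase hi).symm, Finset.mem_univ o⟩
  refine le_trans (le_of_eq ?_) (Finset.single_le_sum (hterm i) ho)
  rw [Finset.erase_right_comm, hU i o, sq]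

theorem InGardingCone.le_sum_esymm_erase_mul_fourth_order
    (hl : InGardingCone Finset.univ (j + 2) l) (hlo : 0 < l o) (hoS : o ∉ S)
    (hS : S.card + (j + 1) = Fintype.card ι) (hg : 0 < g)
    (hpow : g ^ (j + 1) = esymm Finset.univ (j + 2) l) {Q : ι → ℝ} {U : ι → ι → ℝ} {g₂ : ℝ}
    (hU : ∀ i p, U i p = U p i)
    (hlin : ∑ i, esymm (Finset.univ.erase i) (j + 1) l * U i i = (j + 1) * g ^ j * g₁)
    (hquad : ∑ i, esymm (Finset.univ.erase i) (j + 1) l * Q i +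
        ∑ i, ∑ p ∈ Finset.univ.erase i, esymm ((Finset.univ.erase i).erase p) j l *
          (U i i * U p p - U i p * U p i) =
        (j + 1) * (j * g ^ (j - 1)) * g₁ ^ 2 + (j + 1) * g ^ j * g₂)
    (hg₁ : |g₁| ≤ C) (hg₂ : |g₂| ≤ C * (1 + l o)) :
    -(2 * g ^ j * C * (|U o o| + ∑ p ∈ S, |U p p|) / l o) -
        ((j + 2 : ℕ) : ℝ) * C * g ^ j * (1 + l o) +
      2 * ∑ i ∈ Finset.univ.erase o, esymm ((Finset.univ.erase o).erase i) j l * U o i ^ 2 ≤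
        ∑ i, esymm (Finset.univ.erase i) (j + 1) l * Q i := by
  have hC : 0 ≤ C := (abs_nonneg _).trans hg₁
  have hpure := hl.sum_sum_esymm_erase_erase_mul_le_abs hlo hoS hS hg hpow hlin hg₁
  have hmixed := hl.two_mul_sum_le_sum_sum o hU
  have hright : -(((j + 2 : ℕ) : ℝ) * C * g ^ j * (1 + l o)) ≤ (j + 1) * g ^ j * g₂ := by
    have hlower := mul_le_mul_of_nonneg_left (abs_le.1 hg₂).1
      (by positivity : 0 ≤ ((j : ℝ) + 1) * g ^ j)
    have hnonneg : 0 ≤ C * g ^ j * (1 + l o) := by positivity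
    push_cast
    linarith
  simp only [mul_sub, Finset.sum_sub_distrib] at hquad
  linarith

end Concavity

section LargestEigenvalue

variable {ι : Type*} {s : Finset ι} {l : ι → ℝ} {i o : ι} {j : ℕ}

theorem InGardingCone.leading_pos (hl : InGardingCone s (j + 1) l) (ho : ∀ i ∈ s, l i ≤ l o) :
    0 < l o := by
  have htrace := hl 1 (by omega)
  rw [esymm_one] at htrace
  have hsum := Finset.sum_le_card_nsmul s l (l o) ho
  rw [nsmul_eq_mul] at hsum
  exact pos_of_mul_pos_right (htrace.trans_le hsum) (by positivity)

theorem InGardingCone.le_esymm_one (hl : InGardingCone s (j + 2) l) (hi : i ∈ s) :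
    l i ≤ esymm s 1 l := by
  classical
  rw [esymm_one, ← Finset.add_sum_erase s l hi, ← esymm_one]
  linarith [(hl.erase hi) 1 (by omega)]

theorem InGardingCone.leading_sub_le (hl : InGardingCone s (j + 1) l) (ho : ∀ i ∈ s, l i ≤ l o)
    (hi : i ∈ s) : l o - l i ≤ s.card * l o := by
  classical
  have htrace := hl 1 (by omega)
  rw [esymm_one, ← Finset.add_sum_erase s l hi] at htrace
  have hsum := Finset.sum_le_card_nsmul (s.erase i) l (l o)
    fun p hp => ho p (Finset.mem_of_mem_erase hp)
  rw [Finset.card_erase_of_mem hi, nsmul_eq_mul, Nat.cast_sub (Finset.card_pos.2 ⟨i, hi⟩),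
    Nat.cast_one] at hsum
  linarith

variable [DecidableEq ι]

theorem InGardingCone.rpow_mul_le_sum_esymm_erase (hj : j + 2 ≤ s.card)
    (hl : InGardingCone s (j + 2) l) (ho : o ∈ s) (hlo : 0 ≤ l o) {g : ℝ}
    (hg : g ^ (j + 1) = esymm s (j + 2) l) :
    l o ^ ((j + 1 : ℕ) : ℝ)⁻¹ * g ^ j ≤ ∑ i ∈ s, esymm (s.erase i) (j + 1) l := by
  have hpos := hl (j + 1) (by omega)
  have hroot : l o ^ ((j + 1 : ℕ) : ℝ)⁻¹ * g ^ j ≤ esymm s (j + 1) l := by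
    refine le_of_pow_le_pow_left₀ (n := j + 1) (by omega) hpos.le ?_
    rw [mul_pow, Real.rpow_inv_natCast_pow hlo (by omega), ← pow_mul, mul_comm j, pow_mul, hg]
    refine le_trans ?_ hl.esymm_one_mul_pow_le
    have := hl (j + 2) le_rfl
    gcongr
    exact hl.le_esymm_one ho
  rw [sum_esymm_erase]
  refine hroot.trans (le_mul_of_one_le_left hpos.le ?_)
  have : ((j + 2 : ℕ) : ℝ) ≤ s.card := by exact_mod_cast hj
  push_cast at this ⊢
  linarith

theorem esymm_erase_sub_esymm_erase (ho : o ∈ s) (hi : i ∈ s) (hio : i ≠ o) :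
    esymm (s.erase i) (j + 1) l - esymm (s.erase o) (j + 1) l =
      esymm ((s.erase o).erase i) j l * (l o - l i) := by
  rw [esymm_erase (Finset.mem_erase.2 ⟨hio.symm, ho⟩), esymm_erase (Finset.mem_erase.2 ⟨hio, hi⟩),
    Finset.erase_right_comm]
  ring

end LargestEigenvalue

section LinearizedOperator

variable {E : Type*} [NormedAddCommGroup E] [InnerProductSpace ℝ E] {ι : Type*} [Fintype ι]
  [DecidableEq ι] {b : OrthonormalBasis ι ℝ E} {l : ι → ℝ} {u : E → ℝ} {x₀ : E} {j : ℕ} {C g : ℝ}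

namespace DifferentiatedEquation

theorem sum_esymm_erase_mul_eq (h : DifferentiatedEquation b u x₀ l j C g) :
    ∑ i, esymm (Finset.univ.erase i) (j + 1) l * l i = ((j + 2 : ℕ) : ℝ) * g ^ (j + 1) := by
  rw [h.pow_eq]
  simpa only [mul_comm (l _), ← Nat.cast_succ] using sum_mul_esymm_erase Finset.univ (j + 1) l

theorem abs_sum_third_order_le (h : DifferentiatedEquation b u x₀ l j C g)
    (hu : ContDiffAt ℝ 3 u x₀) {v : E} (hv : ‖v‖ = 1) :
    |∑ i, esymm (Finset.univ.erase i) (j + 1) l *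
      dirDeriv (b i) (dirDeriv (b i) (dirDeriv v u)) x₀| ≤ ((j + 2 : ℕ) : ℝ) * C * g ^ j := by
  obtain ⟨g₁, -, hg₁, -, hfirst, -⟩ := h.exists_deriv v hv
  have hg := h.pos
  have hC : 0 ≤ C := (abs_nonneg _).trans hg₁
  simp only [← dirDeriv_dirDeriv_rotate hu v]
  rw [hfirst, abs_mul, abs_of_nonneg (by positivity)]
  calc (j + 1) * g ^ j * |g₁| ≤ (j + 1) * g ^ j * C := by gcongr
    _ ≤ ((j + 2 : ℕ) : ℝ) * g ^ j * C := by gcongr; push_cast; linarith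
    _ = _ := by ring

theorem le_sum_weight (h : DifferentiatedEquation b u x₀ l j C g) (hu : ContDiffAt ℝ 3 u x₀)
    (hl : formMatrix b (fderiv ℝ (fderiv ℝ u) x₀) = Matrix.diagonal l) {A B M₁ : ℝ} (hB : 0 ≤ B)
    (hy : ∀ r, |dirDeriv (b r) u x₀| ≤ M₁) (z : E) :
    B * ∑ i, esymm (Finset.univ.erase i) (j + 1) l * l i ^ 2 +
        A * ∑ i, esymm (Finset.univ.erase i) (j + 1) l -
        B * Fintype.card ι * M₁ * ((j + 2 : ℕ) : ℝ) * C * g ^ j ≤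
      ∑ i, esymm (Finset.univ.erase i) (j + 1) l *
        dirDeriv (b i) (dirDeriv (b i) (pogorelovWeight A B z u)) x₀ := by
  have hsplit : ∑ i, esymm (Finset.univ.erase i) (j + 1) l *
      dirDeriv (b i) (dirDeriv (b i) (pogorelovWeight A B z u)) x₀ =
        B * ∑ i, esymm (Finset.univ.erase i) (j + 1) l * l i ^ 2 +
          A * ∑ i, esymm (Finset.univ.erase i) (j + 1) l +
          B * ∑ r, dirDeriv (b r) u x₀ * ∑ i, esymm (Finset.univ.erase i) (j + 1) l *
            dirDeriv (b i) (dirDeriv (b i) (dirDeriv (b r) u)) x₀ := by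
    simp only [dirDeriv_dirDeriv_pogorelovWeight hu hl, mul_add, Finset.sum_add_distrib,
      Finset.mul_sum]
    rw [Finset.sum_comm (f := fun i r => _ * (B * (_ * _))), add_right_comm]
    simp only [mul_comm, mul_left_comm]
  have hthird : |∑ r, dirDeriv (b r) u x₀ * ∑ i, esymm (Finset.univ.erase i) (j + 1) l *
      dirDeriv (b i) (dirDeriv (b i) (dirDeriv (b r) u)) x₀| ≤
        Fintype.card ι * (M₁ * (((j + 2 : ℕ) : ℝ) * C * g ^ j)) := by
    refine (Finset.abs_sum_le_sum_abs _ _).trans ?_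
    rw [← nsmul_eq_mul]
    refine Finset.sum_le_card_nsmul _ _ _ fun r _ => ?_
    rw [abs_mul]
    exact mul_le_mul (hy r) (h.abs_sum_third_order_le hu (b.norm_eq_one r)) (abs_nonneg _)
      ((abs_nonneg _).trans (hy r))
  rw [hsplit]
  linarith [mul_le_mul_of_nonneg_left (abs_le.1 hthird).1 hB]

theorem le_sum_fourth_order (h : DifferentiatedEquation b u x₀ l j C g) (hu : ContDiffAt ℝ 4 u x₀)
    (hl : formMatrix b (fderiv ℝ (fderiv ℝ u) x₀) = Matrix.diagonal l)
    (hcone : InGardingCone Finset.univ (j + 2) l) {S : Finset ι} {o : ι} (hlo : 0 < l o)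
    (hoS : o ∉ S) (hS : S.card + (j + 1) = Fintype.card ι) :
    -(2 * g ^ j * C * (|dirDeriv (b o) (dirDeriv (b o) (dirDeriv (b o) u)) x₀| +
          ∑ p ∈ S, |dirDeriv (b o) (dirDeriv (b p) (dirDeriv (b p) u)) x₀|) / l o) -
        ((j + 2 : ℕ) : ℝ) * C * g ^ j * (1 + l o) +
      2 * ∑ i ∈ Finset.univ.erase o, esymm ((Finset.univ.erase o).erase i) j l *
        dirDeriv (b i) (dirDeriv (b o) (dirDeriv (b o) u)) x₀ ^ 2 ≤
        ∑ i, esymm (Finset.univ.erase i) (j + 1) l *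
          dirDeriv (b i) (dirDeriv (b i) (dirDeriv (b o) (dirDeriv (b o) u))) x₀ := by
  obtain ⟨g₁, g₂, hg₁, hg₂, hfirst, hsecond⟩ := h.exists_deriv (b o) (b.norm_eq_one o)
  have hu₃ : ContDiffAt ℝ 3 u x₀ := hu.of_le (by norm_num)
  rw [form_apply_self_of_diagonal hl, abs_of_pos hlo] at hg₂
  simp only [dirDeriv_dirDeriv_dirDeriv_comm hu (b o)] at hsecond
  simpa only [← dirDeriv_dirDeriv_rotate hu₃ _ (b o) (b o)] using
    hcone.le_sum_esymm_erase_mul_fourth_order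
      (U := fun i p => dirDeriv (b o) (dirDeriv (b i) (dirDeriv (b p) u)) x₀) hlo hoS hS h.pos
      h.pow_eq (fun i p => dirDeriv_dirDeriv_comm_right (hu.of_le (by norm_num)) _ _ _) hfirst
      hsecond hg₁ hg₂

theorem le_sum_fourth_order_of_normalized (h : DifferentiatedEquation b u x₀ l j C g)
    (hu : ContDiffAt ℝ 4 u x₀) (hl : formMatrix b (fderiv ℝ (fderiv ℝ u) x₀) = Matrix.diagonal l)
    (hcone : InGardingCone Finset.univ (j + 2) l) {S : Finset ι} {o : ι} (hlo : 0 < l o)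
    (hoS : o ∉ S) (hS : S.card + (j + 1) = Fintype.card ι) :
    -(2 * g ^ j * C * (l o * |dirDeriv (b o) (dirDeriv (b o) (dirDeriv (b o) u)) x₀ / l o| +
          ∑ p ∈ S, |dirDeriv (b o) (dirDeriv (b p) (dirDeriv (b p) u)) x₀|) / l o) -
        ((j + 2 : ℕ) : ℝ) * C * g ^ j * (1 + l o) +
      2 * (l o ^ 2 * ∑ i ∈ Finset.univ.erase o, esymm ((Finset.univ.erase o).erase i) j l *
        (dirDeriv (b i) (dirDeriv (b o) (dirDeriv (b o) u)) x₀ / l o) ^ 2) ≤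
        ∑ i, esymm (Finset.univ.erase i) (j + 1) l *
          dirDeriv (b i) (dirDeriv (b i) (dirDeriv (b o) (dirDeriv (b o) u))) x₀ := by
  refine le_of_eq_of_le ?_ (h.le_sum_fourth_order hu hl hcone hlo hoS hS)
  rw [abs_div, abs_of_pos hlo, mul_div_cancel₀ _ hlo.ne', Finset.mul_sum]
  congr 2
  refine Finset.sum_congr rfl fun i _ => ?_
  field_simp

end DifferentiatedEquation

end LinearizedOperator

section MaximumPoint

open Filter Topology

variable {E : Type*} [NormedAddCommGroup E] [InnerProductSpace ℝ E] {ι : Type*} [Fintype ι]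
  [DecidableEq ι] {b : OrthonormalBasis ι ℝ E} {l : ι → ℝ} {o : ι} {u ub : E → ℝ} {x₀ z : E}
  {A B : ℝ} {m : ℕ}

theorem eventually_sub_le_exp_rotatingField (hu : ContDiffAt ℝ 2 u x₀)
    (hl : formMatrix b (fderiv ℝ (fderiv ℝ u) x₀) = Matrix.diagonal l) (hlo : 0 < l o) (hm : m ≠ 0)
    (hW : 0 < ub x₀ - u x₀)
    (hmax : ∀ᶠ x in 𝓝 x₀, ∀ v, pogorelovFunction m A B z u ub x v ≤
      pogorelovFunction m A B z u ub x₀ (b o) * ‖v‖ ^ 2) (a : ι → ℝ) :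
    ∀ᶠ x in 𝓝 x₀, ub x - u x ≤ (ub x₀ - u x₀) * Real.exp
      ((touchingExponent A B z u (rotatingField b o a x₀) x -
        touchingExponent A B z u (rotatingField b o a x₀) x₀) / m) := by
  have hform := form_apply_self_of_diagonal hl o
  refine eventually_sub_le_exp_of_isMax hm hW hu
    (contDiff_rotatingField (k := 0) o a).continuous.continuousAt ?_ ?_ ?_
  · simp
  · simpa [hform] using hlo
  · simpa using hmax

theorem contDiffAt_touchingExponent_rotatingField (hu : ContDiffAt ℝ 4 u x₀)
    (hl : formMatrix b (fderiv ℝ (fderiv ℝ u) x₀) = Matrix.diagonal l) (hlo : 0 < l o)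
    (a : ι → ℝ) : ContDiffAt ℝ 2 (touchingExponent A B z u (rotatingField b o a x₀)) x₀ := by
  have hform := form_apply_self_of_diagonal hl o
  refine contDiffAt_touchingExponent b hu (contDiff_rotatingField o a).contDiffAt ?_ ?_
  · simpa using b.orthonormal.ne_zero o
  · simpa [hform] using hlo

theorem abs_first_order_le_of_isMax (hu : ContDiffAt ℝ 4 u x₀) (hub : DifferentiableAt ℝ ub x₀)
    (hl : formMatrix b (fderiv ℝ (fderiv ℝ u) x₀) = Matrix.diagonal l) (hlo : 0 < l o) (hm : m ≠ 0)
    (hW : 0 < ub x₀ - u x₀)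
    (hmax : ∀ᶠ x in 𝓝 x₀, ∀ v, pogorelovFunction m A B z u ub x v ≤
      pogorelovFunction m A B z u ub x₀ (b o) * ‖v‖ ^ 2) (i : ι) :
    |dirDeriv (b i) (pogorelovWeight A B z u) x₀ +
        dirDeriv (b i) (dirDeriv (b o) (dirDeriv (b o) u)) x₀ / l o| ≤
      m * ‖fderiv ℝ ub x₀ - fderiv ℝ u x₀‖ / (ub x₀ - u x₀) := by
  set ψ := touchingExponent A B z u (rotatingField b o 0 x₀)
  have hψ : ContDiffAt ℝ 2 ψ x₀ := contDiffAt_touchingExponent_rotatingField hu hl hlo 0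
  have htouch := fderiv_touching (Nat.cast_ne_zero.2 hm) hub (hu.differentiableAt (by norm_num))
    (hψ.differentiableAt (by norm_num))
    (eventually_sub_le_exp_rotatingField (hu.of_le (by norm_num)) hl hlo hm hW hmax 0)
  have hψ' : fderiv ℝ ψ x₀ (b i) = -(dirDeriv (b i) (pogorelovWeight A B z u) x₀ +
      dirDeriv (b i) (dirDeriv (b o) (dirDeriv (b o) u)) x₀ / l o) := by
    rw [neg_add']
    exact ((hasTwoJet_line hψ (b i)).unique
      (hasTwoJet_touchingExponent hu hl (a := 0) rfl hlo i)).2.1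
  have happly := congrArg (fun L => ‖L (b i)‖) htouch
  simp only [smul_apply, hψ', norm_smul, norm_neg] at happly
  rw [le_div_iff₀ hW, mul_comm |_|, ← Real.norm_eq_abs, ← Real.norm_of_nonneg hW.le, ← happly,
    Real.norm_natCast]
  gcongr
  exact ContinuousLinearMap.unit_le_opNorm _ _ (b.norm_eq_one i).le

variable [FiniteDimensional ℝ E] [MeasurableSpace E] [BorelSpace E] {μ : Measure E}
  [μ.IsAddHaarMeasure] {Ω : Set E} {D K : ℝ≥0} {S : Finset ι}

/-- The direction of the test function is rotated towards each `b i`, `i ∈ S`, at the speed for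
which `rotation_gain` makes the mixed third derivatives negative definite. -/
theorem second_order_nonneg_of_isMax {F : ι → ℝ} (hF : ∀ i, 0 ≤ F i) (hu : ContDiffAt ℝ 4 u x₀)
    (hl : formMatrix b (fderiv ℝ (fderiv ℝ u) x₀) = Matrix.diagonal l) (hlo : 0 < l o)
    (hgap : ∀ i, l o - l i ≤ Fintype.card ι * l o) (hoS : o ∉ S) (hΩ : IsOpen Ω) (hx₀ : x₀ ∈ Ω)
    (hdiff : ∀ x ∈ Ω, DifferentiableAt ℝ ub x) (hD : ∀ x ∈ Ω, ‖fderiv ℝ ub x‖₊ ≤ D)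
    (hK : LipschitzOnWith K (fderiv ℝ ub) Ω)
    (hae : ∀ᵐ x ∂μ.restrict Ω, DifferentiableAt ℝ (fderiv ℝ ub) x ∧
      0 ≤ ∑ i, F i * fderiv ℝ (fderiv ℝ ub) x (b i) (b i))
    (hm : m ≠ 0) (hW : 0 < ub x₀ - u x₀)
    (hmax : ∀ᶠ x in 𝓝 x₀, ∀ v, pogorelovFunction m A B z u ub x v ≤
      pogorelovFunction m A B z u ub x₀ (b o) * ‖v‖ ^ 2) :
    0 ≤ m * (∑ i, F i * l i) / (ub x₀ - u x₀) +
      ∑ i, F i * ((dirDeriv (b i) (pogorelovWeight A B z u) x₀ +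
        dirDeriv (b i) (dirDeriv (b o) (dirDeriv (b o) u)) x₀ / l o) ^ 2 / m +
          (dirDeriv (b i) (dirDeriv (b o) (dirDeriv (b o) u)) x₀ / l o) ^ 2) -
      ∑ i, F i * dirDeriv (b i) (dirDeriv (b i) (pogorelovWeight A B z u)) x₀ -
      (∑ i, F i * dirDeriv (b i) (dirDeriv (b i) (dirDeriv (b o) (dirDeriv (b o) u))) x₀) / l o -
      ∑ p ∈ S, F p * (2 * dirDeriv (b o) (dirDeriv (b p) (dirDeriv (b p) u)) x₀ ^ 2 /
        (Fintype.card ι * l o ^ 2)) := by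
  set ξ : ι → ℝ := fun i => dirDeriv (b o) (dirDeriv (b i) (dirDeriv (b i) u)) x₀
  set a : ι → ℝ := fun i => if i ∈ S then ξ i / (Fintype.card ι * l o) else 0 with ha
  have hcard : (0 : ℝ) < Fintype.card ι := by exact_mod_cast Fintype.card_pos_iff.2 ⟨o⟩
  have hvisc := second_order_touching hΩ hdiff hD hK hF hae hx₀
    (Nat.cast_pos.2 (Nat.pos_of_ne_zero hm)) hW (hu.of_le (by norm_num))
    (contDiffAt_touchingExponent_rotatingField hu hl hlo a)
    (hasTwoJet_touchingExponent hu hl (if_neg hoS) hlo)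
    (eventually_sub_le_exp_rotatingField (hu.of_le (by norm_num)) hl hlo hm hW hmax a)
  simp only [dirDeriv_dirDeriv_basis (hu.of_le (m := 2) (by norm_num)) hl,
    Matrix.diagonal_apply_eq] at hvisc
  have hrotation : ∀ i, 2 * a i ^ 2 - (4 * a i * ξ i + 2 * a i ^ 2 * l i) / l o ≤
      -(if i ∈ S then 2 * ξ i ^ 2 / (Fintype.card ι * l o ^ 2) else 0) := by
    intro i
    by_cases hi : i ∈ S
    · simpa only [ha, hi, if_true] using rotation_gain hcard hlo (hgap i)
    · simp [ha, hi]
  have hS : ∑ p ∈ S, F p * (2 * ξ p ^ 2 / (Fintype.card ι * l o ^ 2)) =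
      ∑ i, F i * if i ∈ S then 2 * ξ i ^ 2 / (Fintype.card ι * l o ^ 2) else 0 := by
    simp only [mul_ite, mul_zero, Finset.sum_ite_mem, Finset.univ_inter]
  rw [hS, Finset.sum_div, add_sub_assoc, add_sub_assoc, add_sub_assoc]
  refine hvisc.trans (add_le_add le_rfl ?_)
  rw [← Finset.sum_sub_distrib, ← Finset.sum_sub_distrib, ← Finset.sum_sub_distrib]
  refine Finset.sum_le_sum fun i _ => ?_
  linear_combination mul_le_mul_of_nonneg_left (hrotation i) (hF i)

theorem mul_rpow_le_of_isMax {j : ℕ} {C c₀ g M M₁ R : ℝ} (hu : ContDiffAt ℝ 4 u x₀)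
    (hl : formMatrix b (fderiv ℝ (fderiv ℝ u) x₀) = Matrix.diagonal l) (ho : ∀ i, l i ≤ l o)
    (hcone : InGardingCone Finset.univ (j + 2) l)
    (heq : DifferentiatedEquation b u x₀ l j C g) (hc₀ : 0 < c₀) (hoS : o ∉ S)
    (hS : S.card + (j + 1) = Fintype.card ι)
    (hFS : ∀ p ∈ S, c₀ * ∑ i, esymm (Finset.univ.erase i) (j + 1) l ≤
      esymm (Finset.univ.erase p) (j + 1) l)
    (hΩ : IsOpen Ω) (hx₀ : x₀ ∈ Ω) (hdiff : ∀ x ∈ Ω, DifferentiableAt ℝ ub x)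
    (hD : ∀ x ∈ Ω, ‖fderiv ℝ ub x‖₊ ≤ D) (hK : LipschitzOnWith K (fderiv ℝ ub) Ω)
    (hae : ∀ᵐ x ∂μ.restrict Ω, DifferentiableAt ℝ (fderiv ℝ ub) x ∧
      0 ≤ ∑ i, esymm (Finset.univ.erase i) (j + 1) l * fderiv ℝ (fderiv ℝ ub) x (b i) (b i))
    (hA : 0 < A) (hB : 0 ≤ B) (hm : 2 ≤ m) (hBM : 8 * B * M₁ ^ 2 ≤ 1) (hAR : 8 * A * R ^ 2 ≤ 1)
    (hM₁ : ‖fderiv ℝ u x₀‖ ≤ M₁) (hM : ‖fderiv ℝ ub x₀ - fderiv ℝ u x₀‖ ≤ M)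
    (hR : ‖x₀ - z‖ ≤ R) (hW : 0 < ub x₀ - u x₀)
    (hmax : ∀ᶠ x in 𝓝 x₀, ∀ v, pogorelovFunction m A B z u ub x v ≤
      pogorelovFunction m A B z u ub x₀ (b o) * ‖v‖ ^ 2)
    (hΛ : 1 ≤ l o) (hWΛ : 1 ≤ (ub x₀ - u x₀) * l o)
    (hlarge : 980 * Fintype.card ι * (m * M / (ub x₀ - u x₀)) ^ 2 ≤ B * l o ^ 2) :
    (ub x₀ - u x₀) * l o ^ ((j + 1 : ℕ) : ℝ)⁻¹ ≤ 2 / A * (m * (j + 2 : ℕ) * C +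
      pogorelovConst (Fintype.card ι) (j + 2) A B M M₁ R C c₀ m * (ub x₀ - u x₀)) := by
  have hlo : 0 < l o := by linarith
  have hg := heq.pos
  have hu₃ : ContDiffAt ℝ 3 u x₀ := hu.of_le (by norm_num)
  have hF : ∀ i, 0 < esymm (Finset.univ.erase i) (j + 1) l := fun i =>
    (hcone.erase (Finset.mem_univ i)) _ le_rfl
  have hy : ∀ i, |dirDeriv (b i) u x₀| ≤ M₁ := fun i =>
    (ContinuousLinearMap.unit_le_opNorm _ _ (b.norm_eq_one i).le).trans hM₁
  have hx : ∀ i, |inner ℝ (x₀ - z) (b i)| ≤ R := fun i => by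
    simpa [b.norm_eq_one i] using (abs_real_inner_le_norm (x₀ - z) (b i)).trans
      (by simpa using hR)
  have hweight := fun i => dirDeriv_pogorelovWeight hu₃ hl A B z i
  have hfirst : ∀ i, |dirDeriv (b i) (pogorelovWeight A B z u) x₀ +
      dirDeriv (b i) (dirDeriv (b o) (dirDeriv (b o) u)) x₀ / l o| ≤
        m * M / (ub x₀ - u x₀) := fun i =>
    (abs_first_order_le_of_isMax hu (hdiff x₀ hx₀) hl hlo (by omega) hW hmax i).trans (by gcongr)
  have hsecond := second_order_nonneg_of_isMax (fun i => (hF i).le) hu hl hlo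
    (fun i => hcone.leading_sub_le (fun i _ => ho i) (Finset.mem_univ i)) hoS hΩ hx₀ hdiff hD hK
    hae (by omega) hW hmax
  rw [heq.sum_esymm_erase_mul_eq] at hsecond
  have hroot := hcone.rpow_mul_le_sum_esymm_erase (hcone.add_two_le_card hS) (Finset.mem_univ o)
    hlo.le heq.pow_eq
  have hG : g ^ j ≤ ∑ i, esymm (Finset.univ.erase i) (j + 1) l := (le_mul_of_one_le_left
    (by positivity) (Real.one_le_rpow hΛ (by positivity))).trans hroot
  have hthird := sum_third_order_le (A := A) (B := B) (β := m) o hA.le hB (by exact_mod_cast hm)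
    hlo.le (fun i => (hF i).le)
    (fun i hi => (((hcone.erase (Finset.mem_univ o)).erase
      (Finset.mem_erase.2 ⟨hi, Finset.mem_univ i⟩)) j le_rfl).le)
    (fun i hi => esymm_erase_sub_esymm_erase (Finset.mem_univ o) (Finset.mem_univ i) hi)
    (fun i => by rw [hweight]; exact cutoff_gradient_sq_le hA.le hB hBM hAR (hy i) (hx i))
    (fun i => sq_le_sq' (abs_le.1 (hfirst i)).1 (abs_le.1 (hfirst i)).2) hlarge
  have hmixed := sum_mixed_third_order_le S (C := C)
    (ξ := fun p => dirDeriv (b o) (dirDeriv (b p) (dirDeriv (b p) u)) x₀) hc₀ (pow_pos hg j) hΛ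
    fun p hp => (mul_le_mul_of_nonneg_left hG hc₀.le).trans (hFS p hp)
  have hleading := abs_leading_third_order_le hA.le hB (Nat.cast_nonneg m)
    ((norm_nonneg _).trans hM) hΛ hW hWΛ (hy o) (hx o) (hfirst o) (hweight o)
  refine mul_le_of_maximum_inequalities hA (Nat.cast_nonneg m) (hg.le.trans heq.le) hW hΛ
    (pow_pos hg j) (by rw [pow_succ']; gcongr; exact heq.le) hroot hsecond hthird
    (heq.le_sum_weight hu₃ hl hB hy z)
    (heq.le_sum_fourth_order_of_normalized hu hl hcone hlo hoS hS) hmixed hleading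

end MaximumPoint

section NormBounds

variable {E : Type*} [NormedAddCommGroup E] [NormedSpace ℝ E] {w : E → ℝ} {S : Set E} {M : ℝ≥0}
  {x : E}

theorem abs_le_of_c1Norm_le (h : c1Norm w S ≤ M) (hx : x ∈ S) : |w x| ≤ M := by
  have : ‖w x‖ₑ ≤ M :=
    ((le_iSup₂ (f := fun x (_ : x ∈ S) => ‖w x‖ₑ) x hx).trans le_self_add).trans h
  exact_mod_cast enorm_le_coe.1 this

theorem nnnorm_fderiv_le_of_c1Norm_le (h : c1Norm w S ≤ M) (hx : x ∈ S) : ‖fderiv ℝ w x‖₊ ≤ M := by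
  have : ‖fderiv ℝ w x‖ₑ ≤ M :=
    ((le_iSup₂ (f := fun x (_ : x ∈ S) => ‖fderiv ℝ w x‖ₑ) x hx).trans le_add_self).trans h
  exact enorm_le_coe.1 this

theorem lipschitzOnWith_of_c11Norm_le (h : c11Norm w S ≤ M) :
    LipschitzOnWith M (fderiv ℝ w) S := by
  intro x hx y hy
  have hquotient : edist (fderiv ℝ w x) (fderiv ℝ w y) / edist x y ≤ M := by
    refine le_trans ?_ (le_add_self.trans h)
    exact (le_iSup₂ (f := fun y (_ : y ∈ S) => edist (fderiv ℝ w x) (fderiv ℝ w y) / edist x y)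
      y hy).trans (le_iSup₂ (f := fun x (_ : x ∈ S) => ⨆ y ∈ S,
        edist (fderiv ℝ w x) (fderiv ℝ w y) / edist x y) x hx)
  rcases eq_or_ne x y with rfl | hxy
  · simp
  · rwa [ENNReal.div_le_iff (edist_pos.2 hxy).ne' (edist_ne_top x y)] at hquotient

theorem MemCUpTo.exists_hessian_le [ProperSpace E] {r : ℕ} (hr : 2 ≤ r)
    (hS : Bornology.IsBounded S) (hw : MemCUpTo r w S) :
    ∃ H : ℝ, ∀ x ∈ S, ∀ v, ‖v‖ = 1 → fderiv ℝ (fderiv ℝ w) x v v ≤ H := by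
  obtain ⟨g, hg, hgw⟩ := hw.2.2 2 hr
  obtain ⟨H, hH⟩ := hS.isCompact_closure.exists_bound_of_continuousOn hg
  refine ⟨H, fun x hx v hv => ?_⟩
  have hop := (g x).le_opNorm fun _ => v
  rw [← hgw hx, iteratedFDeriv_two_apply] at hop
  simp only [hv, Finset.prod_const_one, mul_one] at hop
  refine (le_abs_self _).trans (hop.trans ?_)
  rw [hgw hx]
  exact hH x (subset_closure hx)

end NormBounds

section DiagonalForms

variable {ι E : Type*} [Fintype ι] [DecidableEq ι] [NormedAddCommGroup E] [InnerProductSpace ℝ E]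
  {b : OrthonormalBasis ι ℝ E} {H : E →L[ℝ] E →L[ℝ] ℝ} {l : ι → ℝ} {c : ℝ}

theorem form_le_of_diagonal (hl : formMatrix b H = Matrix.diagonal l) (hc : ∀ i, l i ≤ c) (v : E) :
    H v v ≤ c * ‖v‖ ^ 2 := by
  rw [form_eq_sum_of_diagonal hl, ← b.sum_sq_norm_inner_right v, Finset.mul_sum]
  refine Finset.sum_le_sum fun p _ => ?_
  rw [Real.norm_eq_abs, sq_abs, ← sq, mul_comm]
  exact mul_le_mul_of_nonneg_right (hc p) (sq_nonneg _)

theorem abs_form_le_of_diagonal (hl : formMatrix b H = Matrix.diagonal l) (hc : ∀ i, |l i| ≤ c)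
    {v w : E} (hv : ‖v‖ ≤ 1) (hw : ‖w‖ ≤ 1) : |H v w| ≤ Fintype.card ι * c := by
  have hcoord : ∀ (p : ι) {v : E}, ‖v‖ ≤ 1 → |inner ℝ (b p) v| ≤ 1 := fun p v hv =>
    (abs_real_inner_le_norm (b p) v).trans (by rwa [b.norm_eq_one, one_mul])
  rw [form_eq_sum_of_diagonal hl, ← nsmul_eq_mul]
  refine (Finset.abs_sum_le_sum_abs _ _).trans (Finset.sum_le_card_nsmul _ _ c fun p _ => ?_)
  rw [abs_mul, abs_mul]
  calc |inner ℝ (b p) v| * |inner ℝ (b p) w| * |l p| ≤ 1 * 1 * c := by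
        gcongr
        exacts [hcoord p hv, hcoord p hw, hc p]
    _ = c := by ring

end DiagonalForms

section EuclideanHessian

open Filter Topology

variable {n : ℕ} {b : OrthonormalBasis (Fin n) ℝ (EuclideanSpace ℝ (Fin n))} {l : Fin n → ℝ}
  {u : EuclideanSpace ℝ (Fin n) → ℝ} {x : EuclideanSpace ℝ (Fin n)}

theorem hessian_eq_formMatrix (u : EuclideanSpace ℝ (Fin n) → ℝ) (x : EuclideanSpace ℝ (Fin n)) :
    hessian u x = formMatrix (EuclideanSpace.basisFun (Fin n) ℝ) (fderiv ℝ (fderiv ℝ u) x) := by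
  ext p q
  simp [hessian, formMatrix]

theorem hessianNorm_le_of_diagonal
    (hl : formMatrix b (fderiv ℝ (fderiv ℝ u) x) = Matrix.diagonal l) {c : ℝ} (hc₀ : 0 ≤ c)
    (hc : ∀ i, |l i| ≤ c) : hessianNorm u x ≤ n ^ 2 * c := by
  refine Real.sqrt_le_iff.2 ⟨by positivity, ?_⟩
  have hentry : ∀ i j, hessian u x i j ^ 2 ≤ (n * c) ^ 2 := fun i j => by
    refine sq_le_sq.2 ?_
    rw [abs_of_nonneg (by positivity : 0 ≤ n * c)]
    simpa [hessian] using abs_form_le_of_diagonal hl hc (v := EuclideanSpace.single i 1)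
      (w := EuclideanSpace.single j 1) (by simp) (by simp)
  calc ∑ i, ∑ j, hessian u x i j ^ 2 ≤ ∑ _i : Fin n, ∑ _j : Fin n, (n * c) ^ 2 :=
        Finset.sum_le_sum fun i _ => Finset.sum_le_sum fun j _ => hentry i j
    _ = (n ^ 2 * c) ^ 2 := by
        simp only [Finset.sum_const, Finset.card_univ, Fintype.card_fin, nsmul_eq_mul]
        ring

theorem exists_eigenbasis_hessian {k : ℕ} (hk : 1 ≤ k) (hu : ContDiffAt ℝ 2 u x)
    (hconv : eigenvalues (hessian u x) ∈ closure (gardingCone n k))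
    (hpos : 0 < sigma k (eigenvalues (hessian u x))) :
    ∃ (b : OrthonormalBasis (Fin n) ℝ (EuclideanSpace ℝ (Fin n))) (l : Fin n → ℝ),
      Antitone l ∧ formMatrix b (fderiv ℝ (fderiv ℝ u) x) = Matrix.diagonal l ∧
        InGardingCone Finset.univ k l := by
  obtain ⟨b, τ, hanti, hdiag⟩ := exists_formMatrix_eq_diagonal (fderiv_fderiv_comm hu)
  rw [← hessian_eq_formMatrix] at hanti hdiag
  refine ⟨b, _, hanti, hdiag, fun m hm => ?_⟩
  rw [esymm_comp_perm]
  exact inGardingCone_of_mem_closure hk hconv hpos m hm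

theorem IsKConvexAEOn.sum_esymm_erase_mul_form_nonneg {j : ℕ} (hj : j + 2 ≤ n)
    {Ω : Set (EuclideanSpace ℝ (Fin n))} (hΩ : IsOpen Ω)
    (hdiff : ∀ x ∈ Ω, DifferentiableAt ℝ u x) (hconv : IsKConvexAEOn (j + 2) u Ω)
    (hl : InGardingCone Finset.univ (j + 2) l)
    (b : OrthonormalBasis (Fin n) ℝ (EuclideanSpace ℝ (Fin n))) :
    ∀ᵐ x ∂volume.restrict Ω, DifferentiableAt ℝ (fderiv ℝ u) x ∧
      0 ≤ ∑ i, esymm (Finset.univ.erase i) (j + 1) l * fderiv ℝ (fderiv ℝ u) x (b i) (b i) := by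
  filter_upwards [hconv, ae_restrict_mem hΩ.measurableSet] with x hx hxΩ
  have hderiv : ∀ᶠ y in 𝓝 x, HasFDerivAt u (fderiv ℝ u y) y := by
    filter_upwards [hΩ.mem_nhds hxΩ] with y hy using (hdiff y hy).hasFDerivAt
  exact ⟨hx.1, hl.sum_esymm_erase_mul_form_nonneg hj
    (second_derivative_symmetric_of_eventually hderiv hx.1.hasFDerivAt)
    (hessian_eq_formMatrix u x ▸ hx.2) b⟩

end EuclideanHessian

section ExistenceOfMaximum

theorem exists_isMaxOn_prod_of_le {E F : Type*} [PseudoMetricSpace E] [ProperSpace E]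
    [TopologicalSpace F] {Ω : Set E} (hbdd : Bornology.IsBounded Ω) (hΩ : IsOpen Ω) {T : Set F}
    (hT : IsCompact T) {P : E × F → ℝ} (hP : ContinuousOn P (Ω ×ˢ T)) {Q : E → ℝ}
    (hQ : ContinuousOn Q (closure Ω)) (hQ₀ : ∀ x ∈ frontier Ω, Q x = 0)
    (hPQ : ∀ p ∈ Ω ×ˢ T, P p ≤ Q p.1) {q : E × F} (hq : q ∈ Ω ×ˢ T) (hpos : 0 < P q) :
    ∃ p ∈ Ω ×ˢ T, IsMaxOn P (Ω ×ˢ T) p := by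
  set K : Set E := closure Ω ∩ Q ⁻¹' Ici (P q)
  have hKΩ : K ⊆ Ω := fun x hx => by
    by_contra hxΩ
    have hfrontier : x ∈ frontier Ω := hΩ.frontier_eq ▸ ⟨hx.1, hxΩ⟩
    have hle : P q ≤ Q x := hx.2
    exact absurd (hQ₀ x hfrontier ▸ hle) hpos.not_ge
  have hK_compact : IsCompact K := Metric.isCompact_of_isClosed_isBounded
    (hQ.preimage_isClosed_of_isClosed isClosed_closure isClosed_Ici) (hbdd.subset hKΩ)
  have hKT : K ×ˢ T ⊆ Ω ×ˢ T := prod_mono_left hKΩ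
  have hqK : q ∈ K ×ˢ T := ⟨⟨subset_closure hq.1, hPQ q hq⟩, hq.2⟩
  obtain ⟨p, hp, hmax⟩ := (hK_compact.prod hT).exists_isMaxOn ⟨q, hqK⟩ (hP.mono hKT)
  refine ⟨p, hKT hp, fun x hx => ?_⟩
  rcases le_or_gt (P q) (Q x.1) with hle | hlt
  · exact hmax ⟨⟨subset_closure hx.1, hle⟩, hx.2⟩
  · exact ((hPQ x hx).trans hlt.le).trans (hmax hqK)

variable {E : Type*} [NormedAddCommGroup E] [InnerProductSpace ℝ E] {Ω : Set E} {u ub : E → ℝ}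
  {z : E} {A B : ℝ} {m : ℕ}

theorem pogorelovFunction_smul (m : ℕ) (A B : ℝ) (z : E) (u ub : E → ℝ) (x : E) (c : ℝ) (v : E) :
    pogorelovFunction m A B z u ub x (c • v) = pogorelovFunction m A B z u ub x v * c ^ 2 := by
  simp only [pogorelovFunction, map_smul, smul_apply, smul_eq_mul]
  ring

theorem continuousOn_pogorelovFunction (hΩ : IsOpen Ω) (hu : ContDiffOn ℝ 2 u Ω)
    (hub : ContinuousOn ub Ω) (T : Set E) :
    ContinuousOn (fun p : E × E => pogorelovFunction m A B z u ub p.1 p.2) (Ω ×ˢ T) := by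
  have hu₁ : ContDiffOn ℝ 1 (fderiv ℝ u) Ω := hu.fderiv_of_isOpen hΩ (by norm_num)
  have hgrad := hu₁.continuousOn
  have hhess := hu₁.continuousOn_fderiv_of_isOpen hΩ le_rfl
  have hcutoff : ContinuousOn (fun x => ub x - u x) Ω := hub.sub hu.continuousOn
  have hweight : ContinuousOn (pogorelovWeight A B z u) Ω := by
    unfold pogorelovWeight
    fun_prop
  have hfst : MapsTo Prod.fst (Ω ×ˢ T) Ω := fun p hp => hp.1
  exact (((hcutoff.comp continuousOn_fst hfst).pow m).mul
    (((hhess.comp continuousOn_fst hfst).clm_apply continuousOn_snd).clm_apply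
      continuousOn_snd)).mul (hweight.comp continuousOn_fst hfst).rexp

theorem exists_isMax_pogorelovFunction [FiniteDimensional ℝ E] (hbdd : Bornology.IsBounded Ω)
    (hΩ : IsOpen Ω) (hu : ContDiffOn ℝ 2 u Ω) (hu₀ : ContinuousOn u (closure Ω))
    (hub : ContinuousOn ub (closure Ω)) (hle : ∀ x ∈ Ω, u x ≤ ub x)
    (hfrontier : ∀ x ∈ frontier Ω, ub x = u x) {H : ℝ}
    (hH : ∀ x ∈ Ω, ∀ v, ‖v‖ = 1 → fderiv ℝ (fderiv ℝ u) x v v ≤ H)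
    (hweight : ∀ x ∈ Ω, pogorelovWeight A B z u x ≤ 1) (hm : m ≠ 0) {y w : E} (hy : y ∈ Ω)
    (hw : ‖w‖ = 1) (hpos : 0 < pogorelovFunction m A B z u ub y w) :
    ∃ x₀ ∈ Ω, ∃ v₀, ‖v₀‖ = 1 ∧ 0 < ub x₀ - u x₀ ∧ ∀ x ∈ Ω, ∀ v,
      pogorelovFunction m A B z u ub x v ≤ pogorelovFunction m A B z u ub x₀ v₀ * ‖v‖ ^ 2 := by
  set P : E × E → ℝ := fun p => pogorelovFunction m A B z u ub p.1 p.2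
  have hyw : (y, w) ∈ Ω ×ˢ Metric.sphere (0 : E) 1 := ⟨hy, by simpa using hw⟩
  obtain ⟨⟨x₀, v₀⟩, hx₀v₀, hmax⟩ := exists_isMaxOn_prod_of_le hbdd hΩ (isCompact_sphere (0 : E) 1)
    (P := P) (Q := fun x => (ub x - u x) ^ m * (|H| * Real.exp 1))
    (continuousOn_pogorelovFunction hΩ hu (hub.mono subset_closure) _)
    (((hub.sub hu₀).pow m).mul continuousOn_const)
    (fun x hx => by rw [hfrontier x hx, sub_self, zero_pow hm, zero_mul])
    (fun p hp => by
      have hcutoff : 0 ≤ ub p.1 - u p.1 := sub_nonneg.2 (hle _ hp.1)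
      simp only [P, pogorelovFunction, mul_assoc]
      gcongr
      · exact (hH _ hp.1 _ (by simpa using hp.2)).trans (le_abs_self H)
      · exact hweight _ hp.1)
    hyw hpos
  refine ⟨x₀, hx₀v₀.1, v₀, by simpa using hx₀v₀.2, ?_, fun x hx v => ?_⟩
  · refine (sub_nonneg.2 (hle x₀ hx₀v₀.1)).lt_of_ne fun hzero => ?_
    have hP₀ : P (x₀, v₀) = 0 := by
      simp only [P, pogorelovFunction, ← hzero, zero_pow hm, zero_mul]
    exact (hpos.trans_le (hmax hyw)).ne' hP₀
  · rcases eq_or_ne v 0 with rfl | hv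
    · simp [pogorelovFunction]
    · have hunit : ‖v‖⁻¹ • v ∈ Metric.sphere (0 : E) 1 := by simp [norm_smul, hv]
      have hscaled := mul_le_mul_of_nonneg_right (hmax (a := (x, ‖v‖⁻¹ • v)) ⟨hx, hunit⟩)
        (sq_nonneg ‖v‖)
      simp only [P] at hscaled
      rwa [← pogorelovFunction_smul, smul_inv_smul₀ (norm_ne_zero_iff.2 hv)] at hscaled

end ExistenceOfMaximum

section CombinedBounds

theorem pow_mul_le_of_mul_rpow_le {j m : ℕ} (hm : j + 1 ≤ m) {M T q W Λ : ℝ} (hT : 0 ≤ T)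
    (hq : 0 ≤ q) (hW : 0 < W) (hWM : W ≤ M) (hΛ : 0 < Λ)
    (h : 1 ≤ Λ → 1 ≤ W * Λ → q ≤ W * Λ → W * Λ ^ ((j + 1 : ℕ) : ℝ)⁻¹ ≤ T) :
    W ^ m * Λ ≤ M ^ (m - 1) * (1 + M + q) + M ^ (m - (j + 1)) * T ^ (j + 1) := by
  have hM : 0 ≤ M := hW.le.trans hWM
  rcases le_or_gt (W * Λ) (1 + M + q) with hsmall | hlarge
  · calc W ^ m * Λ = W ^ (m - 1) * (W * Λ) := by
          rw [← mul_assoc, ← pow_succ, Nat.sub_add_cancel (by omega)]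
      _ ≤ M ^ (m - 1) * (1 + M + q) := by gcongr
      _ ≤ _ := le_add_of_nonneg_right (by positivity)
  · have hΛ₁ : 1 ≤ Λ := by
      by_contra! hlt
      nlinarith
    have hpow : W ^ (j + 1) * Λ ≤ T ^ (j + 1) := by
      have hroot := pow_le_pow_left₀ (by positivity)
        (h hΛ₁ (by linarith) (by linarith)) (j + 1)
      rwa [mul_pow, Real.rpow_inv_natCast_pow hΛ.le (by omega)] at hroot
    calc W ^ m * Λ = W ^ (m - (j + 1)) * (W ^ (j + 1) * Λ) := by
          rw [← mul_assoc, ← pow_add, Nat.sub_add_cancel hm]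
      _ ≤ M ^ (m - (j + 1)) * T ^ (j + 1) := by gcongr
      _ ≤ _ := le_add_of_nonneg_left (by positivity)

end CombinedBounds

section GraphJets

open Filter Topology

variable {E : Type*} [NormedAddCommGroup E] [NormedSpace ℝ E]

theorem hasDerivAt_comp_line {g : E → ℝ} {x v : E} {t : ℝ}
    (hg : DifferentiableAt ℝ g (x + t • v)) :
    HasDerivAt (fun s : ℝ => g (x + s • v)) (dirDeriv v g (x + t • v)) t := by
  have hline : HasDerivAt (fun s : ℝ => x + s • v) v t := by
    simpa using ((hasDerivAt_id t).smul_const v).const_add x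
  exact hg.hasFDerivAt.comp_hasDerivAt t hline

theorem HasTwoJet.bounds_of_graph {g : E × ℝ → ℝ} {S : Set (E × ℝ)} {M M₁ : ℝ≥0} {u : E → ℝ}
    {x v : E} (hdiff : ∀ p ∈ S, DifferentiableAt ℝ g p) (hbound : ∀ p ∈ S, ‖fderiv ℝ g p‖ ≤ M)
    (hlip : LipschitzOnWith M (fderiv ℝ g) S) (hu : ContDiffAt ℝ 2 u x)
    (hgraph : ∀ᶠ y in 𝓝 x, (y, u y) ∈ S) (hM₁ : ‖fderiv ℝ u x‖ ≤ M₁) (hv : ‖v‖ = 1) {a g₁ g₂ : ℝ}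
    (hjet : HasTwoJet (fun t => g (x + t • v, u (x + t • v))) a g₁ g₂) :
    |g₁| ≤ M * (1 + M₁) ^ 2 ∧
      |g₂| ≤ M * (1 + M₁) ^ 2 * (1 + |fderiv ℝ (fderiv ℝ u) x v v|) := by
  have hline : Tendsto (fun t : ℝ => x + t • v) (𝓝 0) (𝓝 x) :=
    Continuous.tendsto' (by fun_prop) 0 x (by simp)
  have hid (t : ℝ) : HasDerivAt (fun t : ℝ => x + t • v) v t := by
    simpa using ((hasDerivAt_id t).smul_const v).const_add x
  obtain ⟨hfirst, hsecond⟩ := hjet.bounds_of_lipschitzOnWith hdiff hbound hlip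
    (γ := fun t => (x + t • v, u (x + t • v))) (γ' := fun t => (v, dirDeriv v u (x + t • v)))
    (γ'' := (0, dirDeriv v (dirDeriv v u) x)) (hline.eventually hgraph)
    (by
      filter_upwards [hline.eventually (hu.eventually (by simp))] with t ht
      exact (hid t).prodMk (hasDerivAt_comp_line (ht.differentiableAt (by norm_num))))
    ((hasDerivAt_const _ _).prodMk (by
      simpa using hasDerivAt_comp_line (t := 0) (v := v) (by
        simpa using (contDiffAt_dirDeriv hu (m := 1) (by norm_num) v).differentiableAt (by simp))))
  have hγ' : ‖(v, dirDeriv v u (x + (0 : ℝ) • v))‖ ≤ 1 + M₁ := by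
    rw [Prod.norm_def, zero_smul, add_zero, hv]
    refine max_le (by simp) ((ContinuousLinearMap.unit_le_opNorm _ _ hv.le).trans ?_)
    exact hM₁.trans (by simp)
  have hγ'' : ‖((0 : E), dirDeriv v (dirDeriv v u) x)‖ = |fderiv ℝ (fderiv ℝ u) x v v| := by
    rw [Prod.norm_def, norm_zero, max_eq_right (norm_nonneg _), dirDeriv_dirDeriv hu,
      Real.norm_eq_abs]
  have hone : (1 : ℝ) ≤ (1 + M₁) ^ 2 := one_le_pow₀ (by simp)
  refine ⟨hfirst.trans ?_, hsecond.trans ?_⟩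
  · gcongr
    exact hγ'.trans (le_self_pow₀ (by simp) two_ne_zero)
  · rw [hγ'', mul_add, mul_one, add_comm]
    gcongr
    exact le_mul_of_one_le_right (by positivity) hone

end GraphJets

section WeightCoefficient

variable {R : ℝ}

/-- The parameters of Pogorelov's weight: `B` if `R` bounds `‖Du‖`, and `A` if `R` bounds the
diameter. They are so small that the weight takes values in `[0, 1]`. -/
def weightCoeff (R : ℝ) : ℝ := 1 / (8 * (R ^ 2 + 1))

theorem weightCoeff_pos (R : ℝ) : 0 < weightCoeff R := by
  unfold weightCoeff
  positivity

theorem eight_mul_weightCoeff_mul_sq_le_one (R : ℝ) : 8 * weightCoeff R * R ^ 2 ≤ 1 := by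
  have hquotient : 8 * weightCoeff R * R ^ 2 = R ^ 2 / (R ^ 2 + 1) := by
    unfold weightCoeff
    field_simp
  rw [hquotient, div_le_one (by positivity)]
  linarith

theorem weightCoeff_div_two_mul_sq_le {r : ℝ} (hr : 0 ≤ r) (hrR : r ≤ R) :
    weightCoeff R / 2 * r ^ 2 ≤ 1 / 16 := by
  have hmono : weightCoeff R * r ^ 2 ≤ weightCoeff R * R ^ 2 := by
    have := weightCoeff_pos R
    gcongr
  linarith [eight_mul_weightCoeff_mul_sq_le_one R]

end WeightCoefficient

section Data

variable {n k : ℕ} {R M₁ M₂ M₃ : ℝ≥0} {Ω : Set (EuclideanSpace ℝ (Fin n))}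
  {f : EuclideanSpace ℝ (Fin n) → ℝ → ℝ} {u ub : EuclideanSpace ℝ (Fin n) → ℝ}
  {x z : EuclideanSpace ℝ (Fin n)}

/-- `u` is a `k`-convex solution of `σ_k(λ(D²u)) = f(x, u)` in `Ω` that lies below the `k`-convex
barrier `ū` and agrees with it on `∂Ω`; the bounds on which the estimate may depend are `R` for
`diam Ω`, `M₁` and `M₂` for the `C¹` norms of `u` and `ū`, and `M₃` for the `C^{1,1}` norm of
`f^{1/(k-1)}`. -/
structure PogorelovData (k : ℕ) (R M₁ M₂ M₃ : ℝ≥0) (Ω : Set (EuclideanSpace ℝ (Fin n)))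
    (f : EuclideanSpace ℝ (Fin n) → ℝ → ℝ) (u ub : EuclideanSpace ℝ (Fin n) → ℝ) : Prop where
  isOpen : IsOpen Ω
  isBounded : Bornology.IsBounded Ω
  pos : ∀ x ∈ Ω, 0 < f x (u x)
  rootIsC11 : RootIsC11 k f Ω
  barrier_memC11 : MemC11 ub Ω
  barrier_isKConvexAEOn : IsKConvexAEOn k ub Ω
  memCUpTo : MemCUpTo 4 u Ω
  isKConvexOn : IsKConvexOn k u Ω
  sigma_eq : ∀ x ∈ Ω, sigma k (eigenvalues (hessian u x)) = f x (u x)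
  le_barrier : ∀ x ∈ Ω, u x ≤ ub x
  barrier_eq : ∀ x ∈ frontier Ω, ub x = u x
  diam_le : Metric.diam Ω ≤ R
  c1Norm_le : c1Norm u Ω ≤ M₁
  barrier_c1Norm_le : c1Norm ub Ω ≤ M₂
  root_c11Norm_le : c11Norm (rootRHS k f) (Ω ×ˢ Icc (sInf (u '' Ω)) (sSup (u '' Ω))) ≤ M₃

theorem RootIsC11.differentiableAt (hΩ : IsOpen Ω) (hf : RootIsC11 k f Ω)
    {p : EuclideanSpace ℝ (Fin n) × ℝ} (hp : p.1 ∈ Ω) : DifferentiableAt ℝ (rootRHS k f) p := by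
  have hC1 := (hf (|p.2| + 1) (by positivity)).1
  refine (hC1.contDiffAt ((hΩ.prod isOpen_Ioo).mem_nhds ⟨hp, ?_⟩)).differentiableAt one_ne_zero
  exact abs_lt.1 (lt_add_one _)

theorem rootRHS_pow {j : ℕ} {t : ℝ} (hf : 0 < f x t) :
    rootRHS (j + 2) f (x, t) ^ (j + 1) = f x t := by
  have hexponent : ((j + 2 : ℕ) : ℝ) - 1 = (j + 1 : ℕ) := by
    push_cast
    ring
  rw [rootRHS, hexponent, one_div]
  exact Real.rpow_inv_natCast_pow hf.le (by omega)

namespace PogorelovData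

theorem contDiffAt (h : PogorelovData k R M₁ M₂ M₃ Ω f u ub) (hx : x ∈ Ω) : ContDiffAt ℝ 4 u x :=
  h.memCUpTo.1.contDiffAt (h.isOpen.mem_nhds hx)

theorem barrier_differentiableAt (h : PogorelovData k R M₁ M₂ M₃ Ω f u ub) (hx : x ∈ Ω) :
    DifferentiableAt ℝ ub x :=
  (h.barrier_memC11.1.contDiffAt (h.isOpen.mem_nhds hx)).differentiableAt one_ne_zero

theorem exists_lipschitzOnWith_fderiv_barrier (h : PogorelovData k R M₁ M₂ M₃ Ω f u ub) :
    ∃ K, LipschitzOnWith K (fderiv ℝ ub) Ω :=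
  ⟨_, lipschitzOnWith_of_c11Norm_le (ENNReal.coe_toNNReal h.barrier_memC11.2.2.ne).ge⟩

theorem norm_fderiv_le (h : PogorelovData k R M₁ M₂ M₃ Ω f u ub) (hx : x ∈ Ω) :
    ‖fderiv ℝ u x‖ ≤ M₁ :=
  nnnorm_fderiv_le_of_c1Norm_le h.c1Norm_le hx

theorem norm_fderiv_barrier_sub_le (h : PogorelovData k R M₁ M₂ M₃ Ω f u ub) (hx : x ∈ Ω) :
    ‖fderiv ℝ ub x - fderiv ℝ u x‖ ≤ M₂ + M₁ :=
  (norm_sub_le _ _).trans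
    (add_le_add (nnnorm_fderiv_le_of_c1Norm_le h.barrier_c1Norm_le hx) (h.norm_fderiv_le hx))

theorem barrier_sub_le (h : PogorelovData k R M₁ M₂ M₃ Ω f u ub) (hx : x ∈ Ω) :
    ub x - u x ≤ M₂ + M₁ :=
  (le_abs_self _).trans <| (abs_sub _ _).trans
    (add_le_add (abs_le_of_c1Norm_le h.barrier_c1Norm_le hx) (abs_le_of_c1Norm_le h.c1Norm_le hx))

theorem norm_sub_le (h : PogorelovData k R M₁ M₂ M₃ Ω f u ub) (hx : x ∈ Ω) (hz : z ∈ Ω) :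
    ‖x - z‖ ≤ R :=
  dist_eq_norm x z ▸ (Metric.dist_le_diam_of_mem h.isBounded hx hz).trans h.diam_le

theorem pogorelovWeight_mem_Icc (h : PogorelovData k R M₁ M₂ M₃ Ω f u ub) (hx : x ∈ Ω)
    (hz : z ∈ Ω) : pogorelovWeight (weightCoeff R) (weightCoeff M₁) z u x ∈ Icc (0 : ℝ) 1 := by
  have hR := weightCoeff_pos R
  have hM₁ := weightCoeff_pos M₁
  have hgrad := weightCoeff_div_two_mul_sq_le (norm_nonneg _) (h.norm_fderiv_le hx)
  have hdist := weightCoeff_div_two_mul_sq_le (norm_nonneg _) (h.norm_sub_le hx hz)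
  unfold pogorelovWeight
  exact ⟨by positivity, by linarith⟩

theorem graph_mem (h : PogorelovData k R M₁ M₂ M₃ Ω f u ub) (hx : x ∈ Ω) :
    (x, u x) ∈ Ω ×ˢ Icc (sInf (u '' Ω)) (sSup (u '' Ω)) := by
  have hbound := fun y hy => abs_le.1 (abs_le_of_c1Norm_le h.c1Norm_le (x := y) hy)
  exact ⟨hx, csInf_le ⟨-M₁, forall_mem_image.2 fun y hy => (hbound y hy).1⟩ (mem_image_of_mem u hx),
    le_csSup ⟨M₁, forall_mem_image.2 fun y hy => (hbound y hy).2⟩ (mem_image_of_mem u hx)⟩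

theorem exists_eigenbasis (h : PogorelovData k R M₁ M₂ M₃ Ω f u ub) (hk : 1 ≤ k) (hx : x ∈ Ω) :
    ∃ (b : OrthonormalBasis (Fin n) ℝ (EuclideanSpace ℝ (Fin n))) (l : Fin n → ℝ),
      Antitone l ∧ formMatrix b (fderiv ℝ (fderiv ℝ u) x) = Matrix.diagonal l ∧
        InGardingCone Finset.univ k l :=
  exists_eigenbasis_hessian hk ((h.contDiffAt hx).of_le (by norm_num)) (h.isKConvexOn x hx)
    (h.sigma_eq x hx ▸ h.pos x hx)

theorem differentiatedEquation {j : ℕ} (h : PogorelovData (j + 2) R M₁ M₂ M₃ Ω f u ub)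
    (hj : j + 2 ≤ n) (hx : x ∈ Ω) {b : OrthonormalBasis (Fin n) ℝ (EuclideanSpace ℝ (Fin n))}
    {l : Fin n → ℝ} (hl : formMatrix b (fderiv ℝ (fderiv ℝ u) x) = Matrix.diagonal l) :
    DifferentiatedEquation b u x l j (M₃ * (1 + M₁) ^ 2) (rootRHS (j + 2) f (x, u x)) := by
  have hnhds := h.isOpen.mem_nhds hx
  have hM₃ := le_self_add.trans h.root_c11Norm_le
  have hone : (1 : ℝ) ≤ (1 + M₁) ^ 2 := one_le_pow₀ (by simp)
  refine differentiatedEquation_of_eventually (g := fun y => rootRHS (j + 2) f (y, u y))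
    (h.contDiffAt hx) hl (by simpa using hj) ?_ ?_ ?_ fun v hv g₁ g₂ hjet => ?_
  · filter_upwards [hnhds] with y hy using Real.rpow_pos_of_pos (h.pos y hy) _
  · filter_upwards [hnhds] with y hy
    have hsymm := fderiv_fderiv_comm ((h.contDiffAt hy).of_le (by norm_num))
    rw [rootRHS_pow (h.pos y hy), ← h.sigma_eq y hy, minorSum_formMatrix hsymm hj,
      hessian_eq_formMatrix]
  · exact (le_abs_self _).trans <| (abs_le_of_c1Norm_le hM₃ (h.graph_mem hx)).trans <|
      le_mul_of_one_le_right (by positivity) hone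
  · exact hjet.bounds_of_graph (fun p hp => h.rootIsC11.differentiableAt h.isOpen hp.1)
      (fun p hp => nnnorm_fderiv_le_of_c1Norm_le hM₃ hp)
      (lipschitzOnWith_of_c11Norm_le h.root_c11Norm_le) ((h.contDiffAt hx).of_le (by norm_num))
      (by filter_upwards [hnhds] with y hy using h.graph_mem hy) (h.norm_fderiv_le hx) hv

end PogorelovData

end Data

section Estimate

open Filter Topology

variable {n j m : ℕ} {R M₁ M₂ M₃ : ℝ≥0} {Ω : Set (EuclideanSpace ℝ (Fin n))}
  {f : EuclideanSpace ℝ (Fin n) → ℝ → ℝ} {u ub : EuclideanSpace ℝ (Fin n) → ℝ}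
  {x₀ y z : EuclideanSpace ℝ (Fin n)} {l : Fin n → ℝ} {o : Fin n}
  {b : OrthonormalBasis (Fin n) ℝ (EuclideanSpace ℝ (Fin n))}

/-- The bound for `(ū - u) λ₁^{1/(k-1)}` at a maximum point of Pogorelov's function, where
`k = j + 2` and `c₀ ∑ ∂σ_k/∂λᵢ ≤ ∂σ_k/∂λ_p` for `p ≥ k`. -/
def maxPointConst (n j m : ℕ) (R M₁ M₂ M₃ c₀ : ℝ) : ℝ :=
  2 / weightCoeff R * (m * (j + 2 : ℕ) * (M₃ * (1 + M₁) ^ 2) +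
    pogorelovConst n (j + 2) (weightCoeff R) (weightCoeff M₁) (M₂ + M₁) M₁ R
      (M₃ * (1 + M₁) ^ 2) c₀ m * (M₂ + M₁))

theorem maxPointConst_nonneg {c₀ : ℝ} (hc₀ : 0 ≤ c₀) : 0 ≤ maxPointConst n j m R M₁ M₂ M₃ c₀ := by
  have hA := weightCoeff_pos R
  have hP : 0 ≤ pogorelovConst n (j + 2) (weightCoeff R) (weightCoeff M₁) (M₂ + M₁) M₁ R
      (M₃ * (1 + M₁) ^ 2) c₀ m := pogorelovConst_nonneg hA.le (weightCoeff_pos M₁).le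
    (by positivity) (by positivity) (by positivity) (by positivity) hc₀ (by positivity)
  unfold maxPointConst
  positivity

theorem PogorelovData.mul_rpow_le_of_isMax (h : PogorelovData (j + 2) R M₁ M₂ M₃ Ω f u ub)
    (hj : j + 2 ≤ n) (hm : 2 ≤ m) {c₀ : ℝ} (hc₀ : 0 < c₀)
    (hFc₀ : ∀ p : Fin n, j + 1 ≤ (p : ℕ) → c₀ * ∑ i, esymm (Finset.univ.erase i) (j + 1) l ≤
      esymm (Finset.univ.erase p) (j + 1) l)
    (hx₀ : x₀ ∈ Ω) (hz : z ∈ Ω)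
    (hl : formMatrix b (fderiv ℝ (fderiv ℝ u) x₀) = Matrix.diagonal l) (ho : ∀ i, l i ≤ l o)
    (ho_zero : (o : ℕ) = 0) (hcone : InGardingCone Finset.univ (j + 2) l)
    (hW : 0 < ub x₀ - u x₀)
    (hmax : ∀ x ∈ Ω, ∀ v, pogorelovFunction m (weightCoeff R) (weightCoeff M₁) z u ub x v ≤
      pogorelovFunction m (weightCoeff R) (weightCoeff M₁) z u ub x₀ (b o) * ‖v‖ ^ 2)
    (hΛ : 1 ≤ l o) (hWΛ : 1 ≤ (ub x₀ - u x₀) * l o)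
    (hlarge : √(980 * n * (m * (M₂ + M₁)) ^ 2 / weightCoeff M₁) ≤ (ub x₀ - u x₀) * l o) :
    (ub x₀ - u x₀) * l o ^ ((j + 1 : ℕ) : ℝ)⁻¹ ≤ maxPointConst n j m R M₁ M₂ M₃ c₀ := by
  have hA := weightCoeff_pos R
  have hB := weightCoeff_pos M₁
  obtain ⟨K, hK⟩ := h.exists_lipschitzOnWith_fderiv_barrier
  have hlarge' : 980 * n * (m * (M₂ + M₁ : ℝ) / (ub x₀ - u x₀)) ^ 2 ≤
      weightCoeff M₁ * l o ^ 2 := by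
    have hsq := (Real.sqrt_le_left (by positivity)).1 hlarge
    rw [div_le_iff₀ hB, mul_pow] at hsq
    rw [div_pow, ← mul_div_assoc, div_le_iff₀ (by positivity)]
    linarith
  have hS : (Finset.Ici (⟨j + 1, hj⟩ : Fin n)).card + (j + 1) = Fintype.card (Fin n) := by
    simp only [Fin.card_Ici, Fintype.card_fin]
    omega
  have hestimate := HessianPogorelov.mul_rpow_le_of_isMax (h.contDiffAt hx₀) hl ho hcone
    (h.differentiatedEquation hj hx₀ hl) hc₀ (S := Finset.Ici ⟨j + 1, hj⟩)
    (by simp [Fin.le_def, ho_zero]) hS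
    (fun p hp => hFc₀ p (Fin.le_def.1 (Finset.mem_Ici.1 hp))) h.isOpen hx₀
    (fun x hx => h.barrier_differentiableAt hx)
    (fun x hx => nnnorm_fderiv_le_of_c1Norm_le h.barrier_c1Norm_le hx) hK
    (h.barrier_isKConvexAEOn.sum_esymm_erase_mul_form_nonneg hj h.isOpen
      (fun x hx => h.barrier_differentiableAt hx) hcone b)
    hA hB.le hm (eight_mul_weightCoeff_mul_sq_le_one M₁) (eight_mul_weightCoeff_mul_sq_le_one R)
    (h.norm_fderiv_le hx₀) (h.norm_fderiv_barrier_sub_le hx₀) (h.norm_sub_le hx₀ hz) hW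
    (by filter_upwards [h.isOpen.mem_nhds hx₀] with x hx using hmax x hx) hΛ hWΛ (by simpa)
  rw [Fintype.card_fin] at hestimate
  refine hestimate.trans ?_
  have hP : 0 ≤ pogorelovConst n (j + 2) (weightCoeff R) (weightCoeff M₁) (M₂ + M₁) M₁ R
      (M₃ * (1 + M₁) ^ 2) c₀ m := pogorelovConst_nonneg hA.le hB.le
    (by positivity) (by positivity) (by positivity) (by positivity) hc₀.le (by positivity)
  unfold maxPointConst
  gcongr
  exact h.barrier_sub_le hx₀

theorem exists_pow_mul_le_of_isMax (hj : j + 2 ≤ n) (hm : 2 ≤ m) (hjm : j + 1 ≤ m)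
    (R M₁ M₂ M₃ : ℝ≥0) : ∃ C : ℝ, 0 ≤ C ∧
      ∀ {Ω : Set (EuclideanSpace ℝ (Fin n))} {f : EuclideanSpace ℝ (Fin n) → ℝ → ℝ}
        {u ub : EuclideanSpace ℝ (Fin n) → ℝ}, PogorelovData (j + 2) R M₁ M₂ M₃ Ω f u ub →
      ∀ {x₀ z : EuclideanSpace ℝ (Fin n)}, x₀ ∈ Ω → z ∈ Ω → 0 < ub x₀ - u x₀ →
      ∀ {b : OrthonormalBasis (Fin n) ℝ (EuclideanSpace ℝ (Fin n))} {l : Fin n → ℝ}, Antitone l →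
        formMatrix b (fderiv ℝ (fderiv ℝ u) x₀) = Matrix.diagonal l →
        InGardingCone Finset.univ (j + 2) l → ∀ {o : Fin n}, (o : ℕ) = 0 →
        (∀ x ∈ Ω, ∀ v, pogorelovFunction m (weightCoeff R) (weightCoeff M₁) z u ub x v ≤
          pogorelovFunction m (weightCoeff R) (weightCoeff M₁) z u ub x₀ (b o) * ‖v‖ ^ 2) →
        (ub x₀ - u x₀) ^ m * l o ≤ C := by
  obtain ⟨c₀, hc₀, hFc₀⟩ := exists_mul_sum_esymm_erase_le hj
  set M : ℝ := M₂ + M₁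
  set q := √(980 * n * (m * M) ^ 2 / weightCoeff M₁)
  set T := maxPointConst n j m R M₁ M₂ M₃ c₀
  have hT : 0 ≤ T := maxPointConst_nonneg hc₀.le
  refine ⟨M ^ (m - 1) * (1 + M + q) + M ^ (m - (j + 1)) * T ^ (j + 1), by positivity,
    fun {Ω f u ub} h {x₀ z} hx₀ hz hW {b l} hanti hl hcone {o} ho hmax => ?_⟩
  have hlo : ∀ i, l i ≤ l o := fun i => hanti (Fin.le_def.2 (by omega))
  exact pow_mul_le_of_mul_rpow_le hjm hT (Real.sqrt_nonneg _) hW (h.barrier_sub_le hx₀)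
    (hcone.leading_pos fun i _ => hlo i) fun hΛ hWΛ hlarge =>
      h.mul_rpow_le_of_isMax hj hm hc₀ (fun p hp => hFc₀ l hanti hcone p hp) hx₀ hz hl hlo ho hcone
        hW hmax hΛ hWΛ hlarge

end Estimate

section Conclusion

variable {n j m : ℕ} {R M₁ M₂ M₃ : ℝ≥0}

theorem PogorelovData.exists_max_eigenvector {Ω : Set (EuclideanSpace ℝ (Fin n))}
    {f : EuclideanSpace ℝ (Fin n) → ℝ → ℝ} {u ub : EuclideanSpace ℝ (Fin n) → ℝ}
    (h : PogorelovData (j + 2) R M₁ M₂ M₃ Ω f u ub) (hm : m ≠ 0)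
    {y w : EuclideanSpace ℝ (Fin n)} (hy : y ∈ Ω) (hw : ‖w‖ = 1) {o : Fin n} (ho : (o : ℕ) = 0)
    (hpos : 0 < pogorelovFunction m (weightCoeff R) (weightCoeff M₁) y u ub y w) :
    ∃ x₀ ∈ Ω, 0 < ub x₀ - u x₀ ∧
      ∃ (b : OrthonormalBasis (Fin n) ℝ (EuclideanSpace ℝ (Fin n))) (l : Fin n → ℝ),
        Antitone l ∧ formMatrix b (fderiv ℝ (fderiv ℝ u) x₀) = Matrix.diagonal l ∧
        InGardingCone Finset.univ (j + 2) l ∧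
        ∀ x ∈ Ω, ∀ v, pogorelovFunction m (weightCoeff R) (weightCoeff M₁) y u ub x v ≤
          pogorelovFunction m (weightCoeff R) (weightCoeff M₁) y u ub x₀ (b o) * ‖v‖ ^ 2 := by
  obtain ⟨H, hH⟩ := h.memCUpTo.exists_hessian_le (by norm_num) h.isBounded
  obtain ⟨x₀, hx₀, v₀, hv₀, hW, hmax⟩ := exists_isMax_pogorelovFunction h.isBounded h.isOpen
    (h.memCUpTo.1.of_le (by norm_num)) h.memCUpTo.2.1 h.barrier_memC11.2.1 h.le_barrier
    h.barrier_eq hH (fun x hx => (h.pogorelovWeight_mem_Icc hx hy).2) hm hy hw hpos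
  obtain ⟨b, l, hanti, hl, hcone⟩ := h.exists_eigenbasis (by omega) hx₀
  refine ⟨x₀, hx₀, hW, b, l, hanti, hl, hcone, fun x hx v => (hmax x hx v).trans ?_⟩
  have hform : fderiv ℝ (fderiv ℝ u) x₀ v₀ v₀ ≤ fderiv ℝ (fderiv ℝ u) x₀ (b o) (b o) := by
    have hle := form_le_of_diagonal hl (fun i => hanti (Fin.le_def.2 (by omega) : o ≤ i)) v₀
    rw [hv₀, one_pow, mul_one] at hle
    rwa [form_apply_self_of_diagonal hl]
  unfold pogorelovFunction
  gcongr

theorem InGardingCone.hessianNorm_le {u : EuclideanSpace ℝ (Fin n) → ℝ}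
    {x : EuclideanSpace ℝ (Fin n)} {b : OrthonormalBasis (Fin n) ℝ (EuclideanSpace ℝ (Fin n))}
    {l : Fin n → ℝ} {o : Fin n} (hcone : InGardingCone Finset.univ (j + 1) l)
    (hl : formMatrix b (fderiv ℝ (fderiv ℝ u) x) = Matrix.diagonal l) (ho : ∀ i, l i ≤ l o) :
    hessianNorm u x ≤ n ^ 3 * l o := by
  have hlo : 0 < l o := hcone.leading_pos fun i _ => ho i
  have hn : (1 : ℝ) ≤ n := by exact_mod_cast Fin.pos o
  have habs : ∀ i, |l i| ≤ n * l o := fun i => by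
    have hlower := hcone.leading_sub_le (fun i _ => ho i) (Finset.mem_univ i)
    rw [Finset.card_univ, Fintype.card_fin] at hlower
    exact abs_le.2 ⟨by linarith, (ho i).trans (le_mul_of_one_le_left hlo.le hn)⟩
  calc hessianNorm u x ≤ n ^ 2 * (n * l o) := hessianNorm_le_of_diagonal hl (by positivity) habs
    _ = n ^ 3 * l o := by ring

theorem exists_pow_mul_eigenvalue_le (hj : j + 2 ≤ n) (hm : 2 ≤ m) (hjm : j + 1 ≤ m)
    (R M₁ M₂ M₃ : ℝ≥0) : ∃ C : ℝ,
      ∀ {Ω : Set (EuclideanSpace ℝ (Fin n))} {f : EuclideanSpace ℝ (Fin n) → ℝ → ℝ}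
        {u ub : EuclideanSpace ℝ (Fin n) → ℝ}, PogorelovData (j + 2) R M₁ M₂ M₃ Ω f u ub →
      ∀ {x : EuclideanSpace ℝ (Fin n)}, x ∈ Ω →
      ∀ {b : OrthonormalBasis (Fin n) ℝ (EuclideanSpace ℝ (Fin n))} {l : Fin n → ℝ},
        formMatrix b (fderiv ℝ (fderiv ℝ u) x) = Matrix.diagonal l →
        ∀ {o : Fin n}, (o : ℕ) = 0 → 0 < l o → (ub x - u x) ^ m * l o ≤ C := by
  obtain ⟨C₀, hC₀, hbound⟩ := exists_pow_mul_le_of_isMax hj hm hjm R M₁ M₂ M₃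
  refine ⟨C₀ * Real.exp 1, fun {Ω f u ub} h {x} hx {b l} hl {o} ho hlo => ?_⟩
  rcases (sub_nonneg.2 (h.le_barrier x hx)).eq_or_lt with hzero | hpos
  · rw [← hzero, zero_pow (by omega), zero_mul]
    positivity
  have hvalue : pogorelovFunction m (weightCoeff R) (weightCoeff M₁) x u ub x (b o) =
      (ub x - u x) ^ m * l o *
        Real.exp (pogorelovWeight (weightCoeff R) (weightCoeff M₁) x u x) := by
    rw [pogorelovFunction, form_apply_self_of_diagonal hl]
  obtain ⟨x₀, hx₀, hW, b₀, l₀, hanti, hl₀, hcone, hmax⟩ := h.exists_max_eigenvector (m := m)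
    (by omega) hx (b.norm_eq_one o) ho (by rw [hvalue]; positivity)
  calc (ub x - u x) ^ m * l o
      ≤ pogorelovFunction m (weightCoeff R) (weightCoeff M₁) x u ub x (b o) := by
        rw [hvalue]
        exact le_mul_of_one_le_right (by positivity)
          (Real.one_le_exp (h.pogorelovWeight_mem_Icc hx hx).1)
    _ ≤ pogorelovFunction m (weightCoeff R) (weightCoeff M₁) x u ub x₀ (b₀ o) := by
        simpa [b.norm_eq_one o] using hmax x hx (b o)
    _ = (ub x₀ - u x₀) ^ m * l₀ o *
          Real.exp (pogorelovWeight (weightCoeff R) (weightCoeff M₁) x u x₀) := by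
        rw [pogorelovFunction, form_apply_self_of_diagonal hl₀]
    _ ≤ C₀ * Real.exp 1 := by
        gcongr
        · exact hbound h hx₀ hx hW hanti hl₀ hcone ho hmax
        · exact (h.pogorelovWeight_mem_Icc hx₀ hx).2

end Conclusion

end HessianPogorelov

end

theorem theorem3p1_general (n k : ℕ) (hk : 2 ≤ k) (hkn : k ≤ n) (R M₁ M₂ M₃ : ℝ≥0) :
    ∃ C : ℝ, ∀ (Ω : Set (EuclideanSpace ℝ (Fin n))) (f : EuclideanSpace ℝ (Fin n) → ℝ → ℝ)
      (u ubar : EuclideanSpace ℝ (Fin n) → ℝ),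
      HessianPogorelov.PogorelovData k R M₁ M₂ M₃ Ω f u ubar →
      ∀ x ∈ Ω, (ubar x - u x) ^ HessianPogorelov.pogorelovExponent k *
        HessianPogorelov.hessianNorm u x ≤ C := by
  obtain ⟨j, rfl⟩ : ∃ j, k = j + 2 := ⟨k - 2, by omega⟩
  set m := HessianPogorelov.pogorelovExponent (j + 2) with hm_def
  have hm : 2 ≤ m ∧ j + 1 ≤ m := by
    simp only [hm_def, HessianPogorelov.pogorelovExponent]
    split_ifs <;> omega
  obtain ⟨C, hC⟩ := HessianPogorelov.exists_pow_mul_eigenvalue_le hkn hm.1 hm.2 R M₁ M₂ M₃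
  refine ⟨n ^ 3 * C, fun Ω f u ubar h x hx => ?_⟩
  obtain ⟨b, l, hanti, hl, hcone⟩ := h.exists_eigenbasis (by omega) hx
  set o : Fin n := ⟨0, by omega⟩
  have ho : ∀ i, l i ≤ l o := fun i => hanti (Fin.le_def.2 (Nat.zero_le _))
  have hcutoff : 0 ≤ ubar x - u x := sub_nonneg.2 (h.le_barrier x hx)
  calc (ubar x - u x) ^ m * HessianPogorelov.hessianNorm u x
      ≤ (ubar x - u x) ^ m * (n ^ 3 * l o) := by
        gcongr
        exact hcone.hessianNorm_le hl ho
    _ = n ^ 3 * ((ubar x - u x) ^ m * l o) := by ring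
    _ ≤ n ^ 3 * C := by
        gcongr
        exact hC h hx hl rfl (hcone.leading_pos fun i _ => ho i)

theorem theorem3p1 (n k : ℕ) (hk : 2 ≤ k) (hkn : k ≤ n) (R M₁ M₂ M₃ : ℝ≥0) :
    ∃ C : ℝ, ∀ (Ω : Set (EuclideanSpace ℝ (Fin n)))
      (f : EuclideanSpace ℝ (Fin n) → ℝ → ℝ) (φ u ubar : EuclideanSpace ℝ (Fin n) → ℝ),
      IsOpen Ω → IsConnected Ω → Bornology.IsBounded Ω →
      (∀ x ∈ Ω, ∀ z : ℝ, 0 < f x z) →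
      HessianPogorelov.RootIsC11 k f Ω →
      HessianPogorelov.MemC11 ubar Ω →
      HessianPogorelov.IsKConvexAEOn k ubar Ω →
      HessianPogorelov.MemCUpTo 4 u Ω →
      HessianPogorelov.IsKConvexOn k u Ω →
      HessianPogorelov.SolvesDirichlet k f φ u Ω →
      (∀ x ∈ Ω, u x ≤ ubar x) →
      (∀ x ∈ frontier Ω, ubar x = u x) →
      Metric.diam Ω ≤ R →
      HessianPogorelov.c1Norm u Ω ≤ M₁ →
      HessianPogorelov.c11Norm ubar Ω ≤ M₂ →
      HessianPogorelov.c11Norm (HessianPogorelov.rootRHS k f)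
        (Ω ×ˢ Set.Icc (sInf (u '' Ω)) (sSup (u '' Ω))) ≤ M₃ →
      ∀ x ∈ Ω, (ubar x - u x) ^ HessianPogorelov.pogorelovExponent k *
        HessianPogorelov.hessianNorm u x ≤ C := by
  obtain ⟨C, hC⟩ := theorem3p1_general n k hk hkn R M₁ M₂ M₃
  exact ⟨C, fun Ω f _ u ubar hΩ _ hbdd hf hroot hubar hubarconv hu huconv hsol hle hfrontier hdiam
    hM₁ hM₂ hM₃ => hC Ω f u ubar ⟨hΩ, hbdd, fun x hx => hf x hx _, hroot, hubar, hubarconv, hu,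
      huconv, hsol.1, hle, hfrontier, hdiam, hM₁, le_self_add.trans hM₂, hM₃⟩⟩
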